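/- Let $\mathcal M=(a_{ij})$ be an $N\times n$ complex matrix satisfying Hypothesis $\mathcal H$: each $a_{ij}$ either vanishes or has positive real part, and no row vanishes. Let $0\le Z<n$ be an integer such that no row of $\mathcal M$ has more than $Z$ vanishing entries, let $Z_{\mathcal M}\le Z$ be the largest number of vanishing entries in a row, and let $\ell\ge 0$ be an integer. For $w\in\mathbb C^n$ with $\mathrm{Re}(w_j)>0$ $(1\le j\le n)$ the series and integral (principal powers) $$\zeta_{N,n}(s,w,\mathcal M)=\sum_{k\in\mathbb N_0^N}\prod_{j=1}^n\Big(w_j+\sum_{i=1}^N k_ia_{ij}\Big)^{-s},\qquad \mathcal Z_{N,n}(s,w,\mathcal M)=\int_{(0,\infty)^N}\prod_{j=1}^n\Big(w_j+\sum_{i=1}^N t_ia_{ij}\Big)^{-s}dt$$ converge absolutely for $\mathrm{Re}(s)>N/(n-Z_{\mathcal M})$ and have meromorphic continuations to $s\in\mathbb C$, which are regular at $s=-\ell$ and are denoted by the same symbols. Notation. $I^n_{Z+1}$ is the set of injections $\gamma:\{1,\dots,Z+1\}\to\{1,\dots,n\}$, each extended to a permutation of $\{1,\dots,n\}$ by letting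 $\gamma(Z+2),\dots,\gamma(n)$ be the remaining elements in increasing order; $w^\gamma:=(w_{\gamma(1)},\dots,w_{\gamma(n)})$ and $\mathcal M^\gamma:=(a_{i\gamma(j)})$. Let $F_j=F_j(\mathcal M)$ be the set of $i$ with $a_{ik}=0$ for $k<j$ and $a_{ij}\ne0$. For $\sigma\in\mathbb R^n$ let $T_k=\prod_{r=1}^k\sigma_r$ if $k\le Z+1$, $T_k=\sigma_k\prod_{r=1}^{Z+1}\sigma_r$ if $k\ge Z+2$, and $$y(\sigma)=\prod_{j=1}^{Z+1}\prod_{i\in F_j}\Big(a_{ij}+\sum_{k=j+1}^{Z+1}a_{ik}\prod_{r=j+1}^k\sigma_r+\Big(\sum_{k=Z+2}^na_{ik}\sigma_k\Big)\prod_{r=j+1}^{Z+1}\sigma_r\Big),$$ $$g_{w,\mathcal M,Z}(\sigma)=\frac{\prod_{j=2}^n e^{-w_jT_j}}{y(\sigma)},\qquad \widetilde g_{w,\mathcal M,Z}(\sigma)=g_{w,\mathcal M,Z}(\sigma)\prod_{i=1}^N\varphi\Big(\sum_{j=1}^na_{ij}T_j\Big),\qquad \varphi(z)=\frac z{1-e^{-z}},\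 \varphi(0)=1.$$ Let $\alpha_j=(n+1-j)\ell+\sum_{k=j}^{Z+1}|F_k|$ for $2\le j\le Z+1$, $\alpha_j=\ell$ for $Z+2\le j\le n$, and $$D^{(q)}_{\ell,\mathcal M,Z}(h)=\frac1{q!\,\alpha_2!\cdots\alpha_n!}\,\frac{\partial^{\,q+\alpha_2+\cdots+\alpha_n}h}{\partial\sigma_1^q\,\partial\sigma_2^{\alpha_2}\cdots\partial\sigma_n^{\alpha_n}}\bigg|_{\sigma=0}.$$ Then, for all $w\in\mathbb C^n$ with $\mathrm{Re}(w_j)>0$ $(1\le j\le n)$, $$\zeta_{N,n}(-\ell,w,\mathcal M)=\frac{(-1)^N(\ell!)^n}{\prod_{j=0}^Z(n-j)}\sum_{\gamma\in I^n_{Z+1}}\sum_{q=0}^{n\ell+N}\frac{(-1)^q\,w_{\gamma(1)}^{\,n\ell+N-q}}{(n\ell+N-q)!}\,D^{(q)}_{\ell,\mathcal M^\gamma,Z}\big(\widetilde g_{w^\gamma,\mathcal M^\gamma,Z}\big),$$ $$\mathcal Z_{N,n}(-\ell,w,\mathcal M)=\frac{(-1)^N(\ell!)^n}{\prod_{j=0}^Z(n-j)}\sum_{\gamma\in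 I^n_{Z+1}}\sum_{q=0}^{n\ell+N}\frac{(-1)^q\,w_{\gamma(1)}^{\,n\ell+N-q}}{(n\ell+N-q)!}\,D^{(q)}_{\ell,\mathcal M^\gamma,Z}\big(g_{w^\gamma,\mathcal M^\gamma,Z}\big).$$ Moreover there are polynomials $P,Q\in\mathbb Q(\{a_{ij}\})[w_1,\dots,w_n]$ with $\zeta_{N,n}(-\ell,w,\mathcal M)=P(w)$ and $\mathcal Z_{N,n}(-\ell,w,\mathcal M)=Q(w)$ for all such $w$. -/

import Mathlib

noncomputable section

namespace ShintaniBarnes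

/-! Column indices `1, …, n` of the usual notation are `Fin n = {0, …, n - 1}` here, so the
parameter `Z : Fin n` is at once an integer `0 ≤ Z < n` and the index of the `(Z+1)`-st column. -/

/-- Every entry of `M` vanishes or has positive real part, and no row of `M` vanishes. -/
def HypothesisH {N n : ℕ} (M : Matrix (Fin N) (Fin n) ℂ) : Prop :=
  (∀ i j, M i j = 0 ∨ 0 < (M i j).re) ∧ ∀ i, ∃ j, M i j ≠ 0

open Classical in
/-- The number of vanishing entries of the `i`-th row. -/
def zeroCount {N n : ℕ} (M : Matrix (Fin N) (Fin n) ℂ) (i : Fin N) : ℕ :=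
  (Finset.univ.filter fun j => M i j = 0).card

/-- The largest number of vanishing entries in a row of `M`. -/
def maxZeroCount {N n : ℕ} (M : Matrix (Fin N) (Fin n) ℂ) : ℕ :=
  Finset.univ.sup (zeroCount M)

/-- The abscissa `N / (n - Z_M)`. -/
def abscissa {N n : ℕ} (M : Matrix (Fin N) (Fin n) ℂ) : ℝ :=
  (N : ℝ) / ((n : ℝ) - (maxZeroCount M : ℝ))

/-- The product `∏ⱼ (wⱼ + x₁ a₁ⱼ + ⋯ + x_N a_Nⱼ)^(-s)`, with principal powers. -/
def kernel {N n : ℕ} (M : Matrix (Fin N) (Fin n) ℂ) (w : Fin n → ℂ) (s : ℂ) (x : Fin N → ℝ) : ℂ :=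
  ∏ j, (w j + ∑ i, (x i : ℂ) * M i j) ^ (-s)

/-- The term of the Dirichlet series indexed by `k ∈ ℕ₀^N`. -/
def zetaTerm {N n : ℕ} (M : Matrix (Fin N) (Fin n) ℂ) (w : Fin n → ℂ) (s : ℂ)
    (k : Fin N → ℕ) : ℂ :=
  kernel M w s fun i => (k i : ℝ)

/-- The Dirichlet series. -/
def zetaSeries {N n : ℕ} (M : Matrix (Fin N) (Fin n) ℂ) (w : Fin n → ℂ) (s : ℂ) : ℂ :=
  ∑' k : Fin N → ℕ, zetaTerm M w s k

/-- The open orthant `(0, ∞)^N`. -/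
def orthant (N : ℕ) : Set (Fin N → ℝ) := {t | ∀ i, 0 < t i}

/-- The integral analogue of the Dirichlet series. -/
def zetaIntegral {N n : ℕ} (M : Matrix (Fin N) (Fin n) ℂ) (w : Fin n → ℂ) (s : ℂ) : ℂ :=
  ∫ t in orthant N, kernel M w s t

/-- `F` is the meromorphic continuation to `ℂ` of the function `f` on the half-plane `Re s > c`.
The normal form makes `F` analytic at its removable singularities, and fixes its value at each
pole to be `0`; in particular there is at most one such `F`. -/
def IsMeromorphicContinuation (f : ℂ → ℂ) (c : ℝ) (F : ℂ → ℂ) : Prop :=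
  MeromorphicNFOn F Set.univ ∧ ∀ s : ℂ, c < s.re → F s = f s

open Classical in
/-- The meromorphic continuation of `f` from the half-plane `Re s > c` to `ℂ`
(the zero function if there is none). -/
def continuation (f : ℂ → ℂ) (c : ℝ) : ℂ → ℂ :=
  if h : ∃ F, IsMeromorphicContinuation f c F then h.choose else 0

/-- The continued function `s ↦ ζ_{N,n}(s, w, M)`. -/
def zeta {N n : ℕ} (M : Matrix (Fin N) (Fin n) ℂ) (w : Fin n → ℂ) : ℂ → ℂ :=
  continuation (zetaSeries M w) (abscissa M)

/-- The continued function `s ↦ 𝒵_{N,n}(s, w, M)`. -/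
def zetaInt {N n : ℕ} (M : Matrix (Fin N) (Fin n) ℂ) (w : Fin n → ℂ) : ℂ → ℂ :=
  continuation (zetaIntegral M w) (abscissa M)

open Classical in
/-- The injections of the first `Z + 1` indices into all `n` indices, each extended to the
permutation that lists the remaining indices in increasing order. -/
def injections {n : ℕ} (Z : Fin n) : Finset (Equiv.Perm (Fin n)) :=
  Finset.univ.filter fun γ => ∀ i j : Fin n, Z < i → i < j → γ i < γ j

/-- The matrix with permuted columns, `(a_{i γ(j)})`. -/
def permCols {N n : ℕ} (M : Matrix (Fin N) (Fin n) ℂ) (γ : Equiv.Perm (Fin n)) :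
    Matrix (Fin N) (Fin n) ℂ :=
  fun i j => M i (γ j)

open Classical in
/-- The rows whose first non-vanishing entry is in column `j`. -/
def leadingRows {N n : ℕ} (M : Matrix (Fin N) (Fin n) ℂ) (j : Fin n) : Finset (Fin N) :=
  Finset.univ.filter fun i => (∀ k, k < j → M i k = 0) ∧ M i j ≠ 0

/-- The change of variables `T(σ)`: `T_k = σ_1 ⋯ σ_k` for `k ≤ Z + 1` and
`T_k = σ_k · σ_1 ⋯ σ_{Z+1}` for `k > Z + 1` (indices starting at `1`). -/
def tOfSigma {n : ℕ} (Z : Fin n) (σ : Fin n → ℝ) (k : Fin n) : ℝ :=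
  if k ≤ Z then ∏ r ∈ Finset.Iic k, σ r else σ k * ∏ r ∈ Finset.Iic Z, σ r

/-- The polynomial `y_{M,Z}`. -/
def yFun {N n : ℕ} (M : Matrix (Fin N) (Fin n) ℂ) (Z : Fin n) (σ : Fin n → ℝ) : ℂ :=
  ∏ j ∈ Finset.Iic Z, ∏ i ∈ leadingRows M j,
    (M i j + ∑ k ∈ Finset.Ioc j Z, M i k * ∏ r ∈ Finset.Ioc j k, (σ r : ℂ)
      + (∑ k ∈ Finset.Ioi Z, M i k * (σ k : ℂ)) * ∏ r ∈ Finset.Ioc j Z, (σ r : ℂ))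

/-- The function `g_{w',M,Z}`; it does not depend on the first coordinate of `w`. -/
def gFun {N n : ℕ} (M : Matrix (Fin N) (Fin n) ℂ) (w : Fin n → ℂ) (Z : Fin n)
    (σ : Fin n → ℝ) : ℂ :=
  (∏ j ∈ Finset.univ.filter (fun j : Fin n => j.val ≠ 0),
    Complex.exp (-(w j * (tOfSigma Z σ j : ℂ)))) / yFun M Z σ

/-- `φ(z) = z / (1 - e^{-z})`, extended by continuity to `φ(0) = 1`. -/
def phi (z : ℂ) : ℂ := if z = 0 then 1 else z / (1 - Complex.exp (-z))

/-- `Φ_M(T) = ∏ᵢ φ(∑ⱼ aᵢⱼ Tⱼ)`. -/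
def bigPhi {N n : ℕ} (M : Matrix (Fin N) (Fin n) ℂ) (T : Fin n → ℝ) : ℂ :=
  ∏ i, phi (∑ j, M i j * (T j : ℂ))

/-- The function `g̃_{w',M,Z}`. -/
def gTilde {N n : ℕ} (M : Matrix (Fin N) (Fin n) ℂ) (w : Fin n → ℂ) (Z : Fin n)
    (σ : Fin n → ℝ) : ℂ :=
  gFun M w Z σ * bigPhi M (tOfSigma Z σ)

/-- The `j`-th partial derivative. -/
def partialDeriv {n : ℕ} (j : Fin n) (h : (Fin n → ℝ) → ℂ) : (Fin n → ℝ) → ℂ :=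
  fun σ => lineDeriv ℝ h σ (Pi.single j 1)

/-- The iterated partial derivative `∂₁^{A₁} ⋯ ∂ₙ^{Aₙ} h`. -/
def mixedPartial {n : ℕ} (A : Fin n → ℕ) (h : (Fin n → ℝ) → ℂ) : (Fin n → ℝ) → ℂ :=
  (List.finRange n).foldr (fun j f => (partialDeriv j)^[A j] f) h

/-- The multi-index `(q, α₂, …, αₙ)`. With indices starting at `1`, `αⱼ` is
`(n + 1 - j) ℓ + ∑_{k=j}^{Z+1} |F_k|` for `2 ≤ j ≤ Z + 1` and `ℓ` for `j > Z + 1`. -/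
def multiIndex {N n : ℕ} (M : Matrix (Fin N) (Fin n) ℂ) (Z : Fin n) (ℓ q : ℕ) (j : Fin n) : ℕ :=
  if j.val = 0 then q
  else if j ≤ Z then (n - j.val) * ℓ + ∑ k ∈ Finset.Icc j Z, (leadingRows M k).card
  else ℓ

/-- The Taylor coefficient `D^{(q)}_{ℓ,M,Z}(h)` at the origin. -/
def taylorCoeff {N n : ℕ} (M : Matrix (Fin N) (Fin n) ℂ) (Z : Fin n) (ℓ q : ℕ)
    (h : (Fin n → ℝ) → ℂ) : ℂ :=
  mixedPartial (multiIndex M Z ℓ q) h 0 / ∏ j, ((multiIndex M Z ℓ q j).factorial : ℂ)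

/-- The field `ℚ({aᵢⱼ}) ⊆ ℂ` generated by the entries of `M`. -/
def entryField {N n : ℕ} (M : Matrix (Fin N) (Fin n) ℂ) : IntermediateField ℚ ℂ :=
  IntermediateField.adjoin ℚ (Set.range fun p : Fin N × Fin n => M p.1 p.2)

/-- The index of the first column. -/
def firstIndex {n : ℕ} (Z : Fin n) : Fin n := ⟨0, Z.pos⟩

/-- The common shape of the two finite formulas, in terms of a family `h` of functions of `σ`
that depends on a matrix and a vector `w`. -/
def finiteTaylorSum {N n : ℕ} (M : Matrix (Fin N) (Fin n) ℂ) (w : Fin n → ℂ) (Z : Fin n) (ℓ : ℕ)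
    (h : Matrix (Fin N) (Fin n) ℂ → (Fin n → ℂ) → (Fin n → ℝ) → ℂ) : ℂ :=
  (-1) ^ N * (ℓ.factorial : ℂ) ^ n / (∏ j ∈ Finset.range (Z.val + 1), ((n : ℂ) - (j : ℂ))) *
    ∑ γ ∈ injections Z, ∑ q ∈ Finset.range (n * ℓ + N + 1),
      (-1) ^ q * w (γ (firstIndex Z)) ^ (n * ℓ + N - q) / ((n * ℓ + N - q).factorial : ℂ) *
        taylorCoeff (permCols M γ) Z ℓ q (h (permCols M γ) (fun j => w (γ j)))

end ShintaniBarnes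

end

open Filter Topology MeasureTheory
open scoped ContDiff

noncomputable section

namespace ShintaniBarnes

section

/-! ### Meromorphic continuation -/

/-! Write `L_i(t) = ∑ⱼ aᵢⱼ tⱼ`. Euler's integral for each factor of the kernel, followed by
summation over `k` or integration over `t`, turns `Γ(s)^n` times either function into one integral
over `(0,∞)^n` of `∏ tⱼ^(s-1) · e^(-w·t) · ∏ᵢ Φ(L_i(t)) / L_i(t)`, with `Φ = φ` for the series and
`Φ = 1` for the integral (`mellin_kernel`). Both halves of the theorem then follow from one argument
for an admissible `Φ` (`continuation_value`).

The difficulty is the zero set of the `L_i` on the boundary of the orthant. Up to a null set the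
orthant is the disjoint union, over the injections `γ`, of the regions where the `Z + 1` largest
coordinates are listed in decreasing order (`existsUnique_sector`). The substitution `T(σ)` maps
`(0,∞) × (0,1)^(n-1)` onto such a region. A row has at most `Z` zeros, so its first nonzero entry
lies among the first `Z + 1` columns, and `L_i` becomes a monomial in `σ` times a factor whose real
part stays positive up to the boundary (`linear_form_eq_mul_yFactor`, `re_le_re_yFactor`). The
integrand is then `∏ σⱼ^(cⱼ s - bⱼ - 1)` times a smooth function that decays in `σ₁`
(`integrand_eq`).

Integrals of this type are Riesz integrals. Divided by `∏ Γ(cⱼ s - bⱼ)` they extend to entire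
functions by repeated integration by parts, and at `s = -ℓ` the exponents are non-positive integers,
where the value is, up to sign, a mixed derivative at the origin (`IsRieszData.exists_entire`). A
cutoff isolates the origin from the faces `σⱼ = 1`, and the pieces away from it vanish at `s = -ℓ`
because `1/Γ` does. The quotients `Γ(cⱼ s - bⱼ) / Γ(s)` are regular at `-ℓ` with explicit values
(`exists_analyticAt_Gamma_ratio`), and the product of the `cⱼ` gives the denominator `n(n-1)⋯(n-Z)`.

The Leibniz rule in `σ₁` alone splits off `e^(-w₁σ₁)` and produces the sum over `q`
(`mixedPartial_mul_exp`). For polynomiality, the functions involved are an exponential times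
elements of an algebra closed under differentiation, whose elements take values at the origin that
are polynomial in `w` over the field of entries (`Elem.hasElemDeriv`, `Elem.exists_polynomial`). -/

theorem IsMeromorphicContinuation.unique {f : ℂ → ℂ} {c : ℝ} {F G : ℂ → ℂ}
    (hF : IsMeromorphicContinuation f c F) (hG : IsMeromorphicContinuation f c G) : F = G := by
  have hD : MeromorphicOn (F - G) Set.univ := hF.1.meromorphicOn.sub hG.1.meromorphicOn
  have hopen : IsOpen {s : ℂ | c < s.re} := isOpen_lt continuous_const Complex.continuous_re
  have h0 : meromorphicOrderAt (F - G) ((c + 1 : ℝ) : ℂ) = ⊤ := by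
    rw [meromorphicOrderAt_eq_top_iff]
    refine Filter.Eventually.filter_mono nhdsWithin_le_nhds ?_
    filter_upwards [hopen.mem_nhds (show ((c + 1 : ℝ) : ℂ) ∈ {s : ℂ | c < s.re} by simp)] with s hs
    simp [hF.2 s hs, hG.2 s hs]
  -- Identity theorem in terms of orders: infinite order of the difference at one point spreads over
  -- the connected plane. This gives agreement on punctured neighbourhoods only; the normal form
  -- supplies the values at the centres.
  have hall : ∀ s, meromorphicOrderAt (F - G) s = ⊤ := by
    intro s
    by_contra hs
    exact (hD.meromorphicOrderAt_ne_top_of_isPreconnected isPreconnected_univ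
      (Set.mem_univ s) (Set.mem_univ _) hs) h0
  funext s
  have hs := meromorphicOrderAt_eq_top_iff.mp (hall s)
  have : F =ᶠ[𝓝[≠] s] G := by
    filter_upwards [hs] with z hz
    simpa [sub_eq_zero] using hz
  exact (((hF.1 (Set.mem_univ s)).eventuallyEq_nhdsNE_iff_eventuallyEq_nhds
    (hG.1 (Set.mem_univ s))).mp this).self_of_nhds

theorem continuation_eq {f : ℂ → ℂ} {c : ℝ} {F : ℂ → ℂ} (hF : IsMeromorphicContinuation f c F) :
    continuation f c = F := by
  have h : ∃ F, IsMeromorphicContinuation f c F := ⟨F, hF⟩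
  rw [continuation, dif_pos h]
  exact h.choose_spec.unique hF

/-- A meromorphic function that agrees with `f` on a half-plane where it is analytic yields the
continuation of `f`; a point near which it agrees with an analytic function is regular. -/
theorem isMeromorphicContinuation_continuation {f F A : ℂ → ℂ} {c : ℝ} {s₀ : ℂ}
    (hF : MeromorphicOn F Set.univ) (han : ∀ s : ℂ, c < s.re → AnalyticAt ℂ F s)
    (heq : ∀ s : ℂ, c < s.re → F s = f s) (hA : AnalyticAt ℂ A s₀) (hFA : F =ᶠ[𝓝[≠] s₀] A) :
    IsMeromorphicContinuation f c (continuation f c) ∧ AnalyticAt ℂ (continuation f c) s₀ ∧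
      continuation f c s₀ = A s₀ := by
  set G := toMeromorphicNFOn F Set.univ with hG
  have hNF : MeromorphicNFOn G Set.univ := meromorphicNFOn_toMeromorphicNFOn F Set.univ
  -- Passing to the normal form changes `F` only on a discrete set, and where the punctured germ is
  -- analytic it restores the analytic value.
  have hagree : ∀ {H : ℂ → ℂ} {s : ℂ}, AnalyticAt ℂ H s → F =ᶠ[𝓝[≠] s] H → G =ᶠ[𝓝 s] H := by
    intro H s hH hFH
    have h1 : G =ᶠ[𝓝[≠] s] H :=
      (hF.toMeromorphicNFOn_eq_self_on_nhdsNE (Set.mem_univ s)).trans hFH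
    exact ((hNF (Set.mem_univ s)).eventuallyEq_nhdsNE_iff_eventuallyEq_nhds
      hH.meromorphicNFAt).mp h1
  have hcont : IsMeromorphicContinuation f c G :=
    ⟨hNF, fun s hs => by
      rw [(hagree (han s hs) EventuallyEq.rfl).self_of_nhds, heq s hs]⟩
  have hGA := hagree hA hFA
  rw [continuation_eq hcont]
  exact ⟨hcont, hA.congr hGA.symm, hGA.self_of_nhds⟩

/-- Holomorphic extensions of one function to half-planes `Re s > b ℓ`, with `b ℓ → -∞`, glue to
an entire function. -/
theorem exists_entire_of_extensions {f : ℂ → ℂ} {c : ℝ} {b : ℕ → ℝ} {v : ℕ → ℂ}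
    (hb : ∀ r : ℝ, ∃ ℓ, b ℓ < r) (hp : ∀ ℓ, b ℓ < (-(ℓ : ℂ)).re)
    (h : ∀ ℓ, ∃ F : ℂ → ℂ, DifferentiableOn ℂ F {s | b ℓ < s.re} ∧
      (∀ s : ℂ, c < s.re → b ℓ < s.re → F s = f s) ∧ F (-(ℓ : ℂ)) = v ℓ) :
    ∃ E : ℂ → ℂ, Differentiable ℂ E ∧ (∀ s : ℂ, c < s.re → E s = f s) ∧
      ∀ ℓ : ℕ, E (-(ℓ : ℂ)) = v ℓ := by
  choose F hF hFf hFv using h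
  have hopen : ∀ r : ℝ, IsOpen {s : ℂ | r < s.re} := fun r =>
    isOpen_lt continuous_const Complex.continuous_re
  -- Two extensions agree on their common half-plane by the identity theorem, since both equal `f`
  -- near a real point far enough to the right.
  have key : ∀ ℓ m (s : ℂ), b ℓ < s.re → b m < s.re → F ℓ s = F m s := by
    intro ℓ m s hℓ hm
    set r := max (b ℓ) (b m) with hr
    have h1 : AnalyticOnNhd ℂ (F ℓ) {s | r < s.re} :=
      ((hF ℓ).mono fun z (hz : r < z.re) => lt_of_le_of_lt (le_max_left _ _) hz).analyticOnNhd
        (hopen r)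
    have h2 : AnalyticOnNhd ℂ (F m) {s | r < s.re} :=
      ((hF m).mono fun z (hz : r < z.re) => lt_of_le_of_lt (le_max_right _ _) hz).analyticOnNhd
        (hopen r)
    have hconn : IsPreconnected {s : ℂ | r < s.re} := (convex_halfSpace_re_gt r).isPreconnected
    set z₀ : ℂ := ((max r c + 1 : ℝ) : ℂ) with hz₀
    have hz₀re : z₀.re = max r c + 1 := by simp [hz₀]
    have hz₀r : r < z₀.re := by rw [hz₀re]; have := le_max_left r c; linarith
    have hz₀c : c < z₀.re := by rw [hz₀re]; have := le_max_right r c; linarith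
    refine h1.eqOn_of_preconnected_of_eventuallyEq h2 hconn (z₀ := z₀) hz₀r ?_
      (show r < s.re from max_lt hℓ hm)
    filter_upwards [(hopen r).mem_nhds hz₀r, (hopen c).mem_nhds hz₀c] with z hz hzc
    rw [hFf ℓ z hzc (lt_of_le_of_lt (le_max_left _ _) hz),
      hFf m z hzc (lt_of_le_of_lt (le_max_right _ _) hz)]
  choose L hL using fun s : ℂ => hb s.re
  refine ⟨fun s => F (L s) s, fun s => ?_, fun s hs => hFf _ s hs (hL s), fun ℓ => ?_⟩
  · have : (fun s => F (L s) s) =ᶠ[𝓝 s] F (L s) := by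
      filter_upwards [(hopen (b (L s))).mem_nhds (hL s)] with z hz
      exact key _ _ z (hL z) hz
    exact ((hF (L s)).differentiableAt ((hopen _).mem_nhds (hL s))).congr_of_eventuallyEq this
  · show F (L (-(ℓ : ℂ))) (-(ℓ : ℂ)) = v ℓ
    rw [key _ ℓ _ (hL _) (hp ℓ), hFv]

/-! ### Quotients of Gamma functions -/

theorem meromorphicOn_Gamma_affine (c d : ℂ) :
    MeromorphicOn (fun s => Complex.Gamma (c * s + d)) Set.univ := by
  intro s _
  have h : Differentiable ℂ fun s => (Complex.Gamma (c * s + d))⁻¹ :=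
    Complex.differentiable_one_div_Gamma.comp ((differentiable_id.const_mul c).add_const d)
  have h2 : MeromorphicAt (fun s => (Complex.Gamma (c * s + d))⁻¹) s :=
    (h.analyticAt s).meromorphicAt
  simpa using h2.fun_inv

/-- `Γ(z - k) ∏_{i ≤ k} (z - i) = Γ(z + 1)` away from the integers. -/
theorem Gamma_sub_nat_mul_prod (k : ℕ) (z : ℂ) (hz : ∀ i ∈ Finset.range (k + 1), z - i ≠ 0) :
    Complex.Gamma (z - k) * ∏ i ∈ Finset.range (k + 1), (z - i) = Complex.Gamma (z + 1) := by
  induction k with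
  | zero =>
    have h0 : z ≠ 0 := by simpa using hz 0 (by simp)
    simp [Complex.Gamma_add_one z h0, mul_comm]
  | succ k ih =>
    have hk : z - ((k + 1 : ℕ) : ℂ) ≠ 0 := hz (k + 1) (by simp)
    rw [Finset.prod_range_succ, ← ih fun i hi => hz i (by simp at hi ⊢; omega)]
    have := Complex.Gamma_add_one _ hk
    have e : z - ((k + 1 : ℕ) : ℂ) + 1 = z - k := by push_cast; ring
    rw [e] at this
    rw [this]
    ring

theorem prod_range_zero_sub (k : ℕ) :
    ∏ i ∈ Finset.range k, ((0 : ℂ) - ((i + 1 : ℕ) : ℂ)) = (-1) ^ k * (k.factorial : ℂ) := by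
  induction k with
  | zero => simp
  | succ k ih => rw [Finset.prod_range_succ, ih, Nat.factorial_succ]; push_cast; ring

/-- The quotient `Γ(c s - b) / Γ(s)` is regular at `s = -ℓ`. -/
theorem exists_analyticAt_Gamma_ratio (c b ℓ : ℕ) (hc : 0 < c) :
    ∃ A : ℂ → ℂ, AnalyticAt ℂ A (-(ℓ : ℂ)) ∧
      (fun s : ℂ => Complex.Gamma ((c : ℂ) * s + -(b : ℂ)) / Complex.Gamma s)
        =ᶠ[𝓝[≠] (-(ℓ : ℂ))] A ∧
      A (-(ℓ : ℂ)) = (-1) ^ (c * ℓ + b) * (-1) ^ ℓ * (ℓ.factorial : ℂ) /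
        ((c : ℂ) * ((c * ℓ + b).factorial : ℂ)) := by
  set a := c * ℓ + b with ha
  have hc' : (c : ℂ) ≠ 0 := by exact_mod_cast hc.ne'
  set P : ℕ → ℂ → ℂ := fun k z => ∏ i ∈ Finset.range k, (z - ((i + 1 : ℕ) : ℂ)) with hP
  have hPd : ∀ k, Differentiable ℂ (P k) := fun k => by
    simp only [hP]; fun_prop
  have hP0 : ∀ k, P k 0 = (-1) ^ k * (k.factorial : ℂ) := fun k => prod_range_zero_sub k
  have hP0' : ∀ k, P k 0 ≠ 0 := fun k => by
    rw [hP0]; exact mul_ne_zero (pow_ne_zero _ (by norm_num)) (by exact_mod_cast k.factorial_ne_zero)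
  -- With `z = s + ℓ` and `a = cℓ + b`, one has `Γ(cz - a) = Γ(cz + 1) / (cz · P a (cz))` and `Γ(z -
  -- ℓ) = Γ(z + 1) / (z · P ℓ z)`. In the quotient the two factors `z` cancel, which leaves `A`.
  set A : ℂ → ℂ := fun s => Complex.Gamma ((c : ℂ) * (s + ℓ) + 1) / ((c : ℂ) * P a (c * (s + ℓ))) *
    (P ℓ (s + ℓ) * (Complex.Gamma (s + ℓ + 1))⁻¹) with hA
  have hz : ∀ d : ℂ, d * (-(ℓ : ℂ) + ℓ) = 0 := fun d => by ring
  refine ⟨A, ?_, ?_, ?_⟩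
  · have h1 : AnalyticAt ℂ (fun s : ℂ => Complex.Gamma ((c : ℂ) * (s + ℓ) + 1)) (-(ℓ : ℂ)) := by
      have hG : AnalyticAt ℂ Complex.Gamma ((c : ℂ) * (-(ℓ : ℂ) + ℓ) + 1) := by
        rw [hz, zero_add]
        refine DifferentiableOn.analyticAt (s := {z : ℂ | 0 < z.re}) (fun z hz' => ?_)
          ((isOpen_lt continuous_const Complex.continuous_re).mem_nhds (by simp))
        refine (Complex.differentiableAt_Gamma z fun m hm => ?_).differentiableWithinAt
        have : (0 : ℝ) < z.re := hz'
        rw [hm] at this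
        simp at this
        linarith [Nat.cast_nonneg (α := ℝ) m]
      exact hG.fun_comp (f := fun s : ℂ => (c : ℂ) * (s + ℓ) + 1) (x := -(ℓ : ℂ)) (by fun_prop)
    have h2 : AnalyticAt ℂ (fun s : ℂ => (c : ℂ) * P a (c * (s + ℓ))) (-(ℓ : ℂ)) := by
      have : Differentiable ℂ (fun s : ℂ => (c : ℂ) * P a (c * (s + ℓ))) :=
        ((hPd a).comp ((differentiable_id.add_const _).const_mul _)).const_mul _
      exact this.analyticAt _
    have h3 : AnalyticAt ℂ (fun s : ℂ => P ℓ (s + ℓ) * (Complex.Gamma (s + ℓ + 1))⁻¹)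
        (-(ℓ : ℂ)) := by
      have : Differentiable ℂ (fun s : ℂ => P ℓ (s + ℓ) * (Complex.Gamma (s + ℓ + 1))⁻¹) :=
        ((hPd ℓ).comp (differentiable_id.add_const _)).mul
          (Complex.differentiable_one_div_Gamma.comp ((differentiable_id.add_const _).add_const _))
      exact this.analyticAt _
    refine (h1.fun_div h2 ?_).fun_mul h3
    simp only [hz]
    exact mul_ne_zero hc' (hP0' a)
  · have ev1 : ∀ᶠ s in 𝓝 (-(ℓ : ℂ)), P a (c * (s + ℓ)) ≠ 0 := by
      have hcont : Continuous fun s : ℂ => P a (c * (s + ℓ)) :=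
        (hPd a).continuous.comp (by fun_prop)
      exact hcont.continuousAt.eventually_ne (by simpa using hP0' a)
    have ev2 : ∀ᶠ s in 𝓝 (-(ℓ : ℂ)), P ℓ (s + ℓ) ≠ 0 := by
      have hcont : Continuous fun s : ℂ => P ℓ (s + ℓ) := (hPd ℓ).continuous.comp (by fun_prop)
      exact hcont.continuousAt.eventually_ne (by simpa using hP0' ℓ)
    have hsplit : ∀ k z, ∏ i ∈ Finset.range (k + 1), (z - (i : ℂ)) = z * P k z := fun k z => by
      rw [Finset.prod_range_succ', hP]; simp [mul_comm]
    filter_upwards [ev1.filter_mono nhdsWithin_le_nhds, ev2.filter_mono nhdsWithin_le_nhds,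
      self_mem_nhdsWithin] with s h1 h2 h3
    have hs : s + ℓ ≠ 0 := fun h => h3 (eq_neg_of_add_eq_zero_left h)
    have g1 := Gamma_sub_nat_mul_prod a (c * (s + ℓ)) (by
      rw [← Finset.prod_ne_zero_iff, hsplit]
      exact mul_ne_zero (mul_ne_zero hc' hs) h1)
    have g2 := Gamma_sub_nat_mul_prod ℓ (s + ℓ) (by
      rw [← Finset.prod_ne_zero_iff, hsplit]
      exact mul_ne_zero hs h2)
    rw [hsplit] at g1 g2
    have e1 : (c : ℂ) * (s + ℓ) - (a : ℂ) = c * s + -(b : ℂ) := by rw [ha]; push_cast; ring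
    have e2 : s + (ℓ : ℂ) - ℓ = s := by ring
    rw [e1] at g1
    rw [e2] at g2
    simp only [hA]
    rw [← g1, ← g2]
    by_cases hG : Complex.Gamma s = 0
    · simp [hG]
    · field_simp
  · simp only [hA, hz]
    simp only [neg_add_cancel, zero_add, Complex.Gamma_one, hP0, inv_one, mul_one]
    have h1 : ((-1 : ℂ) ^ a) * (-1) ^ a = 1 := by rw [← mul_pow]; norm_num
    have h2 : (a.factorial : ℂ) ≠ 0 := by exact_mod_cast a.factorial_ne_zero
    have h3 : ((-1 : ℂ) ^ a) ≠ 0 := pow_ne_zero _ (by norm_num)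
    field_simp
    rw [pow_two, h1, one_mul]

/-! ### Holomorphy of parameter integrals -/

/-- Only the integrand has to be dominated, not its derivative: Cauchy's estimate on discs of a
fixed radius `r` bounds the derivative by `g / r`. -/
theorem differentiableOn_integral_of_dominated {X : Type*} [MeasurableSpace X] {μ : Measure X}
    {U : Set ℂ} (hU : IsOpen U) {f : ℂ → X → ℂ}
    (hmeas : ∀ s ∈ U, AEStronglyMeasurable (f s) μ)
    (hdiff : ∀ᵐ x ∂μ, DifferentiableOn ℂ (fun s => f s x) U)
    (hdom : ∀ s₀ ∈ U, ∃ V ∈ 𝓝 s₀, ∃ g : X → ℝ, Integrable g μ ∧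
      ∀ᵐ x ∂μ, ∀ s ∈ V, ‖f s x‖ ≤ g x) :
    DifferentiableOn ℂ (fun s => ∫ x, f s x ∂μ) U := by
  intro s₀ hs₀
  obtain ⟨V, hV, g, hg, hfg⟩ := hdom s₀ hs₀
  obtain ⟨R, hR, hball⟩ := Metric.mem_nhds_iff.mp (inter_mem hV (hU.mem_nhds hs₀))
  set r := R / 2 with hr
  have hr0 : 0 < r := by positivity
  have hsub : ∀ s ∈ Metric.ball s₀ r, Metric.closedBall s r ⊆ V ∩ U := by
    intro s hs z hz
    refine hball ?_
    rw [Metric.mem_ball] at hs ⊢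
    rw [Metric.mem_closedBall] at hz
    calc dist z s₀ ≤ dist z s + dist s s₀ := dist_triangle _ _ _
      _ < R := by rw [hr] at *; linarith
  have hmem : ∀ s ∈ Metric.ball s₀ r, s ∈ V ∩ U := fun s hs =>
    hsub s hs (Metric.mem_closedBall_self hr0.le)
  have hs₀b : s₀ ∈ Metric.ball s₀ r := Metric.mem_ball_self hr0
  have hderiv : ∀ᵐ x ∂μ, ∀ s ∈ Metric.ball s₀ r,
      HasDerivAt (fun s => f s x) (deriv (fun s => f s x) s) s := by
    filter_upwards [hdiff] with x hx s hs
    exact (hx.differentiableAt (hU.mem_nhds (hmem s hs).2)).hasDerivAt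
  -- The derivative at `s₀` is measurable as a limit of difference quotients along a sequence of
  -- steps that stays inside the disc.
  have hmeas' : AEStronglyMeasurable (fun x => deriv (fun s => f s x) s₀) μ := by
    set u : ℕ → ℂ := fun m => ((r / (m + 2) : ℝ) : ℂ) with hu
    have hu0 : ∀ m, u m ≠ 0 := fun m => by
      simp only [hu]
      exact_mod_cast (by positivity : r / ((m : ℝ) + 2) ≠ 0)
    have hub : ∀ m, s₀ + u m ∈ Metric.ball s₀ r := fun m => by
      simp only [Metric.mem_ball, dist_self_add_left, hu, Complex.norm_real, Real.norm_eq_abs]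
      rw [abs_of_pos (by positivity), div_lt_iff₀ (by positivity)]
      nlinarith [Nat.cast_nonneg (α := ℝ) m]
    have hul : Tendsto u atTop (𝓝[≠] 0) := by
      refine tendsto_nhdsWithin_iff.mpr ⟨?_, Eventually.of_forall hu0⟩
      have : Tendsto (fun m : ℕ => r / ((m : ℝ) + 2)) atTop (𝓝 0) :=
        tendsto_const_nhds.div_atTop
          (tendsto_atTop_add_const_right _ _ tendsto_natCast_atTop_atTop)
      simpa [hu, Function.comp_def] using (Complex.continuous_ofReal.tendsto 0).comp this
    refine aestronglyMeasurable_of_tendsto_ae atTop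
      (f := fun m x => (u m)⁻¹ • (f (s₀ + u m) x - f s₀ x)) (fun m => ?_) ?_
    · exact ((hmeas _ (hmem _ (hub m)).2).sub (hmeas _ hs₀)).const_smul (u m)⁻¹
    · filter_upwards [hderiv] with x hx
      exact (hasDerivAt_iff_tendsto_slope_zero.mp (hx s₀ hs₀b)).comp hul
  refine (hasDerivAt_integral_of_dominated_loc_of_deriv_le (F := f)
    (F' := fun s x => deriv (fun s => f s x) s) (bound := fun x => g x / r)
    (Metric.ball_mem_nhds s₀ hr0) ?_ ?_ hmeas' ?_ (hg.div_const r)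
    hderiv).2.differentiableAt.differentiableWithinAt
  · filter_upwards [hU.mem_nhds hs₀] with s hs using hmeas s hs
  · exact hg.mono' (hmeas _ hs₀) (hfg.mono fun x hx => hx s₀ (hmem s₀ hs₀b).1)
  · filter_upwards [hdiff, hfg] with x hx hx' s hs
    refine Complex.norm_deriv_le_of_forall_mem_sphere_norm_le hr0 ?_ fun z hz => ?_
    · refine DifferentiableOn.diffContOnCl_ball (U := U) hx fun z hz => (hsub s hs hz).2
    · exact hx' z (hsub s hs (Metric.sphere_subset_closedBall hz)).1

end

section

/-! ### Absolute convergence -/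

theorem exists_pos_le {ι : Type*} [Finite ι] (f : ι → ℝ) (hf : ∀ i, 0 < f i) :
    ∃ c, 0 < c ∧ ∀ i, c ≤ f i := by
  rcases isEmpty_or_nonempty ι with h | h
  · exact ⟨1, one_pos, fun i => (h.false i).elim⟩
  · obtain ⟨i₀, hi₀⟩ := Finite.exists_min f
    exact ⟨f i₀, hf i₀, hi₀⟩

theorem zeroCount_le_maxZeroCount {N n : ℕ} (M : Matrix (Fin N) (Fin n) ℂ) (i : Fin N) :
    zeroCount M i ≤ maxZeroCount M :=
  Finset.le_sup (f := zeroCount M) (Finset.mem_univ i)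

theorem maxZeroCount_lt {N n : ℕ} {M : Matrix (Fin N) (Fin n) ℂ} {Z : Fin n}
    (hZ : ∀ i, zeroCount M i ≤ (Z : ℕ)) : maxZeroCount M < n :=
  lt_of_le_of_lt (Finset.sup_le fun i _ => hZ i) Z.isLt

theorem abscissa_nonneg {N n : ℕ} {M : Matrix (Fin N) (Fin n) ℂ} (hn : maxZeroCount M < n) :
    0 ≤ abscissa M := by
  have : (maxZeroCount M : ℝ) < n := by exact_mod_cast hn
  exact div_nonneg (Nat.cast_nonneg _) (by linarith)

theorem HypothesisH.re_nonneg {N n : ℕ} {M : Matrix (Fin N) (Fin n) ℂ} (hM : HypothesisH M)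
    (i : Fin N) (j : Fin n) : 0 ≤ (M i j).re := by
  rcases hM.1 i j with h | h
  · simp [h]
  · exact h.le

theorem re_linear_form {N : ℕ} (a : Fin N → ℂ) (v : ℂ) (x : Fin N → ℝ) :
    (v + ∑ i, (x i : ℂ) * a i).re = v.re + ∑ i, x i * (a i).re := by
  simp [Complex.re_sum]

theorem re_linear_form_pos {N n : ℕ} {M : Matrix (Fin N) (Fin n) ℂ} (hM : HypothesisH M)
    {w : Fin n → ℂ} (hw : ∀ j, 0 < (w j).re) {x : Fin N → ℝ} (hx : ∀ i, 0 ≤ x i) (j : Fin n) :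
    0 < (w j + ∑ i, (x i : ℂ) * M i j).re := by
  rw [re_linear_form (fun i => M i j)]
  exact add_pos_of_pos_of_nonneg (hw j)
    (Finset.sum_nonneg fun i _ => mul_nonneg (hx i) (hM.re_nonneg i j))

/-- Decay of the absolute kernel, uniformly on the closed orthant. -/
theorem exists_prod_rpow_le {N n : ℕ} {M : Matrix (Fin N) (Fin n) ℂ} (hM : HypothesisH M)
    (hn : maxZeroCount M < n) {w : Fin n → ℂ} (hw : ∀ j, 0 < (w j).re) {r : ℝ}
    (hr : abscissa M < r) :
    ∃ C p : ℝ, (0 < N → 1 < p) ∧ ∀ x : Fin N → ℝ, (∀ i, 0 ≤ x i) →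
      ∏ j, (w j + ∑ i, (x i : ℂ) * M i j).re ^ (-r) ≤ C * ∏ i, (1 + x i) ^ (-p) := by
  classical
  have hr0 : 0 < r := lt_of_le_of_lt (abscissa_nonneg hn) hr
  obtain ⟨c₁, hc₁, hcw⟩ := exists_pos_le (fun j => (w j).re) hw
  obtain ⟨c₂, hc₂, hcM⟩ := exists_pos_le
    (fun q : {q : Fin N × Fin n // M q.1 q.2 ≠ 0} => (M q.1.1 q.1.2).re)
    (fun q => (hM.1 q.1.1 q.1.2).resolve_left q.2)
  set c := min c₁ c₂ with hc
  have hc0 : 0 < c := lt_min hc₁ hc₂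
  have hcw' : ∀ j, c ≤ (w j).re := fun j => (min_le_left _ _).trans (hcw j)
  have hcM' : ∀ i j, M i j ≠ 0 → c ≤ (M i j).re := fun i j h =>
    (min_le_right _ _).trans (hcM ⟨(i, j), h⟩)
  set m := n - maxZeroCount M with hm
  have hmR : (m : ℝ) = (n : ℝ) - maxZeroCount M := by
    rw [hm, Nat.cast_sub hn.le]
  have hm0 : (0 : ℝ) < m := by rw [hmR]; have : (maxZeroCount M : ℝ) < n := by exact_mod_cast hn
                               linarith
  have hpos := fun (x : Fin N → ℝ) (hx : ∀ i, 0 ≤ x i) j => re_linear_form_pos hM hw hx j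
  -- A fixed row has at least `m = n - Z_M` nonzero entries, and each of them contributes a factor
  -- at least `c (1 + x i₀)`; the remaining factors are at least `c`.
  have hlow : ∀ x : Fin N → ℝ, (∀ i, 0 ≤ x i) → ∀ i₀,
      c ^ n * (1 + x i₀) ^ m ≤ ∏ j, (w j + ∑ i, (x i : ℂ) * M i j).re := by
    intro x hx i₀
    have h1 : ∀ j, c * (if M i₀ j = 0 then 1 else 1 + x i₀) ≤
        (w j + ∑ i, (x i : ℂ) * M i j).re := by
      intro j
      rw [re_linear_form (fun i => M i j)]
      have hs : x i₀ * (M i₀ j).re ≤ ∑ i, x i * (M i j).re :=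
        Finset.single_le_sum (f := fun i => x i * (M i j).re)
          (fun i _ => mul_nonneg (hx i) (hM.re_nonneg i j)) (Finset.mem_univ i₀)
      split_ifs with h
      · simp only [h, Complex.zero_re, mul_zero] at hs
        linarith [hcw' j]
      · nlinarith [hcw' j, mul_le_mul_of_nonneg_left (hcM' i₀ j h) (hx i₀)]
    have hx1 : 1 ≤ 1 + x i₀ := by linarith [hx i₀]
    have hcard : m ≤ (Finset.univ.filter fun j => ¬ M i₀ j = 0).card := by
      have h2 := Finset.card_filter_add_card_filter_not (s := (Finset.univ : Finset (Fin n)))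
        (fun j => M i₀ j = 0)
      have h3 := zeroCount_le_maxZeroCount M i₀
      unfold zeroCount at h3
      simp only [Finset.card_univ, Fintype.card_fin] at h2
      omega
    calc c ^ n * (1 + x i₀) ^ m
        ≤ c ^ n * (1 + x i₀) ^ (Finset.univ.filter fun j => ¬ M i₀ j = 0).card := by
          gcongr
      _ = ∏ j, c * (if M i₀ j = 0 then 1 else 1 + x i₀) := by
          rw [Finset.prod_mul_distrib, Finset.prod_ite]
          simp
      _ ≤ _ := Finset.prod_le_prod (fun j _ => by
          split_ifs <;> nlinarith [hx i₀]) fun j _ => h1 j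
  rcases Nat.eq_zero_or_pos N with hN | hN
  · subst hN
    refine ⟨∏ j, (w j).re ^ (-r), 0, fun h => absurd h (lt_irrefl 0), fun x _ => by simp⟩
  · have hN' : (0 : ℝ) < N := by exact_mod_cast hN
    -- There is one lower bound for the same product `P` for each of the `N` variables. Writing
    -- `P^(-r)` as `N` equal powers and using a different bound in each gives the exponent `m r /
    -- N`, which exceeds `1` exactly when `r` exceeds the abscissa.
    refine ⟨∏ _i : Fin N, (c ^ n) ^ (-r / N), m * r / N, fun _ => ?_, fun x hx => ?_⟩
    · rw [lt_div_iff₀ hN', one_mul]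
      have := hr
      unfold abscissa at this
      rw [← hmR, div_lt_iff₀ hm0] at this
      linarith
    · set P := ∏ j, (w j + ∑ i, (x i : ℂ) * M i j).re with hP
      have hP0 : 0 < P := Finset.prod_pos fun j _ => hpos x hx j
      rw [Real.finsetProd_rpow _ _ (fun j _ => (hpos x hx j).le), ← Finset.prod_mul_distrib]
      have e : P ^ (-r) = ∏ _i : Fin N, P ^ (-r / N) := by
        rw [Finset.prod_const, Finset.card_univ, Fintype.card_fin, ← Real.rpow_natCast,
          ← Real.rpow_mul hP0.le]
        congr 1
        field_simp
      rw [e]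
      refine Finset.prod_le_prod (fun i _ => Real.rpow_nonneg hP0.le _) fun i _ => ?_
      have hxi : (0 : ℝ) < 1 + x i := by linarith [hx i]
      calc P ^ (-r / N) ≤ (c ^ n * (1 + x i) ^ m) ^ (-r / N) :=
            Real.rpow_le_rpow_of_nonpos (by positivity) (hlow x hx i)
              (div_nonpos_of_nonpos_of_nonneg (by linarith) hN'.le)
        _ = (c ^ n) ^ (-r / N) * (1 + x i) ^ (-(m * r / N)) := by
            rw [Real.mul_rpow (by positivity) (by positivity), ← Real.rpow_natCast (1 + x i),
              ← Real.rpow_mul hxi.le]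
            congr 2
            ring

theorem norm_cpow_neg_le {z s : ℂ} (hz : 0 < z.re) (hs : 0 ≤ s.re) :
    ‖z ^ (-s)‖ ≤ Real.exp (Real.pi * |s.im|) * z.re ^ (-s.re) := by
  have hz0 : z ≠ 0 := fun h => by simp [h] at hz
  rw [Complex.norm_cpow_of_ne_zero hz0, div_eq_mul_inv, ← Real.exp_neg, mul_comm]
  refine mul_le_mul ?_ ?_ (Real.rpow_nonneg (norm_nonneg _) _) (Real.exp_pos _).le
  · rw [Real.exp_le_exp]
    have h1 := Complex.abs_arg_le_pi z
    calc -(z.arg * (-s).im) ≤ |z.arg * s.im| := by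
          rw [Complex.neg_im, mul_neg, neg_neg]; exact le_abs_self _
      _ ≤ Real.pi * |s.im| := by rw [abs_mul]; gcongr
  · rw [Complex.neg_re]
    exact Real.rpow_le_rpow_of_nonpos hz ((le_abs_self _).trans (Complex.abs_re_le_norm z))
      (by linarith)

/-! ### Euler's integral and the Mellin transform of the kernel. -/

theorem integrableOn_cpow_mul_exp {s z : ℂ} (hs0 : 0 < s.re) (hz : 0 < z.re) :
    IntegrableOn (fun t : ℝ => (t : ℂ) ^ (s - 1) * Complex.exp (-(z * t))) (Set.Ioi 0) := by
  have h1 : IntegrableOn (fun t : ℝ => t ^ (s.re - 1) * Real.exp (-(z.re * t))) (Set.Ioi 0) := by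
    have := integrableOn_rpow_mul_exp_neg_mul_rpow (p := 1) (s := s.re - 1) (b := z.re)
      (by linarith) one_pos hz
    simpa using this
  refine Integrable.mono' h1 ?_ ?_
  · exact Measurable.aestronglyMeasurable (by fun_prop)
  · filter_upwards [ae_restrict_mem measurableSet_Ioi] with t ht
    have ht' : (0 : ℝ) < t := ht
    rw [norm_mul, Complex.norm_cpow_eq_rpow_re_of_pos ht', Complex.norm_exp]
    simp

/-- Euler's integral with a complex rate. -/
theorem integral_cpow_mul_exp_neg_mul {s z : ℂ} (hs0 : 0 < s.re) (hz : 0 < z.re) :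
    ∫ t in Set.Ioi (0 : ℝ), (t : ℂ) ^ (s - 1) * Complex.exp (-(z * t)) =
      Complex.Gamma s * z ^ (-s) := by
  have hopen : IsOpen {z : ℂ | 0 < z.re} := isOpen_lt continuous_const Complex.continuous_re
  have h1 : DifferentiableOn ℂ
      (fun z => ∫ t in Set.Ioi (0 : ℝ), (t : ℂ) ^ (s - 1) * Complex.exp (-(z * t)))
      {z : ℂ | 0 < z.re} := by
    refine differentiableOn_integral_of_dominated hopen
      (fun z hz => (integrableOn_cpow_mul_exp hs0 hz).aestronglyMeasurable)
      (Eventually.of_forall fun t => by fun_prop) fun z₀ hz₀ => ?_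
    have hz₀' : 0 < z₀.re := hz₀
    refine ⟨{z | z₀.re / 2 < z.re}, (isOpen_lt continuous_const Complex.continuous_re).mem_nhds
      (show z₀.re / 2 < z₀.re by linarith), _, (integrableOn_cpow_mul_exp (z := (z₀.re / 2 : ℝ)) hs0
        (by simpa using hz₀')).norm, ?_⟩
    filter_upwards [ae_restrict_mem measurableSet_Ioi] with t ht z hz
    have ht' : (0 : ℝ) < t := ht
    have hz' : z₀.re / 2 < z.re := hz
    rw [norm_mul, norm_mul, Complex.norm_exp, Complex.norm_exp]
    refine mul_le_mul_of_nonneg_left (Real.exp_le_exp.mpr ?_) (norm_nonneg _)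
    rw [Complex.neg_re, Complex.neg_re, Complex.re_mul_ofReal, Complex.re_mul_ofReal,
      Complex.ofReal_re]
    nlinarith
  have h2 : DifferentiableOn ℂ (fun z => Complex.Gamma s * z ^ (-s)) {z : ℂ | 0 < z.re} := by
    intro z hz
    exact ((differentiableAt_id.cpow_const (Or.inl hz)).const_mul _).differentiableWithinAt
  -- Both sides are holomorphic in `z` on the right half-plane, so it suffices to compare them at
  -- the real points `1 + 1/(m+1)`, which accumulate at `1`.
  refine (h1.analyticOnNhd hopen).eqOn_of_preconnected_of_frequently_eq (h2.analyticOnNhd hopen)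
    (convex_halfSpace_re_gt 0).isPreconnected (z₀ := 1) (by simp) ?_ hz
  have hl : Tendsto (fun m : ℕ => ((1 + 1 / ((m : ℝ) + 1) : ℝ) : ℂ)) atTop (𝓝[≠] 1) := by
    refine tendsto_nhdsWithin_iff.mpr ⟨?_, Eventually.of_forall fun m h => ?_⟩
    · have := (tendsto_one_div_add_atTop_nhds_zero_nat (𝕜 := ℝ)).const_add 1
      rw [add_zero] at this
      simpa [Function.comp_def] using (Complex.continuous_ofReal.tendsto 1).comp this
    · have : (1 + 1 / ((m : ℝ) + 1) : ℝ) = 1 := by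
        exact_mod_cast Set.mem_singleton_iff.mp h
      have h3 : (0 : ℝ) < 1 / ((m : ℝ) + 1) := by positivity
      linarith
  refine hl.frequently (Frequently.of_forall fun m => ?_)
  have hm : (0 : ℝ) < 1 + 1 / ((m : ℝ) + 1) := by positivity
  rw [Complex.integral_cpow_mul_exp_neg_mul_Ioi hs0 hm, mul_comm, one_div,
    Complex.inv_cpow _ _ (by rw [Complex.arg_ofReal_of_nonneg hm.le]; exact Real.pi_pos.ne),
    ← Complex.cpow_neg]

section Mellin

variable {X : Type*} [MeasurableSpace X] {μ : Measure X} [SigmaFinite μ] {pos : X → ℝ}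
  {N n : ℕ} {M : Matrix (Fin N) (Fin n) ℂ} {w : Fin n → ℂ} {s : ℂ} {ρ : ℂ → ℂ}

theorem ae_pi_nonneg (h0 : ∀ᵐ x ∂μ, 0 ≤ pos x) :
    ∀ᵐ x ∂(Measure.pi fun _ : Fin N => μ), ∀ i, 0 ≤ pos (x i) := by
  rw [ae_all_iff]
  intro i
  exact (Measure.quasiMeasurePreserving_eval (fun _ : Fin N => μ) i).ae h0

theorem measurable_linear_form (hp : Measurable pos) (j : Fin n) :
    Measurable fun x : Fin N → X => w j + ∑ i, (pos (x i) : ℂ) * M i j := by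
  fun_prop

/-- The pair `(μ, pos)` stands for counting measure on `ℕ` or for Lebesgue measure on the half-line,
so that absolute convergence of the series and of the integral is one statement. -/
theorem integrable_kernel (hM : HypothesisH M) (hn : maxZeroCount M < n)
    (hw : ∀ j, 0 < (w j).re) (hs : abscissa M < s.re) (hp : Measurable pos)
    (h0 : ∀ᵐ x ∂μ, 0 ≤ pos x)
    (hint : ∀ p : ℝ, 1 < p → Integrable (fun x => (1 + pos x) ^ (-p)) μ) :
    Integrable (fun x : Fin N → X => kernel M w s fun i => pos (x i))
      (Measure.pi fun _ => μ) := by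
  obtain ⟨C, p, hp1, hC⟩ := exists_prod_rpow_le hM hn hw hs
  have hi : Integrable (fun x : Fin N → X => ∏ i, (1 + pos (x i)) ^ (-p))
      (Measure.pi fun _ => μ) :=
    Integrable.fintype_prod fun i => hint p (hp1 i.pos)
  have hs0 : 0 ≤ s.re := (abscissa_nonneg hn).trans hs.le
  refine ((hi.const_mul C).const_mul (Real.exp (Real.pi * |s.im|) ^ n)).mono' ?_ ?_
  · refine Measurable.aestronglyMeasurable ?_
    unfold kernel
    exact Finset.measurable_prod _ fun j _ => (measurable_linear_form hp j).pow_const _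
  · filter_upwards [ae_pi_nonneg h0] with x hx
    unfold kernel
    rw [norm_prod]
    calc ∏ j, ‖(w j + ∑ i, (pos (x i) : ℂ) * M i j) ^ (-s)‖
        ≤ ∏ j, Real.exp (Real.pi * |s.im|) * (w j + ∑ i, (pos (x i) : ℂ) * M i j).re ^ (-s.re) :=
          Finset.prod_le_prod (fun _ _ => norm_nonneg _) fun j _ =>
            norm_cpow_neg_le (re_linear_form_pos hM hw hx j) hs0
      _ ≤ _ := by
          rw [Finset.prod_mul_distrib, Finset.prod_const, Finset.card_univ, Fintype.card_fin]
          exact mul_le_mul_of_nonneg_left (hC _ hx) (by positivity)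

theorem volume_restrict_orthant (n : ℕ) :
    (volume : Measure (Fin n → ℝ)).restrict (orthant n) =
      Measure.pi fun _ => (volume : Measure ℝ).restrict (Set.Ioi 0) := by
  rw [← Measure.restrict_pi_pi, ← volume_pi]
  congr 1
  ext t
  simp [orthant]

/-- The Mellin transform of the kernel. -/
theorem mellin_kernel (hM : HypothesisH M) (hn : maxZeroCount M < n)
    (hw : ∀ j, 0 < (w j).re) (hs : abscissa M < s.re) (hp : Measurable pos)
    (h0 : ∀ᵐ x ∂μ, 0 ≤ pos x)
    (hint : ∀ p : ℝ, 1 < p → Integrable (fun x => (1 + pos x) ^ (-p)) μ)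
    (hρ : ∀ z : ℂ, 0 < z.re → ∫ x, Complex.exp (-(z * pos x)) ∂μ = ρ z) :
    IntegrableOn (fun t : Fin n → ℝ => (∏ j, (t j : ℂ) ^ (s - 1)) *
      Complex.exp (-∑ j, w j * t j) * ∏ i, ρ (∑ j, M i j * t j)) (orthant n) ∧
    ∫ t in orthant n, (∏ j, (t j : ℂ) ^ (s - 1)) * Complex.exp (-∑ j, w j * t j) *
      ∏ i, ρ (∑ j, M i j * t j) =
    Complex.Gamma s ^ n * ∫ x, kernel M w s (fun i => pos (x i)) ∂(Measure.pi fun _ => μ) := by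
  have hs0 : 0 < s.re := lt_of_le_of_lt (abscissa_nonneg hn) hs
  set μN := Measure.pi fun _ : Fin N => μ with hμN
  set ν := (volume : Measure ℝ).restrict (Set.Ioi 0) with hν
  set νn := Measure.pi fun _ : Fin n => ν with hνn
  set Lf : (Fin N → X) → Fin n → ℂ := fun x j => w j + ∑ i, (pos (x i) : ℂ) * M i j with hLf
  set G : (Fin N → X) → (Fin n → ℝ) → ℂ := fun x t =>
    ∏ j, ((t j : ℂ) ^ (s - 1) * Complex.exp (-(Lf x j * t j))) with hG
  have hx0 : ∀ᵐ x ∂μN, ∀ i, 0 ≤ pos (x i) := ae_pi_nonneg h0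
  have ht0 : ∀ᵐ t ∂νn, ∀ j, 0 < t j := by
    rw [ae_all_iff]
    intro j
    refine (Measure.quasiMeasurePreserving_eval (fun _ : Fin n => ν) j).ae ?_
    exact ae_restrict_mem measurableSet_Ioi
  have hGm : Measurable (Function.uncurry G) := by
    simp only [hG, Function.uncurry_def]
    refine Finset.measurable_prod _ fun j _ => Measurable.mul ?_ ?_
    · refine Measurable.pow_const ?_ _
      exact Complex.measurable_ofReal.comp ((measurable_pi_apply j).comp measurable_snd)
    · refine Complex.measurable_exp.comp (Measurable.neg (Measurable.mul ?_ ?_))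
      · exact (measurable_linear_form hp j).comp measurable_fst
      · exact Complex.measurable_ofReal.comp ((measurable_pi_apply j).comp measurable_snd)
  have hfac : ∀ z : ℂ, 0 < z.re →
      Integrable (fun t : ℝ => (t : ℂ) ^ (s - 1) * Complex.exp (-(z * t))) ν := by
    intro z hz
    exact integrableOn_cpow_mul_exp hs0 hz
  have hnormfac : ∀ z : ℂ, 0 < z.re →
      ∫ t, ‖(t : ℂ) ^ (s - 1) * Complex.exp (-(z * t))‖ ∂ν =
        Real.Gamma s.re * z.re ^ (-s.re) := by
    intro z hz
    rw [show Real.Gamma s.re * z.re ^ (-s.re) = (1 / z.re) ^ s.re * Real.Gamma s.re by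
      rw [Real.rpow_neg hz.le, one_div, Real.inv_rpow hz.le, mul_comm],
      ← Real.integral_rpow_mul_exp_neg_mul_Ioi hs0 hz]
    refine setIntegral_congr_fun measurableSet_Ioi fun t ht => ?_
    have ht' : (0 : ℝ) < t := ht
    rw [norm_mul, Complex.norm_cpow_eq_rpow_re_of_pos ht', Complex.norm_exp]
    simp
  have hLpos : ∀ x : Fin N → X, (∀ i, 0 ≤ pos (x i)) → ∀ j, 0 < (Lf x j).re := fun x hx j =>
    re_linear_form_pos hM hw hx j
  -- Tonelli: the `t`-integral of the norm factors into one-dimensional Gamma integrals and equals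
  -- `Γ(Re s)^n ∏ Re(Lⱼ)^(-Re s)`, which `exists_prod_rpow_le` makes integrable in `x`.
  have hGint : Integrable (Function.uncurry G) (μN.prod νn) := by
    rw [integrable_prod_iff hGm.aestronglyMeasurable]
    constructor
    · filter_upwards [hx0] with x hx
      exact Integrable.fintype_prod fun j => hfac _ (hLpos x hx j)
    · obtain ⟨C, p, hp1, hC⟩ := exists_prod_rpow_le hM hn hw hs
      have hi : Integrable (fun x : Fin N → X => ∏ i, (1 + pos (x i)) ^ (-p)) μN :=
        Integrable.fintype_prod fun i => hint p (hp1 i.pos)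
      refine ((hi.const_mul C).const_mul (Real.Gamma s.re ^ n)).mono' ?_ ?_
      · exact hGm.norm.stronglyMeasurable.integral_prod_right.aestronglyMeasurable
      · filter_upwards [hx0] with x hx
        have e : ∫ t, ‖Function.uncurry G (x, t)‖ ∂νn =
            Real.Gamma s.re ^ n * ∏ j, (Lf x j).re ^ (-s.re) := by
          simp only [Function.uncurry_apply_pair, hG, norm_prod]
          rw [hνn, integral_fintype_prod_eq_prod (𝕜 := ℝ)
            (fun j (t : ℝ) => ‖(t : ℂ) ^ (s - 1) * Complex.exp (-(Lf x j * t))‖),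
            Finset.prod_congr rfl fun j _ => hnormfac _ (hLpos x hx j), Finset.prod_mul_distrib,
            Finset.prod_const, Finset.card_univ, Fintype.card_fin]
        rw [e, Real.norm_of_nonneg (mul_nonneg (pow_nonneg (Real.Gamma_pos_of_pos hs0).le _)
          (Finset.prod_nonneg fun j _ => Real.rpow_nonneg (hLpos x hx j).le _))]
        exact mul_le_mul_of_nonneg_left (hC _ hx) (pow_nonneg (Real.Gamma_pos_of_pos hs0).le _)
  -- Integrating in `x` first, the exponential splits over the rows. For `t` in the open orthant
  -- each `L_i(t)` has positive real part because no row vanishes, so `hρ` applies.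
  have hinner : ∀ t : Fin n → ℝ, (∀ j, 0 < t j) → ∫ x, G x t ∂μN =
      (∏ j, (t j : ℂ) ^ (s - 1)) * Complex.exp (-∑ j, w j * t j) *
        ∏ i, ρ (∑ j, M i j * t j) := by
    intro t ht
    have hz : ∀ i, 0 < (∑ j, M i j * (t j : ℂ)).re := by
      intro i
      obtain ⟨j₀, hj₀⟩ := hM.2 i
      rw [Complex.re_sum]
      refine Finset.sum_pos' (fun j _ => ?_) ⟨j₀, Finset.mem_univ _, ?_⟩
      · simpa using mul_nonneg (hM.re_nonneg i j) (ht j).le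
      · simpa using mul_pos ((hM.1 i j₀).resolve_left hj₀) (ht j₀)
    have e : ∀ x, G x t = ((∏ j, (t j : ℂ) ^ (s - 1)) * Complex.exp (-∑ j, w j * t j)) *
        ∏ i, Complex.exp (-((∑ j, M i j * t j) * pos (x i))) := by
      intro x
      simp only [hG, hLf]
      rw [Finset.prod_mul_distrib, mul_assoc, ← Complex.exp_sum, ← Complex.exp_sum,
        ← Complex.exp_add]
      congr 2
      simp only [Finset.sum_neg_distrib, add_mul, Finset.sum_add_distrib, Finset.sum_mul, neg_add]
      congr 2
      rw [Finset.sum_comm]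
      exact Finset.sum_congr rfl fun i _ => Finset.sum_congr rfl fun j _ => by ring
    simp only [e]
    rw [integral_const_mul, hμN, integral_fintype_prod_eq_prod (𝕜 := ℂ)
      (fun i (x : X) => Complex.exp (-((∑ j, M i j * t j) * pos x)))]
    rw [Finset.prod_congr rfl fun i _ => hρ _ (hz i)]
  have hinner' : (fun t => ∫ x, G x t ∂μN) =ᵐ[νn] fun t => (∏ j, (t j : ℂ) ^ (s - 1)) *
      Complex.exp (-∑ j, w j * t j) * ∏ i, ρ (∑ j, M i j * t j) := by
    filter_upwards [ht0] with t ht using hinner t ht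
  have hrestr : (volume : Measure (Fin n → ℝ)).restrict (orthant n) = νn :=
    volume_restrict_orthant n
  constructor
  · rw [IntegrableOn, hrestr]
    exact hGint.integral_prod_right.congr hinner'
  · rw [hrestr, ← integral_congr_ae hinner', ← integral_integral_swap hGint,
      ← integral_const_mul]
    refine integral_congr_ae ?_
    filter_upwards [hx0] with x hx
    simp only [hG]
    rw [hνn, integral_fintype_prod_eq_prod (𝕜 := ℂ)
      (fun j (t : ℝ) => (t : ℂ) ^ (s - 1) * Complex.exp (-(Lf x j * t)))]
    have : ∀ j, ∫ t, (t : ℂ) ^ (s - 1) * Complex.exp (-(Lf x j * t)) ∂ν =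
        Complex.Gamma s * Lf x j ^ (-s) := fun j =>
      integral_cpow_mul_exp_neg_mul hs0 (hLpos x hx j)
    rw [Finset.prod_congr rfl fun j _ => this j, Finset.prod_mul_distrib, Finset.prod_const,
      Finset.card_univ, Fintype.card_fin]
    rfl

end Mellin

end

section

/-! ### Sectors -/

variable {n : ℕ}

/-- The index of the variable that dominates the `k`-th one in a sector. -/
def prevIdx (Z k : Fin n) : Fin n := if k ≤ Z then ⟨k.val - 1, by omega⟩ else Z

theorem prevIdx_lt {Z k : Fin n} (hk : k.val ≠ 0) : prevIdx Z k < k := by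
  unfold prevIdx
  split_ifs with h
  · rw [Fin.lt_def]; simp; omega
  · exact not_le.mp h

theorem prevIdx_le (Z k : Fin n) : prevIdx Z k ≤ Z := by
  unfold prevIdx
  split_ifs with h
  · rw [Fin.le_def] at *; simp; omega
  · exact le_rfl

/-- The points whose first `Z + 1` coordinates decrease and dominate all others. -/
def sector (Z : Fin n) : Set (Fin n → ℝ) :=
  {T | (∀ k, 0 < T k) ∧ ∀ k : Fin n, k.val ≠ 0 → T k < T (prevIdx Z k)}

theorem mem_sector_iff {Z : Fin n} {T : Fin n → ℝ} :
    T ∈ sector Z ↔ (∀ k, 0 < T k) ∧ ∀ i k : Fin n, i ≤ Z → i < k → T k < T i := by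
  refine and_congr_right fun _ => ⟨fun h i k => ?_, fun h k hk => ?_⟩
  · induction k using WellFoundedLT.induction with
    | ind k ih =>
      intro hi hik
      have hk : k.val ≠ 0 := by rw [Fin.lt_def] at hik; omega
      have hle : i ≤ prevIdx Z k := by
        unfold prevIdx
        split_ifs
        · rw [Fin.lt_def] at hik; rw [Fin.le_def]; simp; omega
        · exact hi
      rcases hle.eq_or_lt with he | hlt
      · rw [he]; exact h k hk
      · exact (h k hk).trans (ih _ (prevIdx_lt hk) hi hlt)
  · exact h _ _ (prevIdx_le Z k) (prevIdx_lt hk)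

open Classical in
/-- A sorting key: the members of `A` come first, by decreasing value of `t`, then the remaining
indices in increasing order. -/
def sectorKey (t : Fin n → ℝ) (A : Finset (Fin n)) (i : Fin n) : ℝ :=
  if i ∈ A then -t i else (i.val : ℝ)

/-- The key is negative on the dominating set and nonnegative off it, so its increasing order lists
that set first by decreasing `t` and then the rest by index. This is the order a sector and its
extended injection prescribe, hence `γ` can be recovered from the set by sorting. -/
theorem strictMono_sectorKey {Z : Fin n} {t : Fin n → ℝ} {γ : Equiv.Perm (Fin n)}
    (hγ : γ ∈ injections Z) (h : t ∘ γ ∈ sector Z) :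
    StrictMono (sectorKey t ((Finset.Iic Z).map γ.toEmbedding) ∘ γ) := by
  rw [mem_sector_iff] at h
  have hγ' : ∀ i j : Fin n, Z < i → i < j → γ i < γ j := by simpa [injections] using hγ
  have hmem : ∀ i, γ i ∈ (Finset.Iic Z).map γ.toEmbedding ↔ i ≤ Z := by simp
  intro i k hik
  simp only [Function.comp_apply, sectorKey, hmem]
  split_ifs with h1 h2 h2
  · simpa using h.2 i k h1 hik
  · have h3 : 0 < t (γ i) := h.1 i
    have : (0 : ℝ) ≤ ((γ k).val : ℝ) := Nat.cast_nonneg _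
    linarith
  · exact absurd (hik.le.trans h2) h1
  · have := hγ' i k (not_le.mp h1) hik
    exact_mod_cast this

/-- Converse of `strictMono_sectorKey`: the positions that `γ` sends into `A` form an initial
segment, and counting identifies it with the first `Z + 1` indices. -/
theorem mem_sector_of_strictMono {Z : Fin n} {t : Fin n → ℝ} (ht : ∀ i, 0 < t i)
    {A : Finset (Fin n)} (hA : A.card = Z.val + 1) (hdom : ∀ a ∈ A, ∀ b ∉ A, t b < t a)
    {γ : Equiv.Perm (Fin n)} (hγ : StrictMono (sectorKey t A ∘ γ)) :
    γ ∈ injections Z ∧ t ∘ γ ∈ sector Z := by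
  have hlow : ∀ i k : Fin n, i < k → γ k ∈ A → γ i ∈ A := by
    intro i k hik hk
    by_contra hi
    have := hγ hik
    simp only [Function.comp_apply, sectorKey, hk, hi, if_true, if_false] at this
    have h2 : (0 : ℝ) ≤ ((γ i).val : ℝ) := Nat.cast_nonneg _
    linarith [ht (γ k)]
  set L := A.map γ.symm.toEmbedding with hL
  have hmemL : ∀ i, i ∈ L ↔ γ i ∈ A := by
    intro i
    simp [hL]
  have hLZ : L = Finset.Iic Z := by
    refine Finset.eq_of_subset_of_card_le (fun i hi => ?_) ?_
    · have hsub : Finset.Iic i ⊆ L := by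
        intro k hk
        rcases (Finset.mem_Iic.mp hk).eq_or_lt with rfl | hlt
        · exact hi
        · exact (hmemL k).mpr (hlow k i hlt ((hmemL i).mp hi))
      have hc := Finset.card_le_card hsub
      rw [hL, Finset.card_map, hA, Fin.card_Iic] at hc
      rw [Finset.mem_Iic, Fin.le_def]
      omega
    · rw [hL, Finset.card_map, hA, Fin.card_Iic]
  have hmem : ∀ i, γ i ∈ A ↔ i ≤ Z := fun i => by rw [← hmemL, hLZ, Finset.mem_Iic]
  constructor
  · simp only [injections, Finset.mem_filter, Finset.mem_univ, true_and]
    intro i j hi hij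
    have h1 : γ i ∉ A := by rw [hmem]; exact not_le.mpr hi
    have h2 : γ j ∉ A := by rw [hmem]; exact not_le.mpr (hi.trans hij)
    have := hγ hij
    simp only [Function.comp_apply, sectorKey, h1, h2, if_false] at this
    exact_mod_cast this
  · rw [mem_sector_iff]
    refine ⟨fun k => ht _, fun i k hi hik => ?_⟩
    have h1 : γ i ∈ A := (hmem i).mpr hi
    by_cases hk : γ k ∈ A
    · have := hγ hik
      simp only [Function.comp_apply, sectorKey, h1, hk, if_true] at this
      simpa using this
    · exact hdom _ h1 _ hk

/-- Existence: a decreasing sort of `t` gives the set `A` of the `Z + 1` largest coordinates, and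
sorting by the key of `A` gives `γ`. Uniqueness: `A` is forced, and a set of reals has only one
increasing enumeration. -/
theorem existsUnique_sector (Z : Fin n) {t : Fin n → ℝ} (ht : ∀ i, 0 < t i)
    (hinj : Function.Injective t) :
    ∃! γ : Equiv.Perm (Fin n), γ ∈ injections Z ∧ t ∘ γ ∈ sector Z := by
  classical
  have hdomγ : ∀ γ : Equiv.Perm (Fin n), t ∘ γ ∈ sector Z →
      ∀ a ∈ (Finset.Iic Z).map γ.toEmbedding, ∀ b ∉ (Finset.Iic Z).map γ.toEmbedding,
        t b < t a := by
    intro γ hγ a ha b hb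
    obtain ⟨i, hi, rfl⟩ := Finset.mem_map.mp ha
    obtain ⟨k, rfl⟩ := γ.surjective b
    have hk : Z < k := by
      by_contra h
      exact hb (by simpa using h)
    have hi' : i ≤ Z := Finset.mem_Iic.mp hi
    exact (mem_sector_iff.mp hγ).2 i k hi' (hi'.trans_lt hk)
  have hcard : ∀ γ : Equiv.Perm (Fin n), ((Finset.Iic Z).map γ.toEmbedding).card = Z.val + 1 := by
    intro γ; rw [Finset.card_map, Fin.card_Iic]
  have hex : ∃ γ : Equiv.Perm (Fin n), γ ∈ injections Z ∧ t ∘ γ ∈ sector Z := by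
    set τ := Tuple.sort (fun i => -t i) with hτ
    have hτm : StrictMono ((fun i => -t i) ∘ τ) :=
      (Tuple.monotone_sort (fun i => -t i)).strictMono_of_injective
        ((neg_injective.comp hinj).comp τ.injective)
    have hτs : t ∘ τ ∈ sector Z := by
      rw [mem_sector_iff]
      exact ⟨fun k => ht _, fun i k _ hik => by simpa using hτm hik⟩
    set A := (Finset.Iic Z).map τ.toEmbedding
    have hkey : Function.Injective (sectorKey t A) := by
      intro i k hik
      simp only [sectorKey] at hik
      split_ifs at hik with h1 h2 h2
      · exact hinj (neg_injective hik)
      · have : (0 : ℝ) ≤ (k.val : ℝ) := Nat.cast_nonneg _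
        linarith [ht i]
      · have : (0 : ℝ) ≤ (i.val : ℝ) := Nat.cast_nonneg _
        linarith [ht k]
      · exact Fin.ext (by exact_mod_cast hik)
    refine ⟨Tuple.sort (sectorKey t A),
      mem_sector_of_strictMono ht (hcard τ) (hdomγ τ hτs) ?_⟩
    exact (Tuple.monotone_sort _).strictMono_of_injective (hkey.comp (Equiv.injective _))
  obtain ⟨γ, hγ⟩ := hex
  refine ⟨γ, hγ, fun γ' hγ' => ?_⟩
  set A := (Finset.Iic Z).map γ.toEmbedding with hA
  set A' := (Finset.Iic Z).map γ'.toEmbedding with hA'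
  -- If two sets of the same size differ, each has an element outside the other; each set dominates
  -- its complement, so these two elements would be strictly ordered both ways.
  have hAA : A' = A := by
    by_contra hne
    have hc : A'.card = A.card := by rw [hcard, hcard]
    have h1 : ¬ A' ⊆ A := fun h => hne (Finset.eq_of_subset_of_card_le h hc.ge)
    have h2 : ¬ A ⊆ A' := fun h => hne (Finset.eq_of_subset_of_card_le h hc.le).symm
    obtain ⟨a, ha, ha'⟩ := Finset.not_subset.mp h1
    obtain ⟨b, hb, hb'⟩ := Finset.not_subset.mp h2
    exact lt_asymm (hdomγ γ hγ.2 b hb a ha') (hdomγ γ' hγ'.2 a ha b hb')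
  have m1 := strictMono_sectorKey hγ.1 hγ.2
  have m2 := strictMono_sectorKey hγ'.1 hγ'.2
  rw [← hA] at m1
  rw [← hA', hAA] at m2
  have hkey : Function.Injective (sectorKey t A) := by
    have h := m1.injective
    intro i k hik
    have := @h (γ.symm i) (γ.symm k) (by simpa using hik)
    simpa using this
  have hr : sectorKey t A ∘ γ' = sectorKey t A ∘ γ := by
    refine (StrictMono.range_inj m2 m1).mp ?_
    rw [γ'.surjective.range_comp, γ.surjective.range_comp]
  ext i : 1
  exact hkey (congrFun hr i)

/-- Ties between coordinates lie on finitely many hyperplanes. The sectors therefore cover the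
orthant up to a null set. -/
theorem ae_injective : ∀ᵐ t : Fin n → ℝ, Function.Injective t := by
  have : ∀ i j : Fin n, i ≠ j → ∀ᵐ t : Fin n → ℝ, t i ≠ t j := by
    intro i j hij
    set K : Submodule ℝ (Fin n → ℝ) :=
      LinearMap.ker (LinearMap.proj (R := ℝ) (φ := fun _ : Fin n => ℝ) i - LinearMap.proj j) with hK
    have hKt : K ≠ ⊤ := by
      intro h
      have : (Pi.single i 1 : Fin n → ℝ) ∈ K := h ▸ Submodule.mem_top
      simp [hK, hij.symm] at this
    have h0 := Measure.addHaar_submodule (volume : Measure (Fin n → ℝ)) K hKt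
    rw [ae_iff]
    refine measure_mono_null (fun t ht => ?_) h0
    simpa [hK, sub_eq_zero] using ht
  have h2 : ∀ᵐ t : Fin n → ℝ, ∀ i j : Fin n, i ≠ j → t i ≠ t j := by
    simp only [ae_all_iff]
    exact this
  filter_upwards [h2] with t ht i j hij
  by_contra h
  exact ht i j h hij

theorem measurableSet_sector (Z : Fin n) : MeasurableSet (sector Z) := by
  have : sector Z = (⋂ k, {T | 0 < T k}) ∩ ⋂ k : Fin n, ⋂ (_ : k.val ≠ 0),
      {T | T k < T (prevIdx Z k)} := by
    ext T; simp [sector]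
  rw [this]
  refine MeasurableSet.inter (MeasurableSet.iInter fun k => ?_)
    (MeasurableSet.iInter fun k => MeasurableSet.iInter fun _ => ?_)
  · exact measurableSet_lt measurable_const (measurable_pi_apply k)
  · exact measurableSet_lt (measurable_pi_apply k) (measurable_pi_apply _)

theorem measurableSet_orthant (n : ℕ) : MeasurableSet (orthant n) := by
  have : orthant n = ⋂ k, {T | 0 < T k} := by ext T; simp [orthant]
  rw [this]
  exact MeasurableSet.iInter fun k => measurableSet_lt measurable_const (measurable_pi_apply k)

theorem integral_orthant_eq_sum_sectors (Z : Fin n) {f : (Fin n → ℝ) → ℂ}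
    (hf : IntegrableOn f (orthant n)) :
    ∫ t in orthant n, f t = ∑ γ ∈ injections Z, ∫ T in sector Z, f (T ∘ γ.symm) := by
  classical
  have hsub : ∀ γ : Equiv.Perm (Fin n), {t | t ∘ γ ∈ sector Z} ⊆ orthant n := by
    intro γ t ht i
    have := ht.1 (γ.symm i)
    simpa using this
  have hmeasγ : ∀ γ : Equiv.Perm (Fin n), MeasurableSet {t : Fin n → ℝ | t ∘ γ ∈ sector Z} := by
    intro γ
    have : Measurable fun t : Fin n → ℝ => t ∘ γ :=
      measurable_pi_lambda _ fun i => measurable_pi_apply _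
    exact this (measurableSet_sector Z)
  have h1 : ∫ t in orthant n, f t =
      ∫ t in orthant n, ∑ γ ∈ injections Z, {t | t ∘ γ ∈ sector Z}.indicator f t := by
    refine setIntegral_congr_ae (measurableSet_orthant n) ?_
    filter_upwards [ae_injective (n := n)] with t ht htp
    obtain ⟨γ, hγ, huniq⟩ := existsUnique_sector Z htp ht
    rw [Finset.sum_eq_single_of_mem γ hγ.1]
    · rw [Set.indicator_of_mem (show t ∈ {t | t ∘ γ ∈ sector Z} from hγ.2)]
    · intro γ' hγ' hne
      exact Set.indicator_of_notMem (s := {t | t ∘ γ' ∈ sector Z})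
        (fun h => hne (huniq γ' ⟨hγ', h⟩)) f
  rw [h1, integral_finsetSum _ fun γ _ => Integrable.indicator hf (hmeasγ γ)]
  refine Finset.sum_congr rfl fun γ _ => ?_
  rw [integral_indicator (hmeasγ γ), Measure.restrict_restrict (hmeasγ γ),
    Set.inter_eq_left.mpr (hsub γ)]
  have hmp := volume_measurePreserving_piCongrLeft (fun _ : Fin n => ℝ) γ
  have hval : ∀ T : Fin n → ℝ, MeasurableEquiv.piCongrLeft (fun _ : Fin n => ℝ) γ T =
      T ∘ γ.symm := by
    intro T
    funext i
    obtain ⟨k, rfl⟩ := γ.surjective i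
    rw [MeasurableEquiv.coe_piCongrLeft, Equiv.piCongrLeft_apply_apply]
    simp
  rw [← hmp.setIntegral_preimage_emb (MeasurableEquiv.measurableEmbedding _)]
  simp only [hval]
  congr 2
  ext T
  simp only [Set.mem_preimage, Set.mem_ofPred_eq, hval]
  have : (T ∘ γ.symm) ∘ γ = T := by funext i; simp
  rw [this]

/-! ### The change of variables -/

/-- The domain `(0, ∞) × (0, 1)^(n - 1)`. -/
def sigmaDomain (n : ℕ) : Set (Fin n → ℝ) :=
  {σ | (∀ k, 0 < σ k) ∧ ∀ k : Fin n, k.val ≠ 0 → σ k < 1}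

theorem measurableSet_sigmaDomain (n : ℕ) : MeasurableSet (sigmaDomain n) := by
  have : sigmaDomain n = (⋂ k, {T | 0 < T k}) ∩ ⋂ k : Fin n, ⋂ (_ : k.val ≠ 0),
      {T | T k < 1} := by
    ext T; simp [sigmaDomain]
  rw [this]
  refine MeasurableSet.inter (MeasurableSet.iInter fun k => ?_)
    (MeasurableSet.iInter fun k => MeasurableSet.iInter fun _ => ?_)
  · exact measurableSet_lt measurable_const (measurable_pi_apply k)
  · exact measurableSet_lt (measurable_pi_apply k) measurable_const

/-- The factor `T_k / σ_k`. -/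
def tFactor (Z : Fin n) (σ : Fin n → ℝ) (k : Fin n) : ℝ :=
  if k.val = 0 then 1 else tOfSigma Z σ (prevIdx Z k)

theorem tOfSigma_eq (Z : Fin n) (σ : Fin n → ℝ) (k : Fin n) :
    tOfSigma Z σ k = σ k * tFactor Z σ k := by
  unfold tFactor
  split_ifs with hk
  · have hkZ : k ≤ Z := by rw [Fin.le_def]; omega
    have : Finset.Iic k = {k} := by
      ext i
      rw [Finset.mem_Iic, Finset.mem_singleton, Fin.le_def, Fin.ext_iff]
      omega
    rw [tOfSigma, if_pos hkZ, this]
    simp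
  · by_cases hkZ : k ≤ Z
    · have hp : prevIdx Z k ≤ Z := prevIdx_le Z k
      rw [tOfSigma, if_pos hkZ, tOfSigma, if_pos hp]
      have : Finset.Iic k = insert k (Finset.Iic (prevIdx Z k)) := by
        ext i
        have hpv : (prevIdx Z k).val = k.val - 1 := by rw [prevIdx, if_pos hkZ]
        rw [Finset.mem_Iic, Finset.mem_insert, Finset.mem_Iic, Fin.le_def, Fin.le_def, Fin.ext_iff,
          hpv]
        omega
      rw [this, Finset.prod_insert]
      simpa using prevIdx_lt hk
    · rw [tOfSigma, if_neg hkZ, prevIdx, if_neg hkZ, tOfSigma, if_pos le_rfl]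

theorem tOfSigma_congr {Z : Fin n} {σ τ : Fin n → ℝ} {k : Fin n} (h : ∀ r, r ≤ k → σ r = τ r) :
    tOfSigma Z σ k = tOfSigma Z τ k := by
  unfold tOfSigma
  split_ifs with hk
  · exact Finset.prod_congr rfl fun r hr => h r (Finset.mem_Iic.mp hr)
  · rw [h k le_rfl, Finset.prod_congr rfl fun r hr =>
      h r ((Finset.mem_Iic.mp hr).trans (not_le.mp hk).le)]

theorem tFactor_congr {Z : Fin n} {σ τ : Fin n → ℝ} {k : Fin n} (h : ∀ r, r < k → σ r = τ r) :
    tFactor Z σ k = tFactor Z τ k := by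
  unfold tFactor
  split_ifs with hk
  · rfl
  · exact tOfSigma_congr fun r hr => h r (hr.trans_lt (prevIdx_lt hk))

theorem tOfSigma_pos {Z : Fin n} {σ : Fin n → ℝ} (h : ∀ r, 0 < σ r) (k : Fin n) :
    0 < tOfSigma Z σ k := by
  unfold tOfSigma
  split_ifs
  · exact Finset.prod_pos fun r _ => h r
  · exact mul_pos (h k) (Finset.prod_pos fun r _ => h r)

theorem tOfSigma_nonneg {Z : Fin n} {σ : Fin n → ℝ} (h : ∀ r, 0 ≤ σ r) (k : Fin n) :
    0 ≤ tOfSigma Z σ k := by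
  unfold tOfSigma
  split_ifs
  · exact Finset.prod_nonneg fun r _ => h r
  · exact mul_nonneg (h k) (Finset.prod_nonneg fun r _ => h r)

theorem tFactor_pos {Z : Fin n} {σ : Fin n → ℝ} (h : ∀ r, 0 < σ r) (k : Fin n) :
    0 < tFactor Z σ k := by
  unfold tFactor
  split_ifs
  · exact one_pos
  · exact tOfSigma_pos h _

/-- The inverse substitution is a quotient: `σ_k` is `T_k` divided by the coordinate that dominates
it, and the sector inequalities say that this quotient is less than `1`. -/
theorem image_tOfSigma (Z : Fin n) : tOfSigma Z '' sigmaDomain n = sector Z := by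
  ext T
  constructor
  · rintro ⟨σ, hσ, rfl⟩
    refine ⟨fun k => tOfSigma_pos hσ.1 k, fun k hk => ?_⟩
    rw [tOfSigma_eq Z σ k, tFactor, if_neg hk]
    have := tOfSigma_pos (Z := Z) hσ.1 (prevIdx Z k)
    nlinarith [hσ.2 k hk]
  · intro hT
    set σ : Fin n → ℝ := fun k => T k / (if k.val = 0 then 1 else T (prevIdx Z k)) with hσ
    have hT' : tOfSigma Z σ = T := by
      funext k
      induction k using WellFoundedLT.induction with
      | ind k ih =>
        rw [tOfSigma_eq, tFactor, hσ]
        by_cases hk : k.val = 0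
        · simp [hk]
        · simp only [if_neg hk]
          rw [ih _ (prevIdx_lt hk)]
          have := hT.1 (prevIdx Z k)
          field_simp
    refine ⟨σ, ⟨fun k => ?_, fun k hk => ?_⟩, hT'⟩
    · simp only [hσ]
      split_ifs
      · simpa using hT.1 k
      · exact div_pos (hT.1 k) (hT.1 _)
    · simp only [hσ, if_neg hk]
      rw [div_lt_one (hT.1 _)]
      exact hT.2 k hk

theorem injOn_tOfSigma (Z : Fin n) : Set.InjOn (tOfSigma Z) (sigmaDomain n) := by
  intro σ hσ τ hτ h
  funext k
  induction k using WellFoundedLT.induction with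
  | ind k ih =>
    have hk := congrFun h k
    rw [tOfSigma_eq, tOfSigma_eq, tFactor_congr ih] at hk
    exact mul_right_cancel₀ (tFactor_pos hτ.1 k).ne' hk

theorem contDiff_tOfSigma_apply (Z k : Fin n) : ContDiff ℝ ⊤ fun σ => tOfSigma Z σ k := by
  unfold tOfSigma
  split_ifs
  · fun_prop
  · fun_prop

theorem differentiable_tOfSigma (Z : Fin n) : Differentiable ℝ (tOfSigma Z) :=
  differentiable_pi.mpr fun k => (contDiff_tOfSigma_apply Z k).differentiable (by simp)

/-- The Jacobian matrix is lower triangular, since `T_k` involves only `σ_r` with `r ≤ k`, and `T_k`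
is linear in `σ_k` with coefficient `tFactor`. -/
theorem det_fderiv_tOfSigma (Z : Fin n) (σ : Fin n → ℝ) :
    (fderiv ℝ (tOfSigma Z) σ).det = ∏ k, tFactor Z σ k := by
  have hd := (differentiable_tOfSigma Z) σ
  have hentry : ∀ k r, LinearMap.toMatrix' (fderiv ℝ (tOfSigma Z) σ : (Fin n → ℝ) →ₗ[ℝ] _) k r =
      deriv (fun x : ℝ => tOfSigma Z (σ + x • Pi.single r 1) k) 0 := by
    intro k r
    rw [LinearMap.toMatrix'_apply]
    have h1 : (fderiv ℝ (tOfSigma Z) σ) (Pi.single r 1) =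
        lineDeriv ℝ (tOfSigma Z) σ (Pi.single r 1) := hd.lineDeriv_eq_fderiv.symm
    have h2 := (hd.hasFDerivAt.hasLineDerivAt (Pi.single r 1))
    have h3 := hasDerivAt_pi.mp h2 k
    rw [h3.deriv]
    rfl
  rw [ContinuousLinearMap.det, ← LinearMap.det_toMatrix', Matrix.det_of_isLowerTriangular]
  · refine Finset.prod_congr rfl fun k _ => ?_
    rw [hentry]
    have : (fun x : ℝ => tOfSigma Z (σ + x • Pi.single k 1) k) =
        fun x => (σ k + x) * tFactor Z σ k := by
      funext x
      rw [tOfSigma_eq, tFactor_congr (τ := σ)]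
      · simp
      · intro r hr
        simp [hr.ne]
    rw [this]
    simp
  · intro k r hkr
    rw [hentry]
    have hkr' : k < r := hkr
    have : (fun x : ℝ => tOfSigma Z (σ + x • Pi.single r 1) k) = fun _ => tOfSigma Z σ k := by
      funext x
      refine tOfSigma_congr fun i hi => ?_
      have : i ≠ r := (hi.trans_lt hkr').ne
      simp [this]
    rw [this, deriv_const]

theorem integral_sector_eq (Z : Fin n) (f : (Fin n → ℝ) → ℂ) :
    ∫ T in sector Z, f T =
      ∫ σ in sigmaDomain n, ((∏ k, tFactor Z σ k : ℝ) : ℂ) * f (tOfSigma Z σ) := by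
  rw [← image_tOfSigma, integral_image_eq_integral_abs_det_fderiv_smul volume
    (measurableSet_sigmaDomain n)
    (fun σ _ => ((differentiable_tOfSigma Z) σ).hasFDerivAt.hasFDerivWithinAt) (injOn_tOfSigma Z)]
  refine setIntegral_congr_fun (measurableSet_sigmaDomain n) fun σ hσ => ?_
  rw [det_fderiv_tOfSigma, abs_of_pos (Finset.prod_pos fun k _ => tFactor_pos hσ.1 k),
    Complex.real_smul]

theorem integral_orthant_eq (Z : Fin n) {f : (Fin n → ℝ) → ℂ}
    (hf : IntegrableOn f (orthant n)) :
    ∫ t in orthant n, f t = ∑ γ ∈ injections Z, ∫ σ in sigmaDomain n,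
      ((∏ k, tFactor Z σ k : ℝ) : ℂ) * f (tOfSigma Z σ ∘ γ.symm) := by
  rw [integral_orthant_eq_sum_sectors Z hf]
  exact Finset.sum_congr rfl fun γ _ => integral_sector_eq Z fun T => f (T ∘ γ.symm)

end

section

/-! ### The integrand in the new variables -/

variable {N n : ℕ}

/-- The number of coordinates of `T(σ)` that contain the factor `σ_j`. -/
def expCoeff (Z j : Fin n) : ℕ := if j ≤ Z then n - j.val else 1

/-- The order of vanishing in `σ_j` of the product of the linear forms. -/
def expShift (M : Matrix (Fin N) (Fin n) ℂ) (Z j : Fin n) : ℕ :=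
  if j ≤ Z then ∑ k ∈ Finset.Icc j Z, (leadingRows M k).card else 0

theorem expCoeff_pos (Z j : Fin n) : 0 < expCoeff Z j := by
  unfold expCoeff; split_ifs <;> omega

/-- The factors of `T_k`. -/
def tSupport (Z k : Fin n) : Finset (Fin n) := Finset.univ.filter fun r => r = k ∨ (r ≤ Z ∧ r ≤ k)

theorem tOfSigma_eq_prod (Z : Fin n) (σ : Fin n → ℝ) (k : Fin n) :
    tOfSigma Z σ k = ∏ r ∈ tSupport Z k, σ r := by
  unfold tOfSigma
  split_ifs with h
  · congr 1
    ext r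
    simp only [tSupport, Finset.mem_Iic, Finset.mem_filter, Finset.mem_univ, true_and]
    constructor
    · exact fun hr => Or.inr ⟨hr.trans h, hr⟩
    · rintro (rfl | hr)
      · exact le_rfl
      · exact hr.2
  · have : tSupport Z k = insert k (Finset.Iic Z) := by
      ext r
      simp only [tSupport, Finset.mem_Iic, Finset.mem_filter, Finset.mem_univ, true_and,
        Finset.mem_insert]
      refine or_congr_right ⟨fun hr => hr.1, fun hr => ⟨hr, hr.trans (not_le.mp h).le⟩⟩
    rw [this, Finset.prod_insert (by simpa using h)]

theorem card_filter_mem_tSupport (Z r : Fin n) :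
    (Finset.univ.filter fun k => r ∈ tSupport Z k).card = expCoeff Z r := by
  unfold expCoeff
  split_ifs with h
  · have : (Finset.univ.filter fun k => r ∈ tSupport Z k) = Finset.Ici r := by
      ext k
      simp only [tSupport, Finset.mem_Ici, Finset.mem_filter, Finset.mem_univ, true_and]
      constructor
      · rintro (rfl | hr)
        · exact le_rfl
        · exact hr.2
      · exact fun hr => Or.inr ⟨h, hr⟩
    rw [this, Fin.card_Ici]
  · have : (Finset.univ.filter fun k => r ∈ tSupport Z k) = {r} := by
      ext k
      simp only [tSupport, Finset.mem_singleton, Finset.mem_filter, Finset.mem_univ, true_and]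
      constructor
      · rintro (rfl | hr)
        · rfl
        · exact absurd hr.1 h
      · exact fun hr => Or.inl hr.symm
    rw [this, Finset.card_singleton]

theorem prod_ofReal_cpow {ι : Type*} (S : Finset ι) {x : ι → ℝ} (hx : ∀ i, 0 < x i) (z : ℂ) :
    ((∏ i ∈ S, x i : ℝ) : ℂ) ^ z = ∏ i ∈ S, (x i : ℂ) ^ z := by
  classical
  induction S using Finset.induction_on with
  | empty => simp
  | insert a S ha ih =>
    rw [Finset.prod_insert ha, Finset.prod_insert ha, Complex.ofReal_mul,
      Complex.mul_cpow_ofReal_nonneg (hx a).le (Finset.prod_nonneg fun i _ => (hx i).le), ih]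

/-- The Jacobian factor is `T_k / σ_k`, so the product is `∏ T_k^s / σ_k`; the exponent of `σ_j` in
`∏ T_k` is the number of coordinates containing it, by `card_filter_mem_tSupport`. -/
theorem prod_tFactor_mul_cpow {Z : Fin n} {σ : Fin n → ℝ} (hσ : ∀ k, 0 < σ k) (s : ℂ) :
    ((∏ k, tFactor Z σ k : ℝ) : ℂ) * ∏ k, (tOfSigma Z σ k : ℂ) ^ (s - 1) =
      ∏ j, (σ j : ℂ) ^ ((expCoeff Z j : ℂ) * s - 1) := by
  have hσ' : ∀ k, (σ k : ℂ) ≠ 0 := fun k => by exact_mod_cast (hσ k).ne'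
  have h1 : ∀ k, (tFactor Z σ k : ℂ) * (tOfSigma Z σ k : ℂ) ^ (s - 1) =
      (tOfSigma Z σ k : ℂ) ^ s * (σ k : ℂ)⁻¹ := by
    intro k
    have hT : (tOfSigma Z σ k : ℂ) ≠ 0 := by exact_mod_cast (tOfSigma_pos hσ k).ne'
    rw [Complex.cpow_sub _ _ hT, Complex.cpow_one]
    have : (tOfSigma Z σ k : ℂ) = σ k * tFactor Z σ k := by
      rw [tOfSigma_eq]; push_cast; rfl
    have hF : (tFactor Z σ k : ℂ) ≠ 0 := by exact_mod_cast (tFactor_pos hσ k).ne'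
    have hk := hσ' k
    field_simp
    rw [this]
    ring
  rw [Complex.ofReal_prod, ← Finset.prod_mul_distrib, Finset.prod_congr rfl fun k _ => h1 k,
    Finset.prod_mul_distrib]
  have h2 : ∏ k, (tOfSigma Z σ k : ℂ) ^ s = ∏ j, (σ j : ℂ) ^ ((expCoeff Z j : ℂ) * s) := by
    simp_rw [tOfSigma_eq_prod, prod_ofReal_cpow _ hσ]
    rw [Finset.prod_comm' (t' := Finset.univ)
      (s' := fun r => Finset.univ.filter fun k => r ∈ tSupport Z k) (by simp)]
    refine Finset.prod_congr rfl fun r _ => ?_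
    rw [Finset.prod_const, card_filter_mem_tSupport, Complex.cpow_nat_mul]
  rw [h2, ← Finset.prod_mul_distrib]
  refine Finset.prod_congr rfl fun j _ => ?_
  rw [Complex.cpow_sub _ _ (hσ' j), Complex.cpow_one, div_eq_mul_inv]

/-- The factors of `yFun`. -/
def yFactor (M : Matrix (Fin N) (Fin n) ℂ) (Z : Fin n) (i : Fin N) (j : Fin n)
    (σ : Fin n → ℝ) : ℂ :=
  M i j + ∑ k ∈ Finset.Ioc j Z, M i k * ∏ r ∈ Finset.Ioc j k, (σ r : ℂ)
      + (∑ k ∈ Finset.Ioi Z, M i k * (σ k : ℂ)) * ∏ r ∈ Finset.Ioc j Z, (σ r : ℂ)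

/-- In row `i` the entries before column `j` vanish, and every `T_k` with `k ≥ j` is a multiple of
`T_j` because `j ≤ Z`. Factoring out `T_j` leaves the constant term `aᵢⱼ ≠ 0`. -/
theorem linear_form_eq_mul_yFactor {M : Matrix (Fin N) (Fin n) ℂ} {Z j : Fin n} {i : Fin N}
    (hj : j ≤ Z) (hi : i ∈ leadingRows M j) (σ : Fin n → ℝ) :
    ∑ k, M i k * (tOfSigma Z σ k : ℂ) = (tOfSigma Z σ j : ℂ) * yFactor M Z i j σ := by
  have hi0 : ∀ k, k < j → M i k = 0 := by
    simp only [leadingRows, Finset.mem_filter] at hi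
    exact hi.2.1
  have hT : ∀ k, k ≤ Z → j ≤ k → (tOfSigma Z σ k : ℂ) =
      (tOfSigma Z σ j : ℂ) * ∏ r ∈ Finset.Ioc j k, (σ r : ℂ) := by
    intro k hk hjk
    have : Finset.Iic k = Finset.Iic j ∪ Finset.Ioc j k := by
      ext r
      simp only [Finset.mem_Iic, Finset.mem_union, Finset.mem_Ioc]
      constructor
      · intro h
        rcases le_or_gt r j with h' | h'
        · exact Or.inl h'
        · exact Or.inr ⟨h', h⟩
      · rintro (h | h)
        · exact h.trans hjk
        · exact h.2
    rw [tOfSigma, if_pos hk, tOfSigma, if_pos hj, this, Finset.prod_union]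
    · push_cast; rfl
    · rw [Finset.disjoint_left]
      intro r h1 h2
      exact absurd (Finset.mem_Iic.mp h1) (not_le.mpr (Finset.mem_Ioc.mp h2).1)
  have hsplit : (Finset.univ : Finset (Fin n)) =
      Finset.Iio j ∪ (insert j (Finset.Ioc j Z) ∪ Finset.Ioi Z) := by
    ext r
    simp only [Finset.mem_univ, Finset.mem_union, Finset.mem_Iio, Finset.mem_insert,
      Finset.mem_Ioc, Finset.mem_Ioi, true_iff]
    rcases lt_trichotomy r j with h | h | h
    · exact Or.inl h
    · exact Or.inr (Or.inl (Or.inl h))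
    · rcases le_or_gt r Z with h' | h'
      · exact Or.inr (Or.inl (Or.inr ⟨h, h'⟩))
      · exact Or.inr (Or.inr h')
  rw [hsplit, Finset.sum_union, Finset.sum_union, Finset.sum_insert (by simp)]
  · have e0 : ∑ k ∈ Finset.Iio j, M i k * (tOfSigma Z σ k : ℂ) = 0 :=
      Finset.sum_eq_zero fun k hk => by rw [hi0 k (Finset.mem_Iio.mp hk), zero_mul]
    have e1 : ∑ k ∈ Finset.Ioc j Z, M i k * (tOfSigma Z σ k : ℂ) = (tOfSigma Z σ j : ℂ) *
        ∑ k ∈ Finset.Ioc j Z, M i k * ∏ r ∈ Finset.Ioc j k, (σ r : ℂ) := by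
      rw [Finset.mul_sum]
      refine Finset.sum_congr rfl fun k hk => ?_
      rw [hT k (Finset.mem_Ioc.mp hk).2 (Finset.mem_Ioc.mp hk).1.le]
      ring
    have e2 : ∑ k ∈ Finset.Ioi Z, M i k * (tOfSigma Z σ k : ℂ) = (tOfSigma Z σ j : ℂ) *
        ((∑ k ∈ Finset.Ioi Z, M i k * (σ k : ℂ)) * ∏ r ∈ Finset.Ioc j Z, (σ r : ℂ)) := by
      rw [Finset.sum_mul, Finset.mul_sum]
      refine Finset.sum_congr rfl fun k hk => ?_
      have hkZ : ¬ k ≤ Z := not_le.mpr (Finset.mem_Ioi.mp hk)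
      have h2 : (tOfSigma Z σ k : ℂ) = σ k * (tOfSigma Z σ Z : ℂ) := by
        rw [tOfSigma, if_neg hkZ, tOfSigma, if_pos le_rfl]; push_cast; rfl
      rw [h2, hT Z le_rfl hj]
      ring
    rw [e0, e1, e2, yFactor]
    ring
  · rw [Finset.disjoint_left]
    intro r h1 h2
    have h3 := Finset.mem_Ioi.mp h2
    rcases Finset.mem_insert.mp h1 with rfl | h
    · exact absurd hj (not_le.mpr h3)
    · exact absurd (Finset.mem_Ioc.mp h).2 (not_le.mpr h3)
  · rw [Finset.disjoint_left]
    intro r h1 h2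
    have h3 := Finset.mem_Iio.mp h1
    rcases Finset.mem_union.mp h2 with h2 | h2
    · rcases Finset.mem_insert.mp h2 with rfl | h
      · exact lt_irrefl _ h3
      · exact lt_asymm h3 (Finset.mem_Ioc.mp h).1
    · exact absurd (h3.le.trans hj) (not_le.mpr (Finset.mem_Ioi.mp h2))

/-- Every row has its first non-vanishing entry among the first `Z + 1` columns. -/
def HasLeading (M : Matrix (Fin N) (Fin n) ℂ) (Z : Fin n) : Prop :=
  ∀ i, ∃ j, j ≤ Z ∧ i ∈ leadingRows M j

/-- This is what the bound `Z` is for: the first `Z + 1` entries of a row cannot all vanish,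
whatever the order of the columns. -/
theorem hasLeading_of_zeroCount_le {M : Matrix (Fin N) (Fin n) ℂ} {Z : Fin n}
    (hZ : ∀ i, zeroCount M i ≤ (Z : ℕ)) : HasLeading M Z := by
  classical
  intro i
  have hex : ∃ j, j ≤ Z ∧ M i j ≠ 0 := by
    by_contra h
    push Not at h
    have hsub : Finset.Iic Z ⊆ Finset.univ.filter fun j => M i j = 0 := fun j hj => by
      simpa using h j (Finset.mem_Iic.mp hj)
    have h1 := Finset.card_le_card hsub
    have h2 := hZ i
    unfold zeroCount at h2
    rw [Fin.card_Iic] at h1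
    have h3 : (Finset.univ.filter fun j => M i j = 0).card ≤ Z.val := by convert h2
    omega
  have hne : (Finset.univ.filter fun j => j ≤ Z ∧ M i j ≠ 0).Nonempty := by
    obtain ⟨j, hj⟩ := hex
    exact ⟨j, by simpa using hj⟩
  set j₀ := (Finset.univ.filter fun j => j ≤ Z ∧ M i j ≠ 0).min' hne with hj₀
  have hmem := Finset.min'_mem _ hne
  rw [← hj₀] at hmem
  simp only [Finset.mem_filter, Finset.mem_univ, true_and] at hmem
  refine ⟨j₀, hmem.1, ?_⟩
  simp only [leadingRows, Finset.mem_filter, Finset.mem_univ, true_and]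
  refine ⟨fun k hk => ?_, hmem.2⟩
  by_contra hk0
  have := Finset.min'_le _ k (by
    simp only [Finset.mem_filter, Finset.mem_univ, true_and]
    exact ⟨hk.le.trans hmem.1, hk0⟩ : k ∈ Finset.univ.filter fun j => j ≤ Z ∧ M i j ≠ 0)
  exact absurd hk (not_lt.mpr this)

theorem leadingRows_unique {M : Matrix (Fin N) (Fin n) ℂ} {i : Fin N} {j k : Fin n}
    (hj : i ∈ leadingRows M j) (hk : i ∈ leadingRows M k) : j = k := by
  simp only [leadingRows, Finset.mem_filter, Finset.mem_univ, true_and] at hj hk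
  rcases lt_trichotomy j k with h | h | h
  · exact absurd (hk.1 j h) hj.2
  · exact h
  · exact absurd (hj.1 k h) hk.2

theorem prod_rows_eq {M : Matrix (Fin N) (Fin n) ℂ} {Z : Fin n} (hL : HasLeading M Z)
    {R : Type*} [CommMonoid R] (f : Fin N → R) :
    ∏ i, f i = ∏ j ∈ Finset.Iic Z, ∏ i ∈ leadingRows M j, f i := by
  classical
  rw [← Finset.prod_biUnion]
  · congr 1
    ext i
    simp only [Finset.mem_univ, Finset.mem_biUnion, Finset.mem_Iic, true_iff]
    exact hL i
  · intro j _ k _ hjk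
    rw [Function.onFun, Finset.disjoint_left]
    exact fun i hi hi' => hjk (leadingRows_unique hi hi')

theorem sum_card_leadingRows {M : Matrix (Fin N) (Fin n) ℂ} {Z : Fin n} (hL : HasLeading M Z) :
    ∑ j ∈ Finset.Iic Z, (leadingRows M j).card = N := by
  have := prod_rows_eq hL (fun _ => Multiplicative.ofAdd 1)
  have h2 := congrArg Multiplicative.toAdd this
  simpa [toAdd_prod] using h2.symm

/-- Each row led by column `j` contributes `T_j = σ_1 ⋯ σ_j`. So `σ_r` collects one factor for every
row whose leading column lies between `r` and `Z`. -/
theorem prod_linear_form_eq {M : Matrix (Fin N) (Fin n) ℂ} {Z : Fin n} (hL : HasLeading M Z)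
    (σ : Fin n → ℝ) :
    ∏ i, ∑ k, M i k * (tOfSigma Z σ k : ℂ) = (∏ j, (σ j : ℂ) ^ expShift M Z j) * yFun M Z σ := by
  rw [prod_rows_eq hL]
  have h1 : ∀ j ∈ Finset.Iic Z, ∏ i ∈ leadingRows M j, ∑ k, M i k * (tOfSigma Z σ k : ℂ) =
      (tOfSigma Z σ j : ℂ) ^ (leadingRows M j).card *
        ∏ i ∈ leadingRows M j, yFactor M Z i j σ := by
    intro j hj
    rw [Finset.prod_congr rfl fun i hi =>
      linear_form_eq_mul_yFactor (Finset.mem_Iic.mp hj) hi σ, Finset.prod_mul_distrib,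
      Finset.prod_const]
  rw [Finset.prod_congr rfl h1, Finset.prod_mul_distrib]
  congr 1
  have h2 : ∀ j ∈ Finset.Iic Z, (tOfSigma Z σ j : ℂ) ^ (leadingRows M j).card =
      ∏ r ∈ Finset.Iic j, (σ r : ℂ) ^ (leadingRows M j).card := by
    intro j hj
    rw [tOfSigma, if_pos (Finset.mem_Iic.mp hj), Complex.ofReal_prod, Finset.prod_pow]
  rw [Finset.prod_congr rfl h2,
    Finset.prod_comm' (t' := Finset.Iic Z) (s' := fun r => Finset.Icc r Z) (by
      intro x y
      simp only [Finset.mem_Iic, Finset.mem_Icc]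
      exact ⟨fun h => ⟨⟨h.2, h.1⟩, h.2.trans h.1⟩, fun h => ⟨h.1.2, h.1.1⟩⟩)]
  rw [← Finset.prod_subset (Finset.subset_univ (Finset.Iic Z))]
  · refine Finset.prod_congr rfl fun r hr => ?_
    rw [expShift, if_pos (Finset.mem_Iic.mp hr), Finset.prod_pow_eq_pow_sum]
  · intro r _ hr
    rw [expShift, if_neg (by simpa using hr), pow_zero]

/-- The regular factor of the integrand. -/
def regFun (Φ : ℂ → ℂ) (M : Matrix (Fin N) (Fin n) ℂ) (w : Fin n → ℂ) (Z : Fin n)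
    (σ : Fin n → ℝ) : ℂ :=
  Complex.exp (-∑ j, w j * (tOfSigma Z σ j : ℂ)) *
    ((yFun M Z σ)⁻¹ * ∏ i, Φ (∑ j, M i j * (tOfSigma Z σ j : ℂ)))

theorem integrand_eq {M : Matrix (Fin N) (Fin n) ℂ} {Z : Fin n} (hL : HasLeading M Z)
    (Φ : ℂ → ℂ) (w : Fin n → ℂ) (s : ℂ) {σ : Fin n → ℝ} (hσ : ∀ k, 0 < σ k) :
    ((∏ k, tFactor Z σ k : ℝ) : ℂ) * ((∏ k, (tOfSigma Z σ k : ℂ) ^ (s - 1)) *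
      Complex.exp (-∑ j, w j * (tOfSigma Z σ j : ℂ)) *
      ∏ i, (Φ (∑ j, M i j * (tOfSigma Z σ j : ℂ)) / ∑ j, M i j * (tOfSigma Z σ j : ℂ))) =
    (∏ j, (σ j : ℂ) ^ ((expCoeff Z j : ℂ) * s - expShift M Z j - 1)) * regFun Φ M w Z σ := by
  have hσ' : ∀ k, (σ k : ℂ) ≠ 0 := fun k => by exact_mod_cast (hσ k).ne'
  have e : ∀ j, (σ j : ℂ) ^ ((expCoeff Z j : ℂ) * s - expShift M Z j - 1) =
      (σ j : ℂ) ^ ((expCoeff Z j : ℂ) * s - 1) * ((σ j : ℂ) ^ expShift M Z j)⁻¹ := by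
    intro j
    rw [show (expCoeff Z j : ℂ) * s - expShift M Z j - 1 =
      ((expCoeff Z j : ℂ) * s - 1) - (expShift M Z j : ℂ) by ring, Complex.cpow_sub _ _ (hσ' j),
      Complex.cpow_natCast, div_eq_mul_inv]
  rw [Finset.prod_congr rfl fun j _ => e j, Finset.prod_mul_distrib, ← prod_tFactor_mul_cpow hσ,
    Finset.prod_div_distrib, prod_linear_form_eq hL, regFun, Finset.prod_inv_distrib,
    div_eq_mul_inv, mul_inv]
  ring

theorem integral_orthant_eq_sum_regFun {M : Matrix (Fin N) (Fin n) ℂ} {Z : Fin n}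
    (hL : ∀ γ : Equiv.Perm (Fin n), HasLeading (permCols M γ) Z) (Φ : ℂ → ℂ) (w : Fin n → ℂ) (s : ℂ)
    (hf : IntegrableOn (fun t : Fin n → ℝ => (∏ j, (t j : ℂ) ^ (s - 1)) *
      Complex.exp (-∑ j, w j * t j) *
        ∏ i, (Φ (∑ j, M i j * t j) / ∑ j, M i j * t j)) (orthant n)) :
    ∫ t in orthant n, (∏ j, (t j : ℂ) ^ (s - 1)) * Complex.exp (-∑ j, w j * t j) *
        ∏ i, (Φ (∑ j, M i j * t j) / ∑ j, M i j * t j) =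
      ∑ γ ∈ injections Z, ∫ σ in sigmaDomain n,
        (∏ j, (σ j : ℂ) ^ ((expCoeff Z j : ℂ) * s - expShift (permCols M γ) Z j - 1)) *
          regFun Φ (permCols M γ) (fun j => w (γ j)) Z σ := by
  rw [integral_orthant_eq Z hf]
  refine Finset.sum_congr rfl fun γ _ =>
    setIntegral_congr_fun (measurableSet_sigmaDomain n) fun σ hσ => ?_
  rw [← integrand_eq (hL γ) Φ _ s hσ.1]
  congr 1
  have hp : ∏ j, (((tOfSigma Z σ ∘ γ.symm) j : ℝ) : ℂ) ^ (s - 1) =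
      ∏ k, (tOfSigma Z σ k : ℂ) ^ (s - 1) := by
    rw [← Equiv.prod_comp γ]; simp
  have hs1 : ∑ j, w j * (((tOfSigma Z σ ∘ γ.symm) j : ℝ) : ℂ) =
      ∑ j, w (γ j) * (tOfSigma Z σ j : ℂ) := by
    rw [← Equiv.sum_comp γ]; simp
  have hs2 : ∀ i, ∑ j, M i j * (((tOfSigma Z σ ∘ γ.symm) j : ℝ) : ℂ) =
      ∑ j, permCols M γ i j * (tOfSigma Z σ j : ℂ) := by
    intro i
    rw [← Equiv.sum_comp γ]; simp [permCols]
  rw [hp, hs1]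
  simp only [hs2]

end

section

/-! ### A differential algebra of functions -/

variable {N n : ℕ}

/-- A smooth cutoff: `1` for `x ≤ 1/3` and `0` for `x ≥ 2/3`. -/
def cutoff (x : ℝ) : ℝ := Real.smoothTransition (2 - 3 * x)

theorem contDiff_cutoff : ContDiff ℝ ∞ cutoff :=
  Real.smoothTransition.contDiff.comp (contDiff_const.sub (contDiff_const.mul contDiff_id))

theorem cutoff_of_le {x : ℝ} (hx : x ≤ 1 / 3) : cutoff x = 1 :=
  Real.smoothTransition.one_of_one_le (by linarith)

theorem cutoff_of_ge {x : ℝ} (hx : 2 / 3 ≤ x) : cutoff x = 0 :=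
  Real.smoothTransition.zero_of_nonpos (by linarith)

theorem contDiff_iteratedDeriv_cutoff (m : ℕ) : ContDiff ℝ ∞ (iteratedDeriv m cutoff) := by
  induction m with
  | zero => simpa using contDiff_cutoff
  | succ m ih =>
    rw [iteratedDeriv_succ]
    exact (contDiff_infty_iff_deriv.mp ih).2

/-- The properties of `Φ = φ` and `Φ = 1` that the proof uses. -/
structure IsAdmissible (Φ : ℂ → ℂ) : Prop where
  analyticAt : ∀ z : ℂ, z = 0 ∨ z.re ≠ 0 → AnalyticAt ℂ Φ z
  bound : ∀ (m : ℕ) (C : ℝ), ∃ B, ∀ z : ℂ, 0 ≤ z.re → |z.im| ≤ C * z.re →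
    ‖iteratedDeriv m Φ z‖ ≤ B * (1 + ‖z‖)
  rational : ∀ m : ℕ, ∃ q : ℚ, iteratedDeriv m Φ 0 = q

theorem IsAdmissible.analyticAt_iteratedDeriv {Φ : ℂ → ℂ} (hΦ : IsAdmissible Φ) (m : ℕ) {z : ℂ}
    (hz : z = 0 ∨ z.re ≠ 0) : AnalyticAt ℂ (iteratedDeriv m Φ) z := by
  rw [iteratedDeriv_eq_iterate]
  exact (hΦ.analyticAt z hz).iterated_deriv m

/-- The `i`-th linear form as a function of `σ`. -/
def linForm (M : Matrix (Fin N) (Fin n) ℂ) (Z : Fin n) (i : Fin N) (σ : Fin n → ℝ) : ℂ :=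
  ∑ j, M i j * (tOfSigma Z σ j : ℂ)

/-- An open set on which the regular factor of the integrand is smooth. -/
def regSet (M : Matrix (Fin N) (Fin n) ℂ) (Z : Fin n) : Set (Fin n → ℝ) :=
  {σ | ∀ j i, j ≤ Z → i ∈ leadingRows M j → 0 < (yFactor M Z i j σ).re}

theorem contDiff_yFactor (M : Matrix (Fin N) (Fin n) ℂ) (Z : Fin n) (i : Fin N) (j : Fin n) :
    ContDiff ℝ ∞ (yFactor M Z i j) := by
  have h : ∀ r : Fin n, ContDiff ℝ ∞ fun σ : Fin n → ℝ => ((σ r : ℝ) : ℂ) := fun r =>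
    Complex.ofRealCLM.contDiff.comp (contDiff_apply ℝ ℝ r)
  unfold yFactor
  refine (contDiff_const.add (ContDiff.sum fun k _ => contDiff_const.mul
    (contDiff_prod fun r _ => h r))).add ((ContDiff.sum fun k _ => contDiff_const.mul (h k)).mul
    (contDiff_prod fun r _ => h r))

theorem contDiff_linForm (M : Matrix (Fin N) (Fin n) ℂ) (Z : Fin n) (i : Fin N) :
    ContDiff ℝ ∞ (linForm M Z i) := by
  unfold linForm
  exact ContDiff.sum fun j _ => contDiff_const.mul
    (Complex.ofRealCLM.contDiff.comp ((contDiff_tOfSigma_apply Z j).of_le le_top))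

theorem isOpen_regSet (M : Matrix (Fin N) (Fin n) ℂ) (Z : Fin n) : IsOpen (regSet M Z) := by
  have : regSet M Z = ⋂ j, ⋂ i, {σ | j ≤ Z → i ∈ leadingRows M j → 0 < (yFactor M Z i j σ).re} := by
    ext σ
    simp [regSet]
  rw [this]
  refine isOpen_iInter_of_finite fun j => isOpen_iInter_of_finite fun i => ?_
  by_cases h : j ≤ Z ∧ i ∈ leadingRows M j
  · simp only [h.1, h.2, forall_true_left]
    exact isOpen_lt continuous_const
      (Complex.continuous_re.comp (contDiff_yFactor M Z i j).continuous)
  · have : {σ | j ≤ Z → i ∈ leadingRows M j → 0 < (yFactor M Z i j σ).re} = Set.univ := by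
      ext σ
      simp only [Set.mem_ofPred_eq, Set.mem_univ, iff_true]
      exact fun h1 h2 => absurd ⟨h1, h2⟩ h
    rw [this]
    exact isOpen_univ

/-- All other terms are entries of nonnegative real part with nonnegative real coefficients. For a
leading entry this keeps the factors of `yFun` away from `0` on the whole closed orthant, the origin
included. -/
theorem re_le_re_yFactor {M : Matrix (Fin N) (Fin n) ℂ} (hM : HypothesisH M) {Z j : Fin n}
    {i : Fin N} {σ : Fin n → ℝ} (hσ : ∀ k, 0 ≤ σ k) :
    (M i j).re ≤ (yFactor M Z i j σ).re := by
  have hp : ∀ S : Finset (Fin n), ∏ r ∈ S, (σ r : ℂ) = ((∏ r ∈ S, σ r : ℝ) : ℂ) := fun S => by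
    push_cast; rfl
  unfold yFactor
  rw [Complex.add_re, Complex.add_re, hp, Complex.re_mul_ofReal, Complex.re_sum, Complex.re_sum,
    add_assoc]
  refine le_add_of_nonneg_right (add_nonneg (Finset.sum_nonneg fun k _ => ?_)
    (mul_nonneg (Finset.sum_nonneg fun k _ => ?_) (Finset.prod_nonneg fun r _ => hσ r)))
  · rw [hp, Complex.re_mul_ofReal]
    exact mul_nonneg (hM.re_nonneg i k) (Finset.prod_nonneg fun r _ => hσ r)
  · rw [Complex.re_mul_ofReal]
    exact mul_nonneg (hM.re_nonneg i k) (hσ k)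

theorem re_leading_pos {M : Matrix (Fin N) (Fin n) ℂ} (hM : HypothesisH M) {j : Fin n}
    {i : Fin N} (hi : i ∈ leadingRows M j) : 0 < (M i j).re := by
  simp only [leadingRows, Finset.mem_filter, Finset.mem_univ, true_and] at hi
  exact (hM.1 i j).resolve_left hi.2

theorem mem_regSet_of_nonneg {M : Matrix (Fin N) (Fin n) ℂ} (hM : HypothesisH M) (Z : Fin n)
    {σ : Fin n → ℝ} (hσ : ∀ k, 0 ≤ σ k) : σ ∈ regSet M Z := fun _ _ _ hi =>
  (re_leading_pos hM hi).trans_le (re_le_re_yFactor hM hσ)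

/-- The form is the real number `T_j` times a factor of positive real part. Near the boundary of the
orthant `T_j` may be negative, hence a statement about nonvanishing; it suffices for analyticity of
`Φ`, since `φ` has its poles on the imaginary axis away from `0`. -/
theorem linForm_eq_zero_or {M : Matrix (Fin N) (Fin n) ℂ} {Z : Fin n} (hL : HasLeading M Z)
    {σ : Fin n → ℝ} (hσ : σ ∈ regSet M Z) (i : Fin N) :
    linForm M Z i σ = 0 ∨ (linForm M Z i σ).re ≠ 0 := by
  obtain ⟨j, hj, hi⟩ := hL i
  have h := linear_form_eq_mul_yFactor hj hi σ
  rw [linForm, h]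
  by_cases h0 : tOfSigma Z σ j = 0
  · left; simp [h0]
  · right
    rw [Complex.re_ofReal_mul]
    exact mul_ne_zero h0 (hσ j i hj hi).ne'

/-- The algebra generated by the coordinates, the inverses of the factors of `yFun`, the
derivatives of `Φ` at the linear forms, and the derivatives of the cutoff. -/
inductive Elem (F : IntermediateField ℚ ℂ) (Φ : ℂ → ℂ) (M : Matrix (Fin N) (Fin n) ℂ) (Z : Fin n) :
    ((Fin n → ℂ) → (Fin n → ℝ) → ℂ) → Prop
  | const (c : ℂ) (hc : c ∈ F) : Elem F Φ M Z fun _ _ => c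
  | param (j : Fin n) : Elem F Φ M Z fun w _ => w j
  | coord (j : Fin n) : Elem F Φ M Z fun _ σ => (σ j : ℂ)
  | yInv (i : Fin N) (j : Fin n) (hj : j ≤ Z) (hi : i ∈ leadingRows M j) :
      Elem F Φ M Z fun _ σ => (yFactor M Z i j σ)⁻¹
  | phi (m : ℕ) (i : Fin N) : Elem F Φ M Z fun _ σ => iteratedDeriv m Φ (linForm M Z i σ)
  | cut (m : ℕ) (j : Fin n) (hj : j.val ≠ 0) :
      Elem F Φ M Z fun _ σ => ((iteratedDeriv m cutoff (σ j) : ℝ) : ℂ)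
  | add {f g : (Fin n → ℂ) → (Fin n → ℝ) → ℂ} (hf : Elem F Φ M Z f) (hg : Elem F Φ M Z g) :
      Elem F Φ M Z fun w σ => f w σ + g w σ
  | mul {f g : (Fin n → ℂ) → (Fin n → ℝ) → ℂ} (hf : Elem F Φ M Z f) (hg : Elem F Φ M Z g) :
      Elem F Φ M Z fun w σ => f w σ * g w σ

variable {F : IntermediateField ℚ ℂ} {Φ : ℂ → ℂ} {M : Matrix (Fin N) (Fin n) ℂ} {Z : Fin n}

theorem Elem.prod {ι : Type*} (S : Finset ι) {f : ι → (Fin n → ℂ) → (Fin n → ℝ) → ℂ}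
    (hf : ∀ i ∈ S, Elem F Φ M Z (f i)) : Elem F Φ M Z fun w σ => ∏ i ∈ S, f i w σ := by
  classical
  induction S using Finset.induction_on with
  | empty => simpa using Elem.const 1 F.one_mem
  | insert a S ha ih =>
    simp only [Finset.prod_insert ha]
    exact (hf a (by simp)).mul (ih fun i hi => hf i (by simp [hi]))

/-- `f` and its `j`-th partial derivative belong to the algebra. -/
def HasElemDeriv (F : IntermediateField ℚ ℂ) (Φ : ℂ → ℂ) (M : Matrix (Fin N) (Fin n) ℂ) (Z : Fin n)
    (j : Fin n) (f : (Fin n → ℂ) → (Fin n → ℝ) → ℂ) : Prop :=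
  Elem F Φ M Z f ∧ ∃ g, Elem F Φ M Z g ∧ ∀ w, ∀ σ ∈ regSet M Z,
    HasLineDerivAt ℝ (f w) (g w σ) σ (Pi.single j 1)

namespace HasElemDeriv

variable {j : Fin n} {f g : (Fin n → ℂ) → (Fin n → ℝ) → ℂ}

theorem add (hf : HasElemDeriv F Φ M Z j f) (hg : HasElemDeriv F Φ M Z j g) :
    HasElemDeriv F Φ M Z j fun w σ => f w σ + g w σ := by
  obtain ⟨hf, f', hf', hfd⟩ := hf
  obtain ⟨hg, g', hg', hgd⟩ := hg
  exact ⟨hf.add hg, _, hf'.add hg', fun w σ hσ => HasDerivAt.add (hfd w σ hσ) (hgd w σ hσ)⟩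

theorem mul (hf : HasElemDeriv F Φ M Z j f) (hg : HasElemDeriv F Φ M Z j g) :
    HasElemDeriv F Φ M Z j fun w σ => f w σ * g w σ := by
  obtain ⟨hf, f', hf', hfd⟩ := hf
  obtain ⟨hg, g', hg', hgd⟩ := hg
  refine ⟨hf.mul hg, _, (hf'.mul hg).add (hf.mul hg'), fun w σ hσ => ?_⟩
  have := HasDerivAt.mul (hfd w σ hσ) (hgd w σ hσ)
  simp only [zero_smul, add_zero] at this
  exact this

theorem const {c : ℂ} (hc : c ∈ F) : HasElemDeriv F Φ M Z j fun _ _ => c :=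
  ⟨Elem.const c hc, _, Elem.const 0 F.zero_mem, fun _ _ _ => hasDerivAt_const _ _⟩

theorem param (k : Fin n) : HasElemDeriv F Φ M Z j fun w _ => w k :=
  ⟨Elem.param k, _, Elem.const 0 F.zero_mem, fun _ _ _ => hasDerivAt_const _ _⟩

theorem hasDerivAt_coord (σ : Fin n → ℝ) (j k : Fin n) :
    HasDerivAt (fun t : ℝ => (σ + t • (Pi.single j 1 : Fin n → ℝ)) k) (if k = j then 1 else 0)
      0 := by
  by_cases h : k = j
  · subst h
    simpa using (hasDerivAt_id (0 : ℝ)).const_add (σ k)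
  · simpa [h] using hasDerivAt_const (0 : ℝ) (σ k)

theorem coord (k : Fin n) : HasElemDeriv F Φ M Z j fun _ σ => (σ k : ℂ) := by
  refine ⟨Elem.coord k, fun _ _ => if k = j then 1 else 0, ?_, fun w σ _ => ?_⟩
  · split_ifs
    · exact Elem.const 1 F.one_mem
    · exact Elem.const 0 F.zero_mem
  · have := (hasDerivAt_coord σ j k).ofReal_comp
    exact this.congr_deriv (by split_ifs <;> simp)

theorem prod {ι : Type*} (S : Finset ι) {f : ι → (Fin n → ℂ) → (Fin n → ℝ) → ℂ}
    (hf : ∀ i ∈ S, HasElemDeriv F Φ M Z j (f i)) :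
    HasElemDeriv F Φ M Z j fun w σ => ∏ i ∈ S, f i w σ := by
  classical
  induction S using Finset.induction_on with
  | empty => simpa using const F.one_mem
  | insert a S ha ih =>
    simp only [Finset.prod_insert ha]
    exact (hf a (by simp)).mul (ih fun i hi => hf i (by simp [hi]))

theorem sum {ι : Type*} (S : Finset ι) {f : ι → (Fin n → ℂ) → (Fin n → ℝ) → ℂ}
    (hf : ∀ i ∈ S, HasElemDeriv F Φ M Z j (f i)) :
    HasElemDeriv F Φ M Z j fun w σ => ∑ i ∈ S, f i w σ := by
  classical
  induction S using Finset.induction_on with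
  | empty => simpa using const F.zero_mem
  | insert a S ha ih =>
    simp only [Finset.sum_insert ha]
    exact (hf a (by simp)).add (ih fun i hi => hf i (by simp [hi]))

theorem tOfSigma (k : Fin n) :
    HasElemDeriv F Φ M Z j fun _ σ => (ShintaniBarnes.tOfSigma Z σ k : ℂ) := by
  simp only [tOfSigma_eq_prod, Complex.ofReal_prod]
  exact prod _ fun r _ => coord r

theorem linForm (hF : ∀ i j, M i j ∈ F) (i : Fin N) :
    HasElemDeriv F Φ M Z j fun _ σ => ShintaniBarnes.linForm M Z i σ :=
  sum _ fun k _ => (const (hF i k)).mul (tOfSigma k)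

theorem yFactor (hF : ∀ i j, M i j ∈ F) (i : Fin N) (k : Fin n) :
    HasElemDeriv F Φ M Z j fun _ σ => ShintaniBarnes.yFactor M Z i k σ :=
  ((const (hF i k)).add (sum _ fun k _ => (const (hF i k)).mul (prod _ fun r _ => coord r))).add
    ((sum _ fun k _ => (const (hF i k)).mul (coord k)).mul (prod _ fun r _ => coord r))

end HasElemDeriv

/-- The algebra is closed under partial derivatives by design: derivatives of `Φ` and of the cutoff
of every order are generators, and differentiating an inverse factor gives a polynomial in the `σ_k`
times the square of that inverse. -/
theorem Elem.hasElemDeriv (hF : ∀ i j, M i j ∈ F) (hL : HasLeading M Z) (hΦ : IsAdmissible Φ)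
    (j : Fin n) {f : (Fin n → ℂ) → (Fin n → ℝ) → ℂ} (hf : Elem F Φ M Z f) :
    HasElemDeriv F Φ M Z j f := by
  induction hf with
  | const c hc => exact HasElemDeriv.const hc
  | param k => exact HasElemDeriv.param k
  | coord k => exact HasElemDeriv.coord k
  | add _ _ ihf ihg => exact ihf.add ihg
  | mul _ _ ihf ihg => exact ihf.mul ihg
  | yInv i k hk hi =>
    obtain ⟨-, g, hg, hgd⟩ := HasElemDeriv.yFactor (Φ := Φ) (Z := Z) (j := j) hF i k
    refine ⟨Elem.yInv i k hk hi, _, ((Elem.const (-1) (F.neg_mem F.one_mem)).mul hg).mul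
      ((Elem.yInv i k hk hi).mul (Elem.yInv i k hk hi)), fun w σ hσ => ?_⟩
    have h0 : yFactor M Z i k σ ≠ 0 := fun h => by
      have := hσ k i hk hi
      rw [h] at this
      simp at this
    have h1 : HasDerivAt (fun t : ℝ => yFactor M Z i k (σ + t • Pi.single j 1)) (g w σ) 0 :=
      hgd w σ hσ
    have := h1.inv (by simpa using h0)
    refine this.congr_deriv ?_
    rw [zero_smul, add_zero]
    field_simp
  | phi m i =>
    obtain ⟨-, g, hg, hgd⟩ := HasElemDeriv.linForm (Φ := Φ) (Z := Z) (j := j) hF i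
    refine ⟨Elem.phi m i, _, (Elem.phi (m + 1) i).mul hg, fun w σ hσ => ?_⟩
    have h1 : HasDerivAt (fun t : ℝ => linForm M Z i (σ + t • Pi.single j 1)) (g w σ) 0 :=
      hgd w σ hσ
    have h2 := (hΦ.analyticAt_iteratedDeriv m (linForm_eq_zero_or hL hσ i)).differentiableAt
    have h3 : HasDerivAt (iteratedDeriv m Φ) (iteratedDeriv (m + 1) Φ (linForm M Z i σ))
        (linForm M Z i (σ + (0 : ℝ) • Pi.single j 1)) := by
      rw [zero_smul, add_zero, iteratedDeriv_succ]
      exact h2.hasDerivAt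
    exact h3.comp (0 : ℝ) h1
  | cut m k hk =>
    refine ⟨Elem.cut m k hk, fun _ σ => ((iteratedDeriv (m + 1) cutoff (σ k) : ℝ) : ℂ) *
      if k = j then 1 else 0, (Elem.cut (m + 1) k hk).mul ?_, fun w σ _ => ?_⟩
    · split_ifs
      · exact Elem.const 1 F.one_mem
      · exact Elem.const 0 F.zero_mem
    · have h1 := HasElemDeriv.hasDerivAt_coord σ j k
      have h2 : HasDerivAt (iteratedDeriv m cutoff) (iteratedDeriv (m + 1) cutoff (σ k))
          ((σ + (0 : ℝ) • (Pi.single j 1 : Fin n → ℝ)) k) := by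
        rw [zero_smul, add_zero, iteratedDeriv_succ]
        exact ((contDiff_iteratedDeriv_cutoff m).differentiable (by simp) _).hasDerivAt
      have h3 := (h2.comp (0 : ℝ) h1).ofReal_comp
      exact h3.congr_deriv (by split_ifs <;> simp)

/-! ### Smoothness, growth and values at the origin of elements of the algebra. -/

theorem Elem.contDiffAt (hL : HasLeading M Z) (hΦ : IsAdmissible Φ)
    {f : (Fin n → ℂ) → (Fin n → ℝ) → ℂ} (hf : Elem F Φ M Z f) (w : Fin n → ℂ) {σ : Fin n → ℝ}
    (hσ : σ ∈ regSet M Z) : ContDiffAt ℝ ∞ (f w) σ := by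
  induction hf with
  | const c hc => exact contDiffAt_const
  | param k => exact contDiffAt_const
  | coord k => exact (Complex.ofRealCLM.contDiff.comp (contDiff_apply ℝ ℝ k)).contDiffAt
  | add _ _ ihf ihg => exact ihf.add ihg
  | mul _ _ ihf ihg => exact ihf.mul ihg
  | yInv i k hk hi =>
    refine (contDiff_yFactor M Z i k).contDiffAt.inv fun h => ?_
    have := hσ k i hk hi
    rw [h] at this
    simp at this
  | phi m i =>
    have h2 := (hΦ.analyticAt_iteratedDeriv m (linForm_eq_zero_or hL hσ i)).contDiffAt (n := ∞)
    exact (h2.restrict_scalars ℝ).comp σ (contDiff_linForm M Z i).contDiffAt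
  | cut m k hk =>
    exact (Complex.ofRealCLM.contDiff.comp
      ((contDiff_iteratedDeriv_cutoff m).comp (contDiff_apply ℝ ℝ k))).contDiffAt

/-- The closure of `sigmaDomain`. -/
def sigmaClosed (n : ℕ) : Set (Fin n → ℝ) :=
  {σ | (∀ k, 0 ≤ σ k) ∧ ∀ k : Fin n, k.val ≠ 0 → σ k ≤ 1}

theorem tOfSigma_le {σ : Fin n → ℝ} (hσ : σ ∈ sigmaClosed n) (k : Fin n) :
    tOfSigma Z σ k ≤ σ (firstIndex Z) := by
  induction k using WellFoundedLT.induction with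
  | ind k ih =>
    rw [tOfSigma_eq, tFactor]
    split_ifs with hk
    · have : k = firstIndex Z := Fin.ext hk
      rw [mul_one, this]
    · have h1 := ih _ (prevIdx_lt hk (Z := Z))
      have h2 := tOfSigma_nonneg (Z := Z) hσ.1 (prevIdx Z k)
      nlinarith [hσ.2 k hk, hσ.1 k]

/-- On the closed domain only the first coordinate is unbounded, so growth is measured in that
variable alone; inverse factors and cutoffs are bounded there, and `Φ` and its derivatives grow at
most linearly. -/
theorem Elem.exists_bound (hM : HypothesisH M) (hΦ : IsAdmissible Φ)
    {f : (Fin n → ℂ) → (Fin n → ℝ) → ℂ} (hf : Elem F Φ M Z f) (w : Fin n → ℂ) :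
    ∃ (C : ℝ) (p : ℕ), 0 ≤ C ∧ ∀ σ ∈ sigmaClosed n,
      ‖f w σ‖ ≤ C * (1 + σ (firstIndex Z)) ^ p := by
  have key : ∀ (h : (Fin n → ℝ) → ℂ) (C : ℝ),
      (∀ σ ∈ sigmaClosed n, ‖h σ‖ ≤ C) → ∃ (C : ℝ) (p : ℕ), 0 ≤ C ∧ ∀ σ ∈ sigmaClosed n,
      ‖h σ‖ ≤ C * (1 + σ (firstIndex Z)) ^ p := fun h C hC =>
    ⟨|C|, 0, abs_nonneg _, fun σ hσ => by simpa using (hC σ hσ).trans (le_abs_self C)⟩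
  induction hf with
  | const c hc => exact key (fun _ => c) ‖c‖ fun σ _ => le_rfl
  | param k => exact key (fun _ => w k) ‖w k‖ fun σ _ => le_rfl
  | coord k =>
    refine ⟨1, 1, zero_le_one, fun σ hσ => ?_⟩
    rw [Complex.norm_real, Real.norm_of_nonneg (hσ.1 k), one_mul, pow_one]
    by_cases hk : k.val = 0
    · have : k = firstIndex Z := Fin.ext hk
      rw [this]; linarith
    · linarith [hσ.2 k hk, hσ.1 (firstIndex Z)]
  | add _ _ ihf ihg =>
    obtain ⟨C, p, hC, hf⟩ := ihf
    obtain ⟨D, q, hD, hg⟩ := ihg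
    refine ⟨C + D, max p q, add_nonneg hC hD, fun σ hσ => (norm_add_le _ _).trans ?_⟩
    have h1 : 1 ≤ 1 + σ (firstIndex Z) := by linarith [hσ.1 (firstIndex Z)]
    rw [add_mul]
    exact add_le_add ((hf σ hσ).trans (by gcongr; exact le_max_left p q))
      ((hg σ hσ).trans (by gcongr; exact le_max_right p q))
  | mul _ _ ihf ihg =>
    obtain ⟨C, p, hC, hf⟩ := ihf
    obtain ⟨D, q, hD, hg⟩ := ihg
    refine ⟨C * D, p + q, mul_nonneg hC hD, fun σ hσ => ?_⟩
    have h1 : 0 ≤ 1 + σ (firstIndex Z) := by linarith [hσ.1 (firstIndex Z)]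
    rw [norm_mul, pow_add, mul_mul_mul_comm]
    exact mul_le_mul (hf σ hσ) (hg σ hσ) (norm_nonneg _) (by positivity)
  | yInv i k hk hi =>
    refine key (fun σ => (yFactor M Z i k σ)⁻¹) ((M i k).re)⁻¹ fun σ hσ => ?_
    rw [norm_inv]
    exact inv_anti₀ (re_leading_pos hM hi) ((re_le_re_yFactor hM hσ.1).trans
      ((le_abs_self _).trans (Complex.abs_re_le_norm _)))
  | cut m k hk =>
    obtain ⟨C, hC⟩ := isCompact_Icc.exists_bound_of_continuousOn (s := Set.Icc (0 : ℝ) 1)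
      (contDiff_iteratedDeriv_cutoff m).continuous.continuousOn
    refine key (fun σ => ((iteratedDeriv m cutoff (σ k) : ℝ) : ℂ)) C fun σ hσ => ?_
    rw [Complex.norm_real]
    exact hC _ ⟨hσ.1 k, hσ.2 k hk⟩
  | phi m i =>
    -- This `C` is the slope of a cone `|Im z| ≤ C Re z` containing all nonzero entries of row `i`,
    -- hence all values of the form; a zero entry contributes `0 / 0 = 0`. In such a cone
    -- `IsAdmissible.bound` applies.
    set C := ∑ j, |(M i j).im| / (M i j).re with hC
    have hq : ∀ j, 0 ≤ |(M i j).im| / (M i j).re := fun j =>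
      div_nonneg (abs_nonneg _) (hM.re_nonneg i j)
    have hCj : ∀ j, |(M i j).im| ≤ C * (M i j).re := by
      intro j
      rcases hM.1 i j with h | h
      · simp [h]
      · rw [← div_le_iff₀ h]
        exact Finset.single_le_sum (f := fun j => |(M i j).im| / (M i j).re)
          (fun j _ => hq j) (Finset.mem_univ j)
    obtain ⟨B, hB⟩ := hΦ.bound m C
    set A := ∑ j, ‖M i j‖ with hA
    have hA0 : 0 ≤ A := Finset.sum_nonneg fun j _ => norm_nonneg _
    refine ⟨|B| * (1 + A), 1, by positivity, fun σ hσ => ?_⟩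
    have hT := tOfSigma_nonneg (Z := Z) hσ.1
    have h0 : 0 ≤ (linForm M Z i σ).re := by
      unfold linForm
      rw [Complex.re_sum]
      refine Finset.sum_nonneg fun j _ => ?_
      rw [Complex.re_mul_ofReal]
      exact mul_nonneg (hM.re_nonneg i j) (hT j)
    have h1 : |(linForm M Z i σ).im| ≤ C * (linForm M Z i σ).re := by
      unfold linForm
      rw [Complex.im_sum, Complex.re_sum, Finset.mul_sum]
      refine (Finset.abs_sum_le_sum_abs _ _).trans (Finset.sum_le_sum fun j _ => ?_)
      rw [Complex.im_mul_ofReal, Complex.re_mul_ofReal, abs_mul, abs_of_nonneg (hT j), ← mul_assoc]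
      exact mul_le_mul_of_nonneg_right (hCj j) (hT j)
    have h2 : ‖linForm M Z i σ‖ ≤ A * σ (firstIndex Z) := by
      unfold linForm
      rw [hA, Finset.sum_mul]
      refine (norm_sum_le _ _).trans (Finset.sum_le_sum fun j _ => ?_)
      rw [norm_mul, Complex.norm_real, Real.norm_of_nonneg (hT j)]
      exact mul_le_mul_of_nonneg_left (tOfSigma_le hσ j) (norm_nonneg _)
    have h3 := hσ.1 (firstIndex Z)
    calc _ ≤ B * (1 + ‖linForm M Z i σ‖) := hB _ h0 h1
      _ ≤ |B| * (1 + ‖linForm M Z i σ‖) := by gcongr; exact le_abs_self B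
      _ ≤ |B| * ((1 + A) * (1 + σ (firstIndex Z))) := by gcongr; nlinarith
      _ = _ := by ring

theorem tOfSigma_zero (k : Fin n) : tOfSigma Z 0 k = 0 := by
  rw [tOfSigma_eq]; simp

theorem yFactor_zero (i : Fin N) (j : Fin n) : yFactor M Z i j 0 = M i j := by
  unfold yFactor
  rw [Finset.sum_eq_zero, Finset.sum_eq_zero]
  · simp
  · intro k _; simp
  · intro k hk
    rw [Finset.prod_eq_zero (i := k), mul_zero]
    · exact Finset.mem_Ioc.mpr ⟨(Finset.mem_Ioc.mp hk).1, le_rfl⟩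
    · simp

/-- At the origin the linear forms vanish, so that `Φ` contributes its rational Taylor data, and the
factors of `yFun` reduce to entries of `M`; only the parameters `w_j` remain free. -/
theorem Elem.exists_polynomial (hF : ∀ i j, M i j ∈ F) (hΦ : IsAdmissible Φ)
    {f : (Fin n → ℂ) → (Fin n → ℝ) → ℂ} (hf : Elem F Φ M Z f) :
    ∃ P : MvPolynomial (Fin n) F, ∀ w, f w 0 = MvPolynomial.aeval w P := by
  have key : ∀ c ∈ F, ∃ P : MvPolynomial (Fin n) F, ∀ w : Fin n → ℂ,
      c = MvPolynomial.aeval w P := fun c hc =>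
    ⟨MvPolynomial.C ⟨c, hc⟩, fun w => by simp⟩
  induction hf with
  | const c hc => exact key c hc
  | param k => exact ⟨MvPolynomial.X k, fun w => by simp⟩
  | coord k => exact ⟨0, fun w => by simp⟩
  | add _ _ ihf ihg =>
    obtain ⟨P, hP⟩ := ihf
    obtain ⟨Q, hQ⟩ := ihg
    exact ⟨P + Q, fun w => by simp only [map_add, hP, hQ]⟩
  | mul _ _ ihf ihg =>
    obtain ⟨P, hP⟩ := ihf
    obtain ⟨Q, hQ⟩ := ihg
    exact ⟨P * Q, fun w => by simp only [map_mul, hP, hQ]⟩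
  | yInv i k hk hi => simpa only [yFactor_zero] using key _ (F.inv_mem (hF i k))
  | phi m i =>
    obtain ⟨q, hq⟩ := hΦ.rational m
    have h0 : linForm M Z i 0 = 0 := by simp [linForm, tOfSigma_zero]
    simp only [h0, hq]
    exact key _ (by simp)
  | cut m k hk =>
    -- Near `0` the cutoff is constant, so its derivatives there are `1` or `0`.
    have h1 : cutoff =ᶠ[𝓝 (0 : ℝ)] fun _ => 1 := by
      filter_upwards [Iio_mem_nhds (show (0 : ℝ) < 1 / 3 by norm_num)] with x hx
      exact cutoff_of_le (le_of_lt hx)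
    simp only [Pi.zero_apply, h1.iteratedDeriv_eq, iteratedDeriv_const]
    split_ifs
    · simpa using key 1 F.one_mem
    · simpa using key 0 F.zero_mem

end

section

/-! ### Partial derivatives -/

section Partial

variable {n : ℕ}

theorem partialDeriv_congr {f g : (Fin n → ℝ) → ℂ} {σ : Fin n → ℝ} (h : f =ᶠ[𝓝 σ] g)
    (j : Fin n) : partialDeriv j f =ᶠ[𝓝 σ] partialDeriv j g := by
  filter_upwards [eventually_eventually_nhds.mpr h] with τ hτ
  exact Filter.EventuallyEq.lineDeriv_eq hτ

theorem iterate_partialDeriv_congr {f g : (Fin n → ℝ) → ℂ} {σ : Fin n → ℝ} (h : f =ᶠ[𝓝 σ] g)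
    (j : Fin n) (m : ℕ) : (partialDeriv j)^[m] f =ᶠ[𝓝 σ] (partialDeriv j)^[m] g := by
  induction m with
  | zero => exact h
  | succ m ih =>
    rw [Function.iterate_succ_apply', Function.iterate_succ_apply']
    exact partialDeriv_congr ih j

/-- The iterated partial derivative along a list of variables. -/
def listPartial (l : List (Fin n)) (A : Fin n → ℕ) (h : (Fin n → ℝ) → ℂ) : (Fin n → ℝ) → ℂ :=
  l.foldr (fun j f => (partialDeriv j)^[A j] f) h

theorem listPartial_cons (i : Fin n) (l : List (Fin n)) (A : Fin n → ℕ) (h : (Fin n → ℝ) → ℂ) :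
    listPartial (i :: l) A h = (partialDeriv i)^[A i] (listPartial l A h) := rfl

theorem mixedPartial_eq_listPartial (A : Fin n → ℕ) (h : (Fin n → ℝ) → ℂ) :
    mixedPartial A h = listPartial (List.finRange n) A h := rfl

theorem listPartial_congr {f g : (Fin n → ℝ) → ℂ} {σ : Fin n → ℝ} (h : f =ᶠ[𝓝 σ] g)
    (l : List (Fin n)) (A : Fin n → ℕ) : listPartial l A f =ᶠ[𝓝 σ] listPartial l A g := by
  induction l with
  | nil => exact h
  | cons i l ih => exact iterate_partialDeriv_congr ih i (A i)

theorem mixedPartial_congr {f g : (Fin n → ℝ) → ℂ} {σ : Fin n → ℝ} (h : f =ᶠ[𝓝 σ] g)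
    (A : Fin n → ℕ) : mixedPartial A f =ᶠ[𝓝 σ] mixedPartial A g :=
  listPartial_congr h _ A

theorem mixedPartial_zero_index (h : (Fin n → ℝ) → ℂ) : mixedPartial 0 h = h := by
  rw [mixedPartial_eq_listPartial]
  induction List.finRange n with
  | nil => rfl
  | cons i l ih => rw [listPartial_cons, ih]; rfl

theorem mixedPartial_zero_fun (A : Fin n → ℕ) : mixedPartial A (0 : (Fin n → ℝ) → ℂ) = 0 := by
  have h : ∀ j m, (partialDeriv j)^[m] (0 : (Fin n → ℝ) → ℂ) = 0 := by
    intro j m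
    induction m with
    | zero => rfl
    | succ m ih =>
      rw [Function.iterate_succ_apply', ih]
      funext σ
      simp [partialDeriv, lineDeriv]
  rw [mixedPartial_eq_listPartial]
  induction List.finRange n with
  | nil => rfl
  | cons i l ih => rw [listPartial_cons, ih, h]

/-- Smoothness at every point of a set. -/
def SmoothOn (U : Set (Fin n → ℝ)) (f : (Fin n → ℝ) → ℂ) : Prop := ∀ σ ∈ U, ContDiffAt ℝ ∞ f σ

variable {U : Set (Fin n → ℝ)} {f g : (Fin n → ℝ) → ℂ}

theorem SmoothOn.differentiableAt (hf : SmoothOn U f) {σ : Fin n → ℝ} (hσ : σ ∈ U) :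
    DifferentiableAt ℝ f σ := (hf σ hσ).differentiableAt (by simp)

theorem SmoothOn.partialDeriv_eventuallyEq (hU : IsOpen U) (hf : SmoothOn U f) (j : Fin n)
    {σ : Fin n → ℝ} (hσ : σ ∈ U) :
    partialDeriv j f =ᶠ[𝓝 σ] fun τ => fderiv ℝ f τ (Pi.single j 1) := by
  filter_upwards [hU.mem_nhds hσ] with τ hτ
  exact (hf.differentiableAt hτ).lineDeriv_eq_fderiv

theorem SmoothOn.partialDeriv (hU : IsOpen U) (hf : SmoothOn U f) (j : Fin n) :
    SmoothOn U (partialDeriv j f) := by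
  intro σ hσ
  have h1 : ContDiffAt ℝ ∞ (fun τ => fderiv ℝ f τ (Pi.single j 1)) σ :=
    ((hf σ hσ).fderiv_right (m := ∞) (by simp)).clm_apply contDiffAt_const
  exact h1.congr_of_eventuallyEq (hf.partialDeriv_eventuallyEq hU j hσ)

theorem SmoothOn.iterate_partialDeriv (hU : IsOpen U) (hf : SmoothOn U f) (j : Fin n) (m : ℕ) :
    SmoothOn U ((ShintaniBarnes.partialDeriv j)^[m] f) := by
  induction m with
  | zero => exact hf
  | succ m ih =>
    rw [Function.iterate_succ_apply']
    exact ih.partialDeriv hU j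

theorem SmoothOn.listPartial (hU : IsOpen U) (hf : SmoothOn U f) (l : List (Fin n))
    (A : Fin n → ℕ) : SmoothOn U (listPartial l A f) := by
  induction l with
  | nil => exact hf
  | cons i l ih => exact ih.iterate_partialDeriv hU i (A i)

theorem SmoothOn.mixedPartial (hU : IsOpen U) (hf : SmoothOn U f) (A : Fin n → ℕ) :
    SmoothOn U (mixedPartial A f) := hf.listPartial hU _ A

theorem SmoothOn.continuousOn (hf : SmoothOn U f) : ContinuousOn f U := fun σ hσ =>
  (hf σ hσ).continuousAt.continuousWithinAt

theorem eqOn_partialDeriv (hU : IsOpen U) (h : Set.EqOn f g U) (j : Fin n) :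
    Set.EqOn (partialDeriv j f) (partialDeriv j g) U := fun _ hσ =>
  (partialDeriv_congr (h.eventuallyEq_of_mem (hU.mem_nhds hσ)) j).self_of_nhds

theorem eqOn_iterate_partialDeriv (hU : IsOpen U) (h : Set.EqOn f g U) (j : Fin n) (m : ℕ) :
    Set.EqOn ((partialDeriv j)^[m] f) ((partialDeriv j)^[m] g) U := fun _ hσ =>
  (iterate_partialDeriv_congr (h.eventuallyEq_of_mem (hU.mem_nhds hσ)) j m).self_of_nhds

/-- `mixedPartial` fixes an order of differentiation. Symmetry of second derivatives is what allows
one more derivative in an arbitrary variable to be absorbed into the multi-index. -/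
theorem SmoothOn.partialDeriv_comm (hU : IsOpen U) (hf : SmoothOn U f) (i j : Fin n) :
    Set.EqOn (ShintaniBarnes.partialDeriv i (ShintaniBarnes.partialDeriv j f))
      (ShintaniBarnes.partialDeriv j (ShintaniBarnes.partialDeriv i f)) U := by
  have key : ∀ i j : Fin n, ∀ σ ∈ U,
      ShintaniBarnes.partialDeriv i (ShintaniBarnes.partialDeriv j f) σ =
        fderiv ℝ (fderiv ℝ f) σ (Pi.single i 1) (Pi.single j 1) := by
    intro i j σ hσ
    rw [(partialDeriv_congr (hf.partialDeriv_eventuallyEq hU j hσ) i).self_of_nhds]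
    have hd : DifferentiableAt ℝ (fderiv ℝ f) σ :=
      ((hf σ hσ).fderiv_right (m := ∞) (by simp)).differentiableAt (by simp)
    have h1 := hd.hasFDerivAt.clm_apply (hasFDerivAt_const (Pi.single j (1 : ℝ) : Fin n → ℝ) σ)
    rw [ShintaniBarnes.partialDeriv, (h1.hasLineDerivAt _).lineDeriv]
    simp
  intro σ hσ
  rw [key i j σ hσ, key j i σ hσ]
  exact ((hf σ hσ).isSymmSndFDerivAt
    (by rw [minSmoothness_of_isRCLikeNormedField]; exact ENat.LEInfty.out)) _ _

theorem SmoothOn.partialDeriv_iterate_comm (hU : IsOpen U) (hf : SmoothOn U f) (i j : Fin n)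
    (m : ℕ) :
    Set.EqOn (ShintaniBarnes.partialDeriv j ((ShintaniBarnes.partialDeriv i)^[m] f))
      ((ShintaniBarnes.partialDeriv i)^[m] (ShintaniBarnes.partialDeriv j f)) U := by
  induction m with
  | zero => exact fun _ _ => rfl
  | succ m ih =>
    rw [Function.iterate_succ_apply', Function.iterate_succ_apply']
    exact ((hf.iterate_partialDeriv hU i m).partialDeriv_comm hU j i).trans
      (eqOn_partialDeriv hU ih i)

theorem listPartial_add_single_of_notMem {l : List (Fin n)} {j : Fin n} (hj : j ∉ l)
    (A : Fin n → ℕ) : listPartial l (A + Pi.single j 1) f = listPartial l A f := by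
  induction l with
  | nil => rfl
  | cons i l ih =>
    rw [List.mem_cons, not_or] at hj
    rw [listPartial_cons, listPartial_cons, ih hj.2]
    simp [Ne.symm hj.1]

theorem SmoothOn.partialDeriv_listPartial (hU : IsOpen U) (hf : SmoothOn U f) {l : List (Fin n)}
    (hl : l.Nodup) {j : Fin n} (hj : j ∈ l) (A : Fin n → ℕ) :
    Set.EqOn (ShintaniBarnes.partialDeriv j (ShintaniBarnes.listPartial l A f))
      (ShintaniBarnes.listPartial l (A + Pi.single j 1) f) U := by
  induction l with
  | nil => simp at hj
  | cons i l ih =>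
    rw [List.nodup_cons] at hl
    rw [listPartial_cons, listPartial_cons]
    rcases eq_or_ne j i with rfl | hne
    · rw [listPartial_add_single_of_notMem hl.1, Pi.add_apply, Pi.single_eq_same,
        Function.iterate_succ_apply']
      exact fun _ _ => rfl
    · have hj' : j ∈ l := (List.mem_cons.mp hj).resolve_left hne
      have hA : (A + (Pi.single j 1 : Fin n → ℕ)) i = A i := by simp [hne.symm]
      rw [hA]
      exact ((hf.listPartial hU l A).partialDeriv_iterate_comm hU i j (A i)).trans
        (eqOn_iterate_partialDeriv hU (ih hl.2 hj') i (A i))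

theorem SmoothOn.partialDeriv_mixedPartial (hU : IsOpen U) (hf : SmoothOn U f) (j : Fin n)
    (A : Fin n → ℕ) :
    Set.EqOn (ShintaniBarnes.partialDeriv j (ShintaniBarnes.mixedPartial A f))
      (ShintaniBarnes.mixedPartial (A + Pi.single j 1) f) U :=
  hf.partialDeriv_listPartial hU (List.nodup_finRange n) (List.mem_finRange j) A

theorem SmoothOn.hasLineDerivAt_mixedPartial (hU : IsOpen U) (hf : SmoothOn U f) (j : Fin n)
    (A : Fin n → ℕ) {σ : Fin n → ℝ} (hσ : σ ∈ U) :
    HasLineDerivAt ℝ (ShintaniBarnes.mixedPartial A f)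
      (ShintaniBarnes.mixedPartial (A + Pi.single j 1) f σ) σ (Pi.single j 1) := by
  rw [← hf.partialDeriv_mixedPartial hU j A hσ]
  exact ((hf.mixedPartial hU A).differentiableAt hσ).lineDifferentiableAt.hasLineDerivAt

end Partial

/-! ### Exponentials times elements of the algebra -/

section ExpElem

variable {N n : ℕ} {F : IntermediateField ℚ ℂ} {Φ : ℂ → ℂ} {M : Matrix (Fin N) (Fin n) ℂ}
  {Z : Fin n}

/-- The functions `exp(-∑ⱼ wⱼ Tⱼ) f` with `f` in the algebra. -/
def ExpElem (F : IntermediateField ℚ ℂ) (Φ : ℂ → ℂ) (M : Matrix (Fin N) (Fin n) ℂ) (Z : Fin n)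
    (h : (Fin n → ℂ) → (Fin n → ℝ) → ℂ) : Prop :=
  ∃ f, Elem F Φ M Z f ∧ ∀ w, ∀ σ ∈ regSet M Z,
    h w σ = Complex.exp (-∑ j, w j * (tOfSigma Z σ j : ℂ)) * f w σ

/-- The derivative of the exponent `∑ w_j T_j` lies in the algebra because the parameters `w_j` and
the coordinates are generators. -/
theorem ExpElem.partialDeriv (hF : ∀ i j, M i j ∈ F) (hL : HasLeading M Z) (hΦ : IsAdmissible Φ)
    {h : (Fin n → ℂ) → (Fin n → ℝ) → ℂ} (hh : ExpElem F Φ M Z h) (j : Fin n) :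
    ExpElem F Φ M Z fun w => partialDeriv j (h w) := by
  obtain ⟨f, hf, hhf⟩ := hh
  obtain ⟨-, g, hg, hgd⟩ := hf.hasElemDeriv hF hL hΦ j
  obtain ⟨-, e, he, hed⟩ := HasElemDeriv.sum (F := F) (Φ := Φ) (M := M) (Z := Z) (j := j)
    Finset.univ fun k _ => (HasElemDeriv.param k).mul (HasElemDeriv.tOfSigma (Z := Z) k)
  refine ⟨_, hg.add (((Elem.const (-1) (F.neg_mem F.one_mem)).mul he).mul hf), fun w σ hσ => ?_⟩
  have h1 : h w =ᶠ[𝓝 σ] fun τ => Complex.exp (-∑ j, w j * (tOfSigma Z τ j : ℂ)) * f w τ := by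
    filter_upwards [(isOpen_regSet M Z).mem_nhds hσ] with τ hτ using hhf w τ hτ
  simp only [ShintaniBarnes.partialDeriv]
  rw [h1.lineDeriv_eq]
  have d1 : HasDerivAt (fun t : ℝ => ∑ k, w k * (tOfSigma Z (σ + t • Pi.single j 1) k : ℂ))
    (e w σ) 0 := hed w σ hσ
  have d2 : HasDerivAt (fun t : ℝ => f w (σ + t • Pi.single j 1)) (g w σ) 0 := hgd w σ hσ
  have d3 := d1.neg.cexp.mul d2
  simp only [Pi.neg_apply, zero_smul, add_zero] at d3
  have d4 : HasLineDerivAt ℝ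
      (fun τ => Complex.exp (-∑ j, w j * (tOfSigma Z τ j : ℂ)) * f w τ) _ σ (Pi.single j 1) := d3
  rw [d4.lineDeriv]
  ring

theorem ExpElem.mixedPartial (hF : ∀ i j, M i j ∈ F) (hL : HasLeading M Z) (hΦ : IsAdmissible Φ)
    {h : (Fin n → ℂ) → (Fin n → ℝ) → ℂ} (hh : ExpElem F Φ M Z h) (A : Fin n → ℕ) :
    ExpElem F Φ M Z fun w => mixedPartial A (h w) := by
  have hit : ∀ (j : Fin n) (m : ℕ) {h : (Fin n → ℂ) → (Fin n → ℝ) → ℂ}, ExpElem F Φ M Z h →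
      ExpElem F Φ M Z fun w => (ShintaniBarnes.partialDeriv j)^[m] (h w) := by
    intro j m h hh
    induction m with
    | zero => exact hh
    | succ m ih =>
      simp only [Function.iterate_succ_apply']
      exact ih.partialDeriv hF hL hΦ j
  simp only [mixedPartial_eq_listPartial]
  induction List.finRange n with
  | nil => exact hh
  | cons i l ih =>
    simp only [listPartial_cons]
    exact hit i (A i) ih

theorem ExpElem.smoothOn (hL : HasLeading M Z) (hΦ : IsAdmissible Φ)
    {h : (Fin n → ℂ) → (Fin n → ℝ) → ℂ} (hh : ExpElem F Φ M Z h) (w : Fin n → ℂ) :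
    SmoothOn (regSet M Z) (h w) := by
  obtain ⟨f, hf, hhf⟩ := hh
  intro σ hσ
  have h1 : h w =ᶠ[𝓝 σ] fun τ => Complex.exp (-∑ j, w j * (tOfSigma Z τ j : ℂ)) * f w τ := by
    filter_upwards [(isOpen_regSet M Z).mem_nhds hσ] with τ hτ using hhf w τ hτ
  refine ContDiffAt.congr_of_eventuallyEq ?_ h1
  refine ContDiffAt.mul (ContDiffAt.cexp (ContDiffAt.neg ?_)) (hf.contDiffAt hL hΦ w hσ)
  exact (ContDiff.sum fun j _ => contDiff_const.mul
    (Complex.ofRealCLM.contDiff.comp ((contDiff_tOfSigma_apply Z j).of_le le_top))).contDiffAt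

theorem tOfSigma_firstIndex (Z : Fin n) (σ : Fin n → ℝ) :
    tOfSigma Z σ (firstIndex Z) = σ (firstIndex Z) := by
  rw [tOfSigma_eq, tFactor, if_pos (show (firstIndex Z).val = 0 from rfl), mul_one]

theorem one_add_pow_le_exp {c x : ℝ} (hc : 0 < c) (hx : 0 ≤ x) (p : ℕ) :
    (1 + x) ^ p ≤ (p.factorial * (c⁻¹) ^ p * Real.exp c) * Real.exp (c * x) := by
  have h := Real.pow_div_factorial_le_exp (c * (1 + x)) (by positivity) p
  rw [div_le_iff₀ (by positivity), mul_pow] at h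
  have h2 : Real.exp (c * (1 + x)) = Real.exp c * Real.exp (c * x) := by
    rw [← Real.exp_add]; ring_nf
  rw [h2] at h
  calc (1 + x) ^ p = c⁻¹ ^ p * (c ^ p * (1 + x) ^ p) := by
        rw [← mul_assoc, ← mul_pow, inv_mul_cancel₀ hc.ne', one_pow, one_mul]
    _ ≤ c⁻¹ ^ p * (Real.exp c * Real.exp (c * x) * p.factorial) := by gcongr
    _ = _ := by ring

/-- Since `T_1 = σ_1` and the other terms of the exponent have nonnegative real part, the
exponential decays at rate `Re w_1` in `σ_1`. Half of that rate is spent on the polynomial growth of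
the algebra element. -/
theorem ExpElem.exists_bound (hM : HypothesisH M) (hΦ : IsAdmissible Φ)
    {h : (Fin n → ℂ) → (Fin n → ℝ) → ℂ} (hh : ExpElem F Φ M Z h) {w : Fin n → ℂ}
    (hw : ∀ j, 0 < (w j).re) :
    ∃ C, 0 ≤ C ∧ ∀ σ ∈ sigmaClosed n, ‖h w σ‖ ≤
      C * Real.exp (-((w (firstIndex Z)).re / 2 * σ (firstIndex Z))) := by
  obtain ⟨f, hf, hhf⟩ := hh
  obtain ⟨C, p, hC, hb⟩ := hf.exists_bound hM hΦ w
  set j₀ := firstIndex Z with hj₀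
  set c := (w j₀).re / 2 with hc
  have hc0 : 0 < c := by rw [hc]; linarith [hw j₀]
  refine ⟨C * (p.factorial * (c⁻¹) ^ p * Real.exp c), by positivity, fun σ hσ => ?_⟩
  have hx := hσ.1 j₀
  have hT0 : tOfSigma Z σ j₀ = σ j₀ := tOfSigma_firstIndex Z σ
  have h1 : ‖Complex.exp (-∑ j, w j * (tOfSigma Z σ j : ℂ))‖ ≤ Real.exp (-(2 * c * σ j₀)) := by
    rw [Complex.norm_exp, Real.exp_le_exp, Complex.neg_re, neg_le_neg_iff, Complex.re_sum]
    have h2 : 2 * c * σ j₀ = (w j₀ * (tOfSigma Z σ j₀ : ℂ)).re := by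
      rw [Complex.re_mul_ofReal, hT0, hc]; ring
    rw [h2]
    refine Finset.single_le_sum (f := fun j => (w j * (tOfSigma Z σ j : ℂ)).re) (fun j _ => ?_)
      (Finset.mem_univ j₀)
    rw [Complex.re_mul_ofReal]
    exact mul_nonneg (hw j).le (tOfSigma_nonneg hσ.1 j)
  rw [hhf w σ (mem_regSet_of_nonneg hM Z hσ.1), norm_mul]
  calc _ ≤ Real.exp (-(2 * c * σ j₀)) * (C * (1 + σ j₀) ^ p) :=
        mul_le_mul h1 (hb σ hσ) (norm_nonneg _) (Real.exp_pos _).le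
    _ ≤ Real.exp (-(2 * c * σ j₀)) *
        (C * ((p.factorial * (c⁻¹) ^ p * Real.exp c) * Real.exp (c * σ j₀))) := by
        gcongr
        exact one_add_pow_le_exp hc0 hx p
    _ = C * (p.factorial * (c⁻¹) ^ p * Real.exp c) *
        (Real.exp (-(2 * c * σ j₀)) * Real.exp (c * σ j₀)) := by ring
    _ = _ := by
        rw [← Real.exp_add]
        congr 2
        ring

theorem ExpElem.exists_polynomial (hM : HypothesisH M) (hF : ∀ i j, M i j ∈ F)
    (hΦ : IsAdmissible Φ) {h : (Fin n → ℂ) → (Fin n → ℝ) → ℂ} (hh : ExpElem F Φ M Z h) :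
    ∃ P : MvPolynomial (Fin n) F, ∀ w, h w 0 = MvPolynomial.aeval w P := by
  obtain ⟨f, hf, hhf⟩ := hh
  obtain ⟨P, hP⟩ := hf.exists_polynomial hF hΦ
  refine ⟨P, fun w => ?_⟩
  rw [hhf w 0 (mem_regSet_of_nonneg hM Z fun _ => le_rfl), ← hP]
  simp [tOfSigma_zero]

theorem expElem_regFun_mul_cutoff (S : Finset (Fin n)) (hS : ∀ j ∈ S, j.val ≠ 0) :
    ExpElem F Φ M Z fun w σ => regFun Φ M w Z σ * ∏ j ∈ S, (cutoff (σ j) : ℂ) := by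
  refine ⟨_, ((Elem.prod (Finset.Iic Z).attach (f := fun j _ σ =>
    ∏ i ∈ (leadingRows M j.1).attach, (yFactor M Z i.1 j.1 σ)⁻¹) fun j _ =>
      Elem.prod (leadingRows M j.1).attach fun i _ =>
        Elem.yInv i.1 j.1 (Finset.mem_Iic.mp j.2) i.2).mul
    (Elem.prod Finset.univ fun i _ => Elem.phi 0 i)).mul
      (Elem.prod S.attach fun j _ => Elem.cut 0 j.1 (hS j.1 j.2)), fun w σ _ => ?_⟩
  have e1 : (yFun M Z σ)⁻¹ = ∏ j ∈ (Finset.Iic Z).attach, ∏ i ∈ (leadingRows M j.1).attach,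
      (yFactor M Z i.1 j.1 σ)⁻¹ := by
    rw [Finset.prod_attach (Finset.Iic Z) (fun j => ∏ i ∈ (leadingRows M j).attach,
      (yFactor M Z i.1 j σ)⁻¹)]
    rw [yFun, ← Finset.prod_inv_distrib]
    refine Finset.prod_congr rfl fun j _ => ?_
    rw [Finset.prod_attach (leadingRows M j) (fun i => (yFactor M Z i j σ)⁻¹),
      ← Finset.prod_inv_distrib]
    rfl
  have e2 : ∏ j ∈ S, (cutoff (σ j) : ℂ) =
      ∏ j ∈ S.attach, ((iteratedDeriv 0 cutoff (σ j.1) : ℝ) : ℂ) := by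
    rw [Finset.prod_attach S (fun j => ((iteratedDeriv 0 cutoff (σ j) : ℝ) : ℂ))]
    simp
  simp only [regFun, e1, e2, iteratedDeriv_zero, linForm]
  ring

end ExpElem

end

section

/-! ### One-dimensional integration by parts -/

/-- Lebesgue measure on `(0, ∞)`. -/
def halfMeasure : Measure ℝ := (volume : Measure ℝ).restrict (Set.Ioi 0)

instance : SigmaFinite halfMeasure := by unfold halfMeasure; infer_instance

theorem ae_halfMeasure_pos : ∀ᵐ x ∂halfMeasure, 0 < x := ae_restrict_mem measurableSet_Ioi

theorem integrable_rpow_mul_exp {a c : ℝ} (ha : 0 < a) (hc : 0 < c) :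
    Integrable (fun x : ℝ => x ^ (a - 1) * Real.exp (-(c * x))) halfMeasure := by
  have := integrableOn_rpow_mul_exp_neg_mul_rpow (p := 1) (s := a - 1) (b := c)
    (by linarith) one_pos hc
  simpa [halfMeasure, IntegrableOn] using this

theorem integrable_cpow_mul_of_bound {h : ℝ → ℂ} {b : ℂ} {c C : ℝ} (hb : 0 < b.re) (hc : 0 < c)
    (hh : AEStronglyMeasurable h halfMeasure)
    (hC : ∀ x, 0 ≤ x → ‖h x‖ ≤ C * Real.exp (-(c * x))) :
    Integrable (fun x : ℝ => (x : ℂ) ^ (b - 1) * h x) halfMeasure := by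
  refine ((integrable_rpow_mul_exp hb hc).const_mul C).mono' ?_ ?_
  · exact (Measurable.aestronglyMeasurable (by fun_prop)).mul hh
  · filter_upwards [ae_halfMeasure_pos] with x hx
    rw [norm_mul, Complex.norm_cpow_eq_rpow_re_of_pos hx, Complex.sub_re, Complex.one_re]
    calc _ ≤ x ^ (b.re - 1) * (C * Real.exp (-(c * x))) :=
          mul_le_mul_of_nonneg_left (hC x hx.le) (Real.rpow_nonneg hx.le _)
      _ = _ := by ring

theorem aestronglyMeasurable_half {h : ℝ → ℂ} (hh : ContinuousOn h (Set.Ici 0)) :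
    AEStronglyMeasurable h halfMeasure :=
  (hh.mono Set.Ioi_subset_Ici_self).aestronglyMeasurable measurableSet_Ioi

theorem tendsto_exp_decay {h : ℝ → ℂ} {c C : ℝ} (hc : 0 < c)
    (hC : ∀ x, 0 ≤ x → ‖h x‖ ≤ C * Real.exp (-(c * x))) (b : ℂ) :
    Tendsto (fun x : ℝ => (x : ℂ) ^ b * h x) atTop (𝓝 0) := by
  have h1 := (tendsto_rpow_mul_exp_neg_mul_atTop_nhds_zero b.re c hc).const_mul C
  rw [mul_zero] at h1
  refine squeeze_zero_norm' ?_ h1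
  filter_upwards [eventually_gt_atTop (0 : ℝ)] with x hx
  rw [norm_mul, Complex.norm_cpow_eq_rpow_re_of_pos hx]
  calc _ ≤ x ^ b.re * (C * Real.exp (-(c * x))) :=
        mul_le_mul_of_nonneg_left (hC x hx.le) (Real.rpow_nonneg hx.le _)
    _ = _ := by rw [neg_mul]; ring

/-- The boundary term at `0` is `0^b h(0) = 0` because `Re b > 0`, and the one at infinity vanishes
by exponential decay. -/
theorem integral_cpow_mul_by_parts {h h' : ℝ → ℂ} {b : ℂ} {c C C' : ℝ} (hb : 0 < b.re)
    (hc : 0 < c) (hd : ∀ x, 0 ≤ x → HasDerivAt h (h' x) x) (hcont : ContinuousOn h' (Set.Ici 0))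
    (hC : ∀ x, 0 ≤ x → ‖h x‖ ≤ C * Real.exp (-(c * x)))
    (hC' : ∀ x, 0 ≤ x → ‖h' x‖ ≤ C' * Real.exp (-(c * x))) :
    ∫ x, (x : ℂ) ^ (b - 1) * h x ∂halfMeasure =
      -b⁻¹ * ∫ x, (x : ℂ) ^ (b + 1 - 1) * h' x ∂halfMeasure := by
  have hb0 : b ≠ 0 := fun h => by simp [h] at hb
  have hcont0 : ContinuousOn h (Set.Ici 0) := fun x hx =>
    (hd x hx).continuousAt.continuousWithinAt
  have i1 := integrable_cpow_mul_of_bound hb hc (aestronglyMeasurable_half hcont0) hC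
  have i2 := integrable_cpow_mul_of_bound (b := b + 1) (by simp; linarith) hc
    (aestronglyMeasurable_half hcont) hC'
  have key : ∫ x in Set.Ioi (0 : ℝ), ((x : ℂ) ^ (b - 1) * h x +
      b⁻¹ * ((x : ℂ) ^ (b + 1 - 1) * h' x)) = 0 - b⁻¹ * (((0 : ℝ) : ℂ) ^ b * h 0) := by
    refine integral_Ioi_of_hasDerivAt_of_tendsto (f := fun x : ℝ => b⁻¹ * ((x : ℂ) ^ b * h x))
      ?_ ?_ (i1.add (i2.const_mul _)) ?_
    · refine ContinuousWithinAt.mul continuousWithinAt_const (ContinuousWithinAt.mul ?_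
        (hd 0 le_rfl).continuousAt.continuousWithinAt)
      exact (Complex.continuousAt_ofReal_cpow_const 0 b (Or.inl hb)).continuousWithinAt
    · intro x hx
      have hx' : (0 : ℝ) < x := hx
      have d1 := hasDerivAt_ofReal_cpow_const' hx'.ne' (r := b - 1) (by
        intro h; exact hb0 (by linear_combination h))
      have d2 : HasDerivAt (fun y : ℝ => b⁻¹ * ((y : ℂ) ^ b * h y))
          (b⁻¹ * (b * (x : ℂ) ^ (b - 1) * h x + (x : ℂ) ^ b * h' x)) x := by
        have d3 : HasDerivAt (fun y : ℝ => (y : ℂ) ^ b) (b * (x : ℂ) ^ (b - 1)) x := by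
          have := d1.const_mul b
          simp only [sub_add_cancel] at this
          refine this.congr_of_eventuallyEq (Eventually.of_forall fun y => ?_)
          field_simp
        exact (d3.mul (hd x hx'.le)).const_mul _
      refine d2.congr_deriv ?_
      rw [add_sub_cancel_right]
      field_simp
    · simpa using (tendsto_exp_decay hc hC b).const_mul b⁻¹
  rw [Complex.ofReal_zero, Complex.zero_cpow hb0, zero_mul, mul_zero, sub_zero] at key
  have h2 : ∫ x, ((x : ℂ) ^ (b - 1) * h x + b⁻¹ * ((x : ℂ) ^ (b + 1 - 1) * h' x)) ∂halfMeasure =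
      0 := key
  rw [integral_add i1 (i2.const_mul _), integral_const_mul] at h2
  linear_combination h2

theorem integral_deriv_half {h h' : ℝ → ℂ} {c C C' : ℝ} (hc : 0 < c)
    (hd : ∀ x, 0 ≤ x → HasDerivAt h (h' x) x) (hcont : ContinuousOn h' (Set.Ici 0))
    (hC : ∀ x, 0 ≤ x → ‖h x‖ ≤ C * Real.exp (-(c * x)))
    (hC' : ∀ x, 0 ≤ x → ‖h' x‖ ≤ C' * Real.exp (-(c * x))) :
    ∫ x, h' x ∂halfMeasure = -h 0 := by
  have i2 := integrable_cpow_mul_of_bound (b := 1) (by simp) hc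
    (aestronglyMeasurable_half hcont) hC'
  simp only [sub_self, Complex.cpow_zero, one_mul] at i2
  have := integral_Ioi_of_hasDerivAt_of_tendsto (f := h) (m := 0) (a := 0)
    (hd 0 le_rfl).continuousAt.continuousWithinAt (fun x hx => hd x (le_of_lt hx)) i2
    (by simpa using tendsto_exp_decay hc hC 0)
  rw [zero_sub] at this
  exact this

/-! ### Integration by parts in one of several variables -/

variable {n : ℕ}

/-- Two integrals agree if they do in one coordinate. -/
theorem integral_pi_eq_of_coordinate {μ μ' : Fin n → Measure ℝ} [∀ i, SigmaFinite (μ i)]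
    [∀ i, SigmaFinite (μ' i)] (j : Fin n) (hμ : ∀ i, i ≠ j → μ i = μ' i)
    (h0 : ∀ i, ∀ᵐ x ∂μ i, 0 ≤ x) {f g : (Fin n → ℝ) → ℂ} (hf : Integrable f (Measure.pi μ))
    (hg : Integrable g (Measure.pi μ'))
    (h : ∀ σ : Fin n → ℝ, (∀ i, i ≠ j → 0 ≤ σ i) →
      ∫ x, f (Function.update σ j x) ∂μ j = ∫ x, g (Function.update σ j x) ∂μ' j) :
    ∫ σ, f σ ∂Measure.pi μ = ∫ σ, g σ ∂Measure.pi μ' := by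
  obtain ⟨m, rfl⟩ : ∃ m, n = m + 1 := ⟨n - 1, by have := j.pos; omega⟩
  have key : ∀ {μ : Fin (m + 1) → Measure ℝ} [∀ i, SigmaFinite (μ i)]
      {f : (Fin (m + 1) → ℝ) → ℂ}, Integrable f (Measure.pi μ) →
      ∫ σ, f σ ∂Measure.pi μ = ∫ y, ∫ x, f (j.insertNth x y) ∂μ j
        ∂Measure.pi fun i => μ (j.succAbove i) := by
    intro μ _ f hf
    have hmp := (measurePreserving_piFinSuccAbove μ j).symm
    rw [← hmp.integral_comp']
    have hi := (hmp.integrable_comp_emb (MeasurableEquiv.measurableEmbedding _)).mpr hf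
    exact integral_prod_symm _ hi
  have hμ' : (fun i => μ (j.succAbove i)) = fun i => μ' (j.succAbove i) := by
    funext i
    exact hμ _ (Fin.succAbove_ne j i)
  rw [key hf, key hg, ← hμ']
  refine integral_congr_ae ?_
  have hy : ∀ᵐ y ∂Measure.pi fun i => μ (j.succAbove i), ∀ i, 0 ≤ y i := by
    rw [ae_all_iff]
    intro i
    exact (Measure.quasiMeasurePreserving_eval (fun i => μ (j.succAbove i)) i).ae
      (h0 (j.succAbove i))
  filter_upwards [hy] with y hy
  have := h (j.insertNth 0 y) (fun i hi => by
    obtain ⟨k, rfl⟩ := Fin.exists_succAbove_eq hi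
    simpa using hy k)
  simpa only [Fin.update_insertNth] using this

/-- The data of a regularized integral: `G` is smooth and decays together with its derivatives;
in the variables outside `S` there is a weight that vanishes near the origin. -/
structure IsRieszData (S : Finset (Fin n)) (κ : Fin n → ℝ → ℂ) (U : Set (Fin n → ℝ))
    (G : (Fin n → ℝ) → ℂ) (c : ℝ) : Prop where
  isOpen : IsOpen U
  mem_of_nonneg : ∀ σ : Fin n → ℝ, (∀ k, 0 ≤ σ k) → σ ∈ U
  smooth : SmoothOn U G
  pos : 0 < c
  bound : ∀ A, ∃ C, 0 ≤ C ∧ ∀ σ : Fin n → ℝ, (∀ k, 0 ≤ σ k) →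
    ‖(∏ j, κ j (σ j)) * mixedPartial A G σ‖ ≤ C * ∏ j, Real.exp (-(c * σ j))
  measurable : ∀ j, Measurable (κ j)
  one : ∀ j ∈ S, ∀ x, κ j x = 1
  zero : ∀ j, j ∉ S → ∀ x, x < 1 / 3 → κ j x = 0

namespace IsRieszData

variable {S : Finset (Fin n)} {κ : Fin n → ℝ → ℂ} {U : Set (Fin n → ℝ)}
    {G : (Fin n → ℝ) → ℂ} {c : ℝ}

theorem ae_nonneg {μ : Fin n → Measure ℝ} [∀ i, SigmaFinite (μ i)]
    (h0 : ∀ i, ∀ᵐ x ∂μ i, 0 ≤ x) : ∀ᵐ σ ∂Measure.pi μ, ∀ k, 0 ≤ σ k := by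
  rw [ae_all_iff]
  exact fun i => (Measure.quasiMeasurePreserving_eval μ i).ae (h0 i)

theorem aestronglyMeasurable (hG : IsRieszData S κ U G c) (A : Fin n → ℕ) {μ : Fin n → Measure ℝ}
    [∀ i, SigmaFinite (μ i)] (h0 : ∀ i, ∀ᵐ x ∂μ i, 0 ≤ x) :
    AEStronglyMeasurable (fun σ => (∏ j, κ j (σ j)) * mixedPartial A G σ) (Measure.pi μ) := by
  have hQ : MeasurableSet {σ : Fin n → ℝ | ∀ k, 0 ≤ σ k} := by
    have : {σ : Fin n → ℝ | ∀ k, 0 ≤ σ k} = ⋂ k, {σ | 0 ≤ σ k} := by ext; simp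
    rw [this]
    exact MeasurableSet.iInter fun k => measurableSet_le measurable_const (measurable_pi_apply k)
  refine AEStronglyMeasurable.mul (Measurable.aestronglyMeasurable ?_) ?_
  · exact Finset.measurable_prod _ fun j _ => (hG.measurable j).comp (measurable_pi_apply j)
  · have h1 : ContinuousOn (mixedPartial A G) {σ : Fin n → ℝ | ∀ k, 0 ≤ σ k} :=
      (hG.smooth.mixedPartial hG.isOpen A).continuousOn.mono fun σ hσ => hG.mem_of_nonneg σ hσ
    have h2 := h1.aestronglyMeasurable (μ := Measure.pi μ) hQ
    rwa [Measure.restrict_eq_self_of_ae_mem (s := {σ : Fin n → ℝ | ∀ k, 0 ≤ σ k})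
      (ae_nonneg h0)] at h2

theorem slice_bound {K : (Fin n → ℝ) → ℂ} {C : ℝ}
    (hK : ∀ σ : Fin n → ℝ, (∀ k, 0 ≤ σ k) → ‖K σ‖ ≤ C * ∏ j, Real.exp (-(c * σ j)))
    {σ : Fin n → ℝ} {j : Fin n} (hσ : ∀ i, i ≠ j → 0 ≤ σ i) (x : ℝ) (hx : 0 ≤ x) :
    ‖K (Function.update σ j x)‖ ≤
      (C * ∏ i ∈ Finset.univ.erase j, Real.exp (-(c * σ i))) * Real.exp (-(c * x)) := by
  refine (hK _ fun k => ?_).trans (le_of_eq ?_)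
  · rcases eq_or_ne k j with rfl | hk
    · simpa using hx
    · simpa [hk] using hσ k hk
  · rw [← Finset.mul_prod_erase Finset.univ _ (Finset.mem_univ j), Function.update_self,
      Finset.prod_congr rfl fun i hi => by rw [Function.update_of_ne (Finset.ne_of_mem_erase hi)]]
    ring

theorem slice_mem (hG : IsRieszData S κ U G c) {σ : Fin n → ℝ} {j : Fin n}
    (hσ : ∀ i, i ≠ j → 0 ≤ σ i) (x : ℝ) (hx : 0 ≤ x) : Function.update σ j x ∈ U := by
  refine hG.mem_of_nonneg _ fun k => ?_
  rcases eq_or_ne k j with rfl | hk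
  · simpa using hx
  · simpa [hk] using hσ k hk

theorem slice_weight (hG : IsRieszData S κ U G c) {j : Fin n} (hj : j ∈ S) (σ : Fin n → ℝ)
    (x : ℝ) : ∏ i, κ i (Function.update σ j x i) = ∏ i ∈ Finset.univ.erase j, κ i (σ i) := by
  rw [← Finset.mul_prod_erase Finset.univ _ (Finset.mem_univ j), hG.one j hj, one_mul]
  exact Finset.prod_congr rfl fun i hi => by rw [Function.update_of_ne (Finset.ne_of_mem_erase hi)]

theorem slice_hasDerivAt (hG : IsRieszData S κ U G c) {j : Fin n} (hj : j ∈ S) (A : Fin n → ℕ)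
    {σ : Fin n → ℝ} (hσ : ∀ i, i ≠ j → 0 ≤ σ i) (x : ℝ) (hx : 0 ≤ x) :
    HasDerivAt (fun y => (∏ i, κ i (Function.update σ j y i)) *
        mixedPartial A G (Function.update σ j y))
      ((∏ i, κ i (Function.update σ j x i)) *
        mixedPartial (A + Pi.single j 1) G (Function.update σ j x)) x := by
  simp only [hG.slice_weight hj]
  refine HasDerivAt.const_mul _ ?_
  have hl : HasDerivAt (fun t : ℝ => mixedPartial A G (Function.update σ j x + t • Pi.single j 1))
      (mixedPartial (A + Pi.single j 1) G (Function.update σ j x)) (x - x) := by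
    rw [sub_self]
    exact hG.smooth.hasLineDerivAt_mixedPartial hG.isOpen j A (hG.slice_mem hσ x hx)
  have h2 := hl.comp_sub_const x x
  refine h2.congr_of_eventuallyEq (Eventually.of_forall fun y => congrArg _ ?_)
  funext k
  rcases eq_or_ne k j with rfl | hk
  · simp
  · simp [hk]

theorem slice_continuousOn (hG : IsRieszData S κ U G c) {j : Fin n} (hj : j ∈ S) (A : Fin n → ℕ)
    {σ : Fin n → ℝ} (hσ : ∀ i, i ≠ j → 0 ≤ σ i) :
    ContinuousOn (fun y => (∏ i, κ i (Function.update σ j y i)) *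
        mixedPartial A G (Function.update σ j y)) (Set.Ici 0) := fun x hx =>
  (hG.slice_hasDerivAt hj A hσ x hx).continuousAt.continuousWithinAt

/-! ### Domination -/

/-- Local uniformity in the exponent: a power is dominated by the sum of two fixed powers with
positive exponents. If `r₀ ≤ 0` this is needed only for `x ≥ 1/3`, where `(3x)^L ≥ 1` raises the
exponent at the cost of the constant `3^L`. -/
theorem exists_rpow_bound (r₀ : ℝ) : ∃ δ > 0, ∃ D a b : ℝ, 0 ≤ D ∧ 0 < a ∧ 0 < b ∧
    ∀ r, |r - r₀| < δ → ∀ x, 0 < x → (0 < r₀ ∨ 1 / 3 ≤ x) →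
      x ^ (r - 1) ≤ D * (x ^ (a - 1) + x ^ (b - 1)) := by
  have two : ∀ {x p q r : ℝ}, 0 < x → p ≤ r → r ≤ q → x ^ r ≤ x ^ p + x ^ q := by
    intro x p q r hx hp hq
    rcases le_total x 1 with h | h
    · have := Real.rpow_le_rpow_of_exponent_ge hx h hp
      have h2 := Real.rpow_nonneg hx.le q
      linarith
    · have := Real.rpow_le_rpow_of_exponent_le h hq
      have h2 := Real.rpow_nonneg hx.le p
      linarith
  by_cases h : 0 < r₀
  · refine ⟨r₀ / 2, by positivity, 1, r₀ / 2, r₀ + r₀, zero_le_one, by positivity, by positivity,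
      fun r hr x hx _ => ?_⟩
    rw [abs_lt] at hr
    rw [one_mul]
    exact two hx (by linarith [hr.1]) (by linarith [hr.2])
  · set L := |r₀| + 2 with hL
    have hr₀ := neg_abs_le r₀
    refine ⟨1, one_pos, 3 ^ L, r₀ - 1 + L, r₀ + 1 + L, by positivity, by linarith, by linarith,
      fun r hr x hx hx3 => ?_⟩
    have hx3 : 1 / 3 ≤ x := hx3.resolve_left h
    rw [abs_lt] at hr
    have h3 : 1 ≤ (3 * x) ^ L := Real.one_le_rpow (by linarith) (by positivity)
    rw [Real.mul_rpow (by norm_num) hx.le] at h3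
    calc x ^ (r - 1) ≤ (3 ^ L * x ^ L) * x ^ (r - 1) :=
          le_mul_of_one_le_left (Real.rpow_nonneg hx.le _) h3
      _ = 3 ^ L * x ^ (L + (r - 1)) := by rw [mul_assoc, ← Real.rpow_add hx]
      _ ≤ _ := mul_le_mul_of_nonneg_left (two hx (by linarith [hr.1]) (by linarith [hr.2]))
          (by positivity)

/-- Positivity of the exponents is needed only in the variables of `S`. In the others the weight
removes a neighbourhood of `0`, so any exponent is allowed; this makes the integral holomorphic in
`s` without integrating by parts there. -/
theorem exists_dominating (hG : IsRieszData S κ U G c) (A : Fin n → ℕ) {z : Fin n → ℂ → ℂ}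
    (hz : ∀ j, Continuous (z j)) {s₀ : ℂ} (hs₀ : ∀ j ∈ S, 0 < (z j s₀).re) :
    ∃ V ∈ 𝓝 s₀, ∃ g : (Fin n → ℝ) → ℝ, Integrable g (Measure.pi fun _ => halfMeasure) ∧
      ∀ᵐ σ ∂(Measure.pi fun _ : Fin n => halfMeasure), ∀ s ∈ V,
        ‖(∏ j, (σ j : ℂ) ^ (z j s - 1)) * ((∏ j, κ j (σ j)) * mixedPartial A G σ)‖ ≤ g σ := by
  choose δ hδ D a b hD ha hb hx using fun j => exists_rpow_bound (z j s₀).re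
  obtain ⟨C, hC0, hC⟩ := hG.bound A
  refine ⟨⋂ j, {s | |(z j s).re - (z j s₀).re| < δ j}, ?_, fun σ =>
    C * ∏ j, (D j * ((σ j) ^ (a j - 1) + (σ j) ^ (b j - 1)) * Real.exp (-(c * σ j))), ?_, ?_⟩
  · rw [Filter.iInter_mem]
    intro j
    have hcont : Continuous fun s => |(z j s).re - (z j s₀).re| :=
      ((Complex.continuous_re.comp (hz j)).sub continuous_const).abs
    exact (isOpen_lt hcont continuous_const).mem_nhds (by simpa using hδ j)
  · refine (Integrable.fintype_prod (f := fun j (x : ℝ) =>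
      D j * (x ^ (a j - 1) + x ^ (b j - 1)) * Real.exp (-(c * x))) fun j => ?_).const_mul C
    have := ((integrable_rpow_mul_exp (ha j) hG.pos).add
      (integrable_rpow_mul_exp (hb j) hG.pos)).const_mul (D j)
    refine this.congr (Eventually.of_forall fun x => ?_)
    simp only [Pi.add_apply]
    ring
  · have hpos : ∀ᵐ σ ∂(Measure.pi fun _ : Fin n => halfMeasure), ∀ k, 0 < σ k := by
      rw [ae_all_iff]
      exact fun i => (Measure.quasiMeasurePreserving_eval (fun _ : Fin n => halfMeasure) i).ae
        ae_halfMeasure_pos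
    filter_upwards [hpos] with σ hσ s hs
    have hnn : ∀ j, 0 ≤ D j * ((σ j) ^ (a j - 1) + (σ j) ^ (b j - 1)) := fun j =>
      mul_nonneg (hD j) (add_nonneg (Real.rpow_nonneg (hσ j).le _) (Real.rpow_nonneg (hσ j).le _))
    by_cases hsm : ∃ j, j ∉ S ∧ σ j < 1 / 3
    · obtain ⟨j, hj, hlt⟩ := hsm
      rw [Finset.prod_eq_zero (f := fun j => κ j (σ j)) (Finset.mem_univ j) (hG.zero j hj _ hlt),
        zero_mul, mul_zero, norm_zero]
      exact mul_nonneg hC0 (Finset.prod_nonneg fun j _ => mul_nonneg (hnn j) (Real.exp_pos _).le)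
    · push Not at hsm
      rw [norm_mul, norm_prod, Finset.prod_mul_distrib, mul_left_comm]
      refine mul_le_mul (Finset.prod_le_prod (fun _ _ => norm_nonneg _) fun j _ => ?_)
        (hC σ fun k => (hσ k).le) (norm_nonneg _) (Finset.prod_nonneg fun j _ => hnn j)
      rw [Complex.norm_cpow_eq_rpow_re_of_pos (hσ j), Complex.sub_re, Complex.one_re]
      refine hx j _ (Set.mem_iInter.mp hs j) _ (hσ j) ?_
      by_cases hj : j ∈ S
      · exact Or.inl (hs₀ j hj)
      · exact Or.inr (hsm j hj)

theorem ae_half_nonneg : ∀ _i : Fin n, ∀ᵐ x ∂halfMeasure, 0 ≤ x := fun _ =>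
  ae_halfMeasure_pos.mono fun _ h => h.le

theorem aestronglyMeasurable_integrand (hG : IsRieszData S κ U G c) (A : Fin n → ℕ)
    (β : Fin n → ℂ) :
    AEStronglyMeasurable
      (fun σ : Fin n → ℝ => (∏ j, (σ j : ℂ) ^ (β j - 1)) *
        ((∏ j, κ j (σ j)) * mixedPartial A G σ)) (Measure.pi fun _ => halfMeasure) := by
  refine AEStronglyMeasurable.mul (Measurable.aestronglyMeasurable ?_)
    (hG.aestronglyMeasurable A ae_half_nonneg)
  refine Finset.measurable_prod _ fun j _ => Measurable.pow_const ?_ _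
  exact Complex.measurable_ofReal.comp (measurable_pi_apply j)

theorem integrable (hG : IsRieszData S κ U G c) (A : Fin n → ℕ) {β : Fin n → ℂ}
    (hβ : ∀ j ∈ S, 0 < (β j).re) :
    Integrable (fun σ : Fin n → ℝ => (∏ j, (σ j : ℂ) ^ (β j - 1)) *
      ((∏ j, κ j (σ j)) * mixedPartial A G σ)) (Measure.pi fun _ => halfMeasure) := by
  obtain ⟨V, hV, g, hg, hle⟩ := hG.exists_dominating A (z := fun j _ => β j) (s₀ := 0)
    (fun j => continuous_const) hβ
  exact hg.mono' (hG.aestronglyMeasurable_integrand A β)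
    (hle.mono fun σ h => h 0 (mem_of_mem_nhds hV))

theorem differentiableOn (hG : IsRieszData S κ U G c) (A : Fin n → ℕ) {z : Fin n → ℂ → ℂ}
    (hz : ∀ j, Differentiable ℂ (z j)) {V : Set ℂ} (hV : IsOpen V)
    (hzV : ∀ s ∈ V, ∀ j ∈ S, 0 < (z j s).re) :
    DifferentiableOn ℂ (fun s => ∫ σ : Fin n → ℝ, (∏ j, (σ j : ℂ) ^ (z j s - 1)) *
      ((∏ j, κ j (σ j)) * mixedPartial A G σ) ∂(Measure.pi fun _ => halfMeasure)) V := by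
  refine differentiableOn_integral_of_dominated hV
    (fun s _ => hG.aestronglyMeasurable_integrand A fun j => z j s) ?_
    fun s₀ hs₀ => hG.exists_dominating A (fun j => (hz j).continuous) (hzV s₀ hs₀)
  have hpos : ∀ᵐ σ ∂(Measure.pi fun _ : Fin n => halfMeasure), ∀ k, 0 < σ k := by
    rw [ae_all_iff]
    exact fun i => (Measure.quasiMeasurePreserving_eval (fun _ : Fin n => halfMeasure) i).ae
      ae_halfMeasure_pos
  filter_upwards [hpos] with σ hσ
  refine (Differentiable.mul_const ?_ _).differentiableOn
  refine Differentiable.fun_finsetProd fun j _ => ?_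
  exact ((hz j).sub_const 1).const_cpow (Or.inl (by exact_mod_cast (hσ j).ne'))

/-! ### Iterated integration by parts -/

theorem integral_by_parts (hG : IsRieszData S κ U G c) (A : Fin n → ℕ) {β : Fin n → ℂ}
    (hβ : ∀ j, 0 < (β j).re) {j : Fin n} (hj : j ∈ S) :
    ∫ σ : Fin n → ℝ, (∏ i, (σ i : ℂ) ^ (β i - 1)) * ((∏ i, κ i (σ i)) * mixedPartial A G σ)
        ∂(Measure.pi fun _ => halfMeasure) =
      -(β j)⁻¹ * ∫ σ : Fin n → ℝ, (∏ i, (σ i : ℂ) ^ ((β + Pi.single j 1 : Fin n → ℂ) i - 1)) *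
        ((∏ i, κ i (σ i)) * mixedPartial (A + Pi.single j 1) G σ)
        ∂(Measure.pi fun _ => halfMeasure) := by
  have hβ' : ∀ i, 0 < ((β + Pi.single j 1 : Fin n → ℂ) i).re := by
    intro i
    rcases eq_or_ne i j with rfl | hi
    · simp; linarith [hβ i]
    · simpa [hi] using hβ i
  rw [← integral_const_mul]
  refine integral_pi_eq_of_coordinate j (fun _ _ => rfl) ae_half_nonneg
    (hG.integrable A fun j _ => hβ j)
    ((hG.integrable (A + Pi.single j 1) fun j _ => hβ' j).const_mul _) fun σ hσ => ?_
  have hsplit : ∀ (β : Fin n → ℂ) (x : ℝ), ∏ i, ((Function.update σ j x i : ℝ) : ℂ) ^ (β i - 1) =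
      (x : ℂ) ^ (β j - 1) * ∏ i ∈ Finset.univ.erase j, (σ i : ℂ) ^ (β i - 1) := by
    intro β x
    rw [← Finset.mul_prod_erase Finset.univ _ (Finset.mem_univ j), Function.update_self]
    congr 1
    exact Finset.prod_congr rfl fun i hi => by
      rw [Function.update_of_ne (Finset.ne_of_mem_erase hi)]
  obtain ⟨C, -, hC⟩ := hG.bound A
  obtain ⟨C', -, hC'⟩ := hG.bound (A + Pi.single j 1)
  have h1 := integral_cpow_mul_by_parts (hβ j) hG.pos
    (fun x hx => hG.slice_hasDerivAt hj A hσ x hx) (hG.slice_continuousOn hj _ hσ)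
    (fun x hx => slice_bound hC hσ x hx) (fun x hx => slice_bound hC' hσ x hx)
  have e1 : ∀ x : ℝ, (∏ i, ((Function.update σ j x i : ℝ) : ℂ) ^ (β i - 1)) *
      ((∏ i, κ i (Function.update σ j x i)) * mixedPartial A G (Function.update σ j x)) =
      (∏ i ∈ Finset.univ.erase j, (σ i : ℂ) ^ (β i - 1)) * ((x : ℂ) ^ (β j - 1) *
      ((∏ i, κ i (Function.update σ j x i)) * mixedPartial A G (Function.update σ j x))) := by
    intro x; rw [hsplit]; ring
  have e2 : ∀ x : ℝ,
      -(β j)⁻¹ * ((∏ i, ((Function.update σ j x i : ℝ) : ℂ) ^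
        ((β + Pi.single j 1 : Fin n → ℂ) i - 1)) * ((∏ i, κ i (Function.update σ j x i)) *
        mixedPartial (A + Pi.single j 1) G (Function.update σ j x))) =
      (∏ i ∈ Finset.univ.erase j, (σ i : ℂ) ^ (β i - 1)) * (-(β j)⁻¹ *
      ((x : ℂ) ^ (β j + 1 - 1) * ((∏ i, κ i (Function.update σ j x i)) *
        mixedPartial (A + Pi.single j 1) G (Function.update σ j x)))) := by
    intro x
    rw [hsplit]
    have : ∏ i ∈ Finset.univ.erase j, (σ i : ℂ) ^ ((β + Pi.single j 1 : Fin n → ℂ) i - 1) =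
        ∏ i ∈ Finset.univ.erase j, (σ i : ℂ) ^ (β i - 1) :=
      Finset.prod_congr rfl fun i hi => by simp [Finset.ne_of_mem_erase hi]
    rw [this, Pi.add_apply, Pi.single_eq_same]
    ring
  simp only [e1, e2]
  rw [integral_const_mul, integral_const_mul, h1, integral_const_mul]

/-- Each integration by parts produces `-1/β_j`, which `Γ(β_j + 1) = β_j Γ(β_j)` absorbs. The
normalized integral thus keeps its shape while the exponents in `S` move to the right, and this
gives the continuation. -/
theorem prod_Gamma_inv_mul_integral (hG : IsRieszData S κ U G c) {β : Fin n → ℂ}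
    (hβ : ∀ j, 0 < (β j).re) (A : Fin n → ℕ) (hA : ∀ j, j ∉ S → A j = 0) :
    (∏ j, (Complex.Gamma (β j))⁻¹) * ∫ σ : Fin n → ℝ, (∏ i, (σ i : ℂ) ^ (β i - 1)) *
        ((∏ i, κ i (σ i)) * G σ) ∂(Measure.pi fun _ => halfMeasure) =
      (∏ j, (-1) ^ A j * (Complex.Gamma (β j + A j))⁻¹) *
        ∫ σ : Fin n → ℝ, (∏ i, (σ i : ℂ) ^ (β i + A i - 1)) *
        ((∏ i, κ i (σ i)) * mixedPartial A G σ) ∂(Measure.pi fun _ => halfMeasure) := by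
  generalize hk : ∑ j, A j = k
  induction k generalizing A with
  | zero =>
    have : A = 0 := by
      funext j
      exact (Finset.sum_eq_zero_iff.mp hk) j (Finset.mem_univ j)
    subst this
    simp [mixedPartial_zero_index]
  | succ k ih =>
    have hex : ∃ j, A j ≠ 0 := by
      by_contra h
      push Not at h
      simp [h] at hk
    obtain ⟨j, hj⟩ := hex
    have hjS : j ∈ S := by
      by_contra h
      exact hj (hA j h)
    set A' : Fin n → ℕ := Function.update A j (A j - 1) with hA'
    have hAA : A = A' + Pi.single j 1 := by
      funext i
      rcases eq_or_ne i j with rfl | hi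
      · simp [hA']; omega
      · simp [hA', hi]
    have hsum : ∑ i, A' i = k := by
      have : ∑ i, A i = ∑ i, A' i + 1 := by
        rw [hAA]; simp [Finset.sum_add_distrib]
      omega
    rw [ih A' (fun i hi => by
      have : i ≠ j := fun h => hi (h ▸ hjS)
      simp [hA', this, hA i hi]) hsum]
    have hβ' : ∀ i, 0 < (β i + (A' i : ℂ)).re := fun i => by
      have := hβ i
      simp only [Complex.add_re, Complex.natCast_re]
      positivity
    have hp := hG.integral_by_parts A' (β := fun i => β i + A' i) hβ' hjS
    rw [hp, ← hAA]
    have e1 : ∀ i, ((fun i => β i + (A' i : ℂ)) + Pi.single j 1 : Fin n → ℂ) i =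
        β i + (A i : ℂ) := by
      intro i
      rw [hAA]
      rcases eq_or_ne i j with rfl | hi
      · simp; ring
      · simp [hi]
    simp only [e1]
    rw [← mul_assoc]
    congr 1
    rw [← Finset.mul_prod_erase Finset.univ _ (Finset.mem_univ j),
      ← Finset.mul_prod_erase Finset.univ (fun j => (-1) ^ A j * (Complex.Gamma (β j + A j))⁻¹)
        (Finset.mem_univ j)]
    have e2 : ∏ i ∈ Finset.univ.erase j, (-1 : ℂ) ^ A' i * (Complex.Gamma (β i + A' i))⁻¹ =
        ∏ i ∈ Finset.univ.erase j, (-1) ^ A i * (Complex.Gamma (β i + A i))⁻¹ :=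
      Finset.prod_congr rfl fun i hi => by
        rw [hA', Function.update_of_ne (Finset.ne_of_mem_erase hi)]
    have hne : β j + (A' j : ℂ) ≠ 0 := fun h => by
      have := hβ' j
      rw [h] at this
      simp at this
    have e3 : (-1 : ℂ) ^ A j * (Complex.Gamma (β j + A j))⁻¹ =
        (-1) ^ A' j * (Complex.Gamma (β j + A' j))⁻¹ * -(β j + (A' j : ℂ))⁻¹ := by
      have h1 : A j = A' j + 1 := by rw [hAA]; simp
      rw [h1, pow_succ]
      push_cast
      rw [← add_assoc, Complex.Gamma_add_one _ hne, mul_inv]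
      ring
    rw [e2, e3]
    ring

/-! ### The value at the origin -/

/-- For the induction, variables in `R` are integrated over the half-line and the others are
evaluated at `0` by a Dirac mass. Moving one variable into `R` is the fundamental theorem of
calculus and costs a sign. -/
theorem integral_mixedPartial (hG : IsRieszData Finset.univ κ U G c) (A : Fin n → ℕ)
    (R : Finset (Fin n)) :
    ∫ σ, mixedPartial (fun j => A j + if j ∈ R then 1 else 0) G σ
      ∂(Measure.pi fun j => if j ∈ R then halfMeasure else Measure.dirac 0) =
    (-1) ^ R.card * mixedPartial A G 0 := by
  have hsf : ∀ (R : Finset (Fin n)) (j : Fin n),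
      SigmaFinite (if j ∈ R then halfMeasure else Measure.dirac 0) := fun R j => by
    split_ifs <;> infer_instance
  have h0 : ∀ (R : Finset (Fin n)) (j : Fin n),
      ∀ᵐ x ∂(if j ∈ R then halfMeasure else Measure.dirac 0), 0 ≤ x := by
    intro R j
    split_ifs
    · exact ae_half_nonneg j
    · rw [ae_dirac_eq]; simp
  have hK : ∀ σ : Fin n → ℝ, ∏ j, κ j (σ j) = 1 := fun σ =>
    Finset.prod_eq_one fun j _ => hG.one j (Finset.mem_univ j) _
  have hint : ∀ (R : Finset (Fin n)) (A : Fin n → ℕ), Integrable (mixedPartial A G)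
      (Measure.pi fun j => if j ∈ R then halfMeasure else Measure.dirac 0) := by
    intro R A
    obtain ⟨C, -, hC⟩ := hG.bound A
    have hm := hG.aestronglyMeasurable A (h0 R)
    simp only [hK, one_mul] at hm hC
    refine ((Integrable.fintype_prod (f := fun _ (x : ℝ) => Real.exp (-(c * x)))
      fun j => ?_).const_mul C).mono' hm ((ae_nonneg (h0 R)).mono fun σ hσ => hC σ hσ)
    split_ifs
    · simpa using integrable_rpow_mul_exp one_pos hG.pos
    · exact integrable_dirac (by simp)
  induction R using Finset.induction_on with
  | empty =>
    have hae : ∀ᵐ σ ∂(Measure.pi fun _ : Fin n => Measure.dirac (0 : ℝ)), σ = 0 := by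
      have : ∀ᵐ σ ∂(Measure.pi fun _ : Fin n => Measure.dirac (0 : ℝ)), ∀ i, σ i = 0 := by
        rw [ae_all_iff]
        intro i
        refine (Measure.quasiMeasurePreserving_eval
          (fun _ : Fin n => Measure.dirac (0 : ℝ)) i).ae (p := fun x => x = 0) ?_
        rw [ae_dirac_eq]; simp
      exact this.mono fun σ hσ => funext hσ
    simp only [Finset.notMem_empty, if_false, add_zero, Finset.card_empty, pow_zero, one_mul]
    rw [integral_congr_ae (hae.mono fun σ hσ => by rw [hσ] : (fun σ => mixedPartial A G σ) =ᵐ[_]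
      fun _ => mixedPartial A G 0), integral_const]
    simp
  | insert j R hj ih =>
    have eA : (fun i => A i + if i ∈ insert j R then 1 else 0) =
        (fun i => A i + if i ∈ R then 1 else 0) + Pi.single j 1 := by
      funext i
      rcases eq_or_ne i j with rfl | hi
      · simp [hj]
      · simp [hi]
    rw [Finset.card_insert_of_notMem hj, pow_succ, eA]
    set A' : Fin n → ℕ := fun i => A i + if i ∈ R then 1 else 0 with hA'
    have step : ∫ σ, mixedPartial (A' + Pi.single j 1) G σ
        ∂(Measure.pi fun i => if i ∈ insert j R then halfMeasure else Measure.dirac 0) =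
        ∫ σ, -mixedPartial A' G σ
        ∂(Measure.pi fun i => if i ∈ R then halfMeasure else Measure.dirac 0) := by
      refine integral_pi_eq_of_coordinate j (fun i hi => by simp [hi]) (h0 _) (hint _ _)
        (hint _ _).neg fun σ hσ => ?_
      simp only [Finset.mem_insert_self, if_true, hj, if_false, integral_dirac]
      obtain ⟨C, -, hC⟩ := hG.bound A'
      obtain ⟨C', -, hC'⟩ := hG.bound (A' + Pi.single j 1)
      have h1 := integral_deriv_half hG.pos
        (fun x hx => hG.slice_hasDerivAt (Finset.mem_univ j) A' hσ x hx)
        (hG.slice_continuousOn (Finset.mem_univ j) _ hσ)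
        (fun x hx => slice_bound hC hσ x hx) (fun x hx => slice_bound hC' hσ x hx)
      simpa only [hK, one_mul] using h1
    rw [step, integral_neg, ih]
    ring

/-- Regularized integrals are products of Gamma functions and an entire function, whose values at
the non-positive integers are derivatives at the origin. -/
theorem exists_entire (hG : IsRieszData S κ U G c) (p b : Fin n → ℕ)
    {a : ℝ} (ha : ∀ s : ℂ, a < s.re → ∀ j, 0 < ((p j : ℂ) * s - b j).re) :
    ∃ E : ℂ → ℂ, Differentiable ℂ E ∧
      (∀ s : ℂ, a < s.re → ∫ σ : Fin n → ℝ, (∏ j, (σ j : ℂ) ^ ((p j : ℂ) * s - b j - 1)) *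
        ((∏ j, κ j (σ j)) * G σ) ∂(Measure.pi fun _ => halfMeasure) =
        (∏ j, Complex.Gamma ((p j : ℂ) * s + -(b j : ℂ))) * E s) ∧
      ∀ ℓ : ℕ, E (-(ℓ : ℂ)) = if S = Finset.univ then
        (-1) ^ (∑ j, (p j * ℓ + b j)) * mixedPartial (fun j => p j * ℓ + b j) G 0 else 0 := by
  classical
  -- The margin `q` satisfies `p_j q < 1` for all `j`, so that `p_j (Re s + ℓ) + 1 > 0` on `Re s >
  -- -ℓ - q`, a half-plane containing `-ℓ` in its interior.
  set q : ℝ := 1 / (1 + ∑ j, (p j : ℝ)) with hq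
  have hq1 : 0 < 1 + ∑ j, (p j : ℝ) := by positivity
  have hq0 : 0 < q := by positivity
  obtain ⟨E, hE, hEf, hEv⟩ := exists_entire_of_extensions (c := a)
    (f := fun s => (∏ j, (Complex.Gamma ((p j : ℂ) * s - b j))⁻¹) *
      ∫ σ : Fin n → ℝ, (∏ j, (σ j : ℂ) ^ ((p j : ℂ) * s - b j - 1)) *
        ((∏ j, κ j (σ j)) * G σ) ∂(Measure.pi fun _ => halfMeasure))
    (b := fun ℓ => -(ℓ : ℝ) - q)
    (v := fun ℓ => if S = Finset.univ then
        (-1) ^ (∑ j, (p j * ℓ + b j)) * mixedPartial (fun j => p j * ℓ + b j) G 0 else 0)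
    (fun r => by
      obtain ⟨ℓ, hℓ⟩ := exists_nat_gt (-r)
      exact ⟨ℓ, by linarith⟩)
    (fun ℓ => by simpa using hq0) (fun ℓ => by
      -- In the variables of `S`, one derivative more than the order `p_j ℓ + b_j`: at `s = -ℓ` the
      -- shifted exponents are exactly `1`, so the power weights disappear and the integral of a
      -- mixed derivative remains.
      set A : Fin n → ℕ := fun j => if j ∈ S then p j * ℓ + b j + 1 else 0 with hA
      refine ⟨fun s => (∏ j, (-1) ^ A j * (Complex.Gamma ((p j : ℂ) * s - b j + A j))⁻¹) *
        ∫ σ : Fin n → ℝ, (∏ i, (σ i : ℂ) ^ ((p i : ℂ) * s - b i + A i - 1)) *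
        ((∏ i, κ i (σ i)) * mixedPartial A G σ) ∂(Measure.pi fun _ => halfMeasure), ?_, ?_, ?_⟩
      · refine DifferentiableOn.mul (Differentiable.differentiableOn ?_) ?_
        · refine Differentiable.fun_finsetProd fun j _ => Differentiable.const_mul ?_ _
          exact Complex.differentiable_one_div_Gamma.comp
            (((differentiable_id.const_mul _).sub_const _).add_const _)
        · refine hG.differentiableOn A (z := fun i s => (p i : ℂ) * s - b i + A i)
            (fun j => by fun_prop) (isOpen_lt continuous_const Complex.continuous_re)
            fun s hs j hj => ?_
          have hs' : -(ℓ : ℝ) - q < s.re := hs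
          have e : ((p j : ℂ) * s - b j + A j).re = p j * (s.re + ℓ) + 1 := by
            simp [hA, hj]; ring
          rw [e]
          have h1 : (p j : ℝ) ≤ ∑ j, (p j : ℝ) :=
            Finset.single_le_sum (f := fun j => (p j : ℝ)) (fun _ _ => Nat.cast_nonneg _)
              (Finset.mem_univ j)
          have h2 : (p j : ℝ) * q < 1 := by
            rw [hq, mul_one_div, div_lt_one hq1]; linarith
          have h3 : (p j : ℝ) * (-q) ≤ p j * (s.re + ℓ) :=
            mul_le_mul_of_nonneg_left (by linarith) (Nat.cast_nonneg _)
          linarith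
      · intro s hs _
        exact (hG.prod_Gamma_inv_mul_integral (ha s hs) A fun j hj => by simp [hA, hj]).symm
      · by_cases hS : S = Finset.univ
        · subst hS
          have e1 : ∀ j, (p j : ℂ) * -(ℓ : ℂ) - b j + A j = 1 := by
            intro j; simp [hA]; ring
          have hK : ∀ σ : Fin n → ℝ, ∏ j, κ j (σ j) = 1 := fun σ =>
            Finset.prod_eq_one fun j _ => hG.one j (Finset.mem_univ j) _
          simp only [e1, Complex.Gamma_one, inv_one, mul_one, sub_self, Complex.cpow_zero,
            Finset.prod_const_one, hK, one_mul, if_true]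
          have h1 := hG.integral_mixedPartial (fun j => p j * ℓ + b j) Finset.univ
          simp only [Finset.mem_univ, if_true, Finset.card_univ, Fintype.card_fin] at h1
          have hA' : A = fun j => p j * ℓ + b j + 1 := by funext j; simp [hA]
          rw [hA', h1, Finset.prod_pow_eq_pow_sum, Finset.sum_add_distrib]
          simp only [Finset.sum_const, Finset.card_univ, Fintype.card_fin, smul_eq_mul, mul_one]
          rw [pow_add, mul_assoc, ← mul_assoc ((-1 : ℂ) ^ n), ← mul_pow]
          norm_num
        · beta_reduce
          rw [if_neg hS]
          -- In a variable outside `S` nothing was shifted, and `1/Γ` is evaluated at a non-positive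
          -- integer, where it vanishes.
          obtain ⟨j, hj⟩ : ∃ j, j ∉ S := by
            by_contra h
            push Not at h
            exact hS (Finset.eq_univ_iff_forall.mpr h)
          rw [Finset.prod_eq_zero (Finset.mem_univ j), zero_mul]
          have e1 : (p j : ℂ) * -(ℓ : ℂ) - b j + A j = -((p j * ℓ + b j : ℕ) : ℂ) := by
            simp [hA, hj]; ring
          rw [e1, Complex.Gamma_neg_nat_eq_zero, inv_zero, mul_zero])
  refine ⟨E, hE, fun s hs => ?_, hEv⟩
  rw [hEf s hs, ← mul_assoc, ← Finset.prod_mul_distrib]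
  have : ∀ j, Complex.Gamma ((p j : ℂ) * s + -(b j : ℂ)) *
      (Complex.Gamma ((p j : ℂ) * s - b j))⁻¹ = 1 := fun j => by
    rw [← sub_eq_add_neg]
    exact mul_inv_cancel₀ (Complex.Gamma_ne_zero_of_re_pos (ha s hs j))
  simp only [this, Finset.prod_const_one, one_mul]

end IsRieszData

end

section

/-! ### The integral over one sector -/

variable {N n : ℕ} {Φ : ℂ → ℂ} {M : Matrix (Fin N) (Fin n) ℂ} {Z : Fin n} {w : Fin n → ℂ}

theorem cutoff_nonneg (x : ℝ) : 0 ≤ cutoff x := Real.smoothTransition.nonneg _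

theorem cutoff_le_one (x : ℝ) : cutoff x ≤ 1 := Real.smoothTransition.le_one _

/-- The weight `(1 - ψ) 1_{x < 1}` in the variables of `T`, and `1` in the others. -/
def weight (T : Finset (Fin n)) (j : Fin n) (x : ℝ) : ℂ :=
  if j ∈ T then (if x < 1 then 1 - (cutoff x : ℂ) else 0) else 1

theorem norm_weight_le (T : Finset (Fin n)) (j : Fin n) (x : ℝ) : ‖weight T j x‖ ≤ 1 := by
  unfold weight
  split_ifs
  · rw [← Complex.ofReal_one, ← Complex.ofReal_sub, Complex.norm_real, Real.norm_eq_abs, abs_le]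
    constructor <;> linarith [cutoff_nonneg x, cutoff_le_one x]
  · simp
  · simp

theorem measurable_weight (T : Finset (Fin n)) (j : Fin n) : Measurable (weight T j) := by
  unfold weight
  by_cases hj : j ∈ T
  · simp only [hj, if_true]
    refine Measurable.ite measurableSet_Iio ?_ measurable_const
    exact measurable_const.sub
      (Complex.measurable_ofReal.comp contDiff_cutoff.continuous.measurable)
  · simp only [hj, if_false]
    exact measurable_const

/-- The indices of all columns but the first. -/
def tailIndices (n : ℕ) : Finset (Fin n) := Finset.univ.filter fun j => j.val ≠ 0

theorem mem_tailIndices {j : Fin n} : j ∈ tailIndices n ↔ j.val ≠ 0 := by simp [tailIndices]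

/-- The function `regFun`, cut off in the variables outside `T`. -/
def cutRegFun (Φ : ℂ → ℂ) (M : Matrix (Fin N) (Fin n) ℂ) (w : Fin n → ℂ) (Z : Fin n)
    (T : Finset (Fin n)) (σ : Fin n → ℝ) : ℂ :=
  regFun Φ M w Z σ * ∏ j ∈ tailIndices n \ T, (cutoff (σ j) : ℂ)

theorem expElem_cutRegFun (F : IntermediateField ℚ ℂ) (T : Finset (Fin n)) :
    ExpElem F Φ M Z fun w σ => cutRegFun Φ M w Z T σ :=
  expElem_regFun_mul_cutoff _ fun _ hj => mem_tailIndices.mp (Finset.mem_sdiff.mp hj).1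

/-- The weight jumps at `1`, so the variables in `T` must stay outside the set in which integration
by parts is done. Where some tail coordinate exceeds `1`, either the weight or the cutoff vanishes.
On the remaining box decay in `σ_1` counts as decay in all variables, at the price of the constant
`e^(nc)`. -/
theorem isRieszData_cutRegFun (hΦ : IsAdmissible Φ) (hM : HypothesisH M) (hL : HasLeading M Z)
    (hw : ∀ j, 0 < (w j).re) (T : Finset (Fin n)) :
    IsRieszData Tᶜ (weight T) (regSet M Z) (cutRegFun Φ M w Z T)
      ((w (firstIndex Z)).re / 2) where
  isOpen := isOpen_regSet M Z
  mem_of_nonneg := fun σ hσ => mem_regSet_of_nonneg hM Z hσ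
  smooth := (expElem_cutRegFun ⊤ T).smoothOn hL hΦ w
  pos := by linarith [hw (firstIndex Z)]
  measurable := measurable_weight T
  one := fun j hj x => by rw [weight, if_neg (Finset.mem_compl.mp hj)]
  zero := fun j hj x hx => by
    have hj : j ∈ T := by simpa using hj
    rw [weight, if_pos hj, if_pos (by linarith), cutoff_of_le hx.le]
    simp
  bound := fun A => by
    set c := (w (firstIndex Z)).re / 2 with hc
    have hc0 : 0 < c := by rw [hc]; linarith [hw (firstIndex Z)]
    obtain ⟨C, hC0, hC⟩ := ((expElem_cutRegFun (Φ := Φ) (M := M) (Z := Z) ⊤ T).mixedPartial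
      (fun _ _ => IntermediateField.mem_top) hL hΦ A).exists_bound hM hΦ hw
    refine ⟨C * Real.exp (n * c), by positivity, fun σ hσ => ?_⟩
    by_cases hs : ∀ k : Fin n, k.val ≠ 0 → σ k ≤ 1
    · rw [norm_mul, norm_prod]
      have h1 : ∏ j, ‖weight T j (σ j)‖ ≤ 1 :=
        Finset.prod_le_one (fun _ _ => norm_nonneg _) fun j _ => norm_weight_le T j _
      have h2 : Real.exp (-(c * σ (firstIndex Z))) ≤
          Real.exp (n * c) * ∏ j, Real.exp (-(c * σ j)) := by
        rw [← Real.exp_sum, ← Real.exp_add, Real.exp_le_exp,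
          ← Finset.add_sum_erase Finset.univ _ (Finset.mem_univ (firstIndex Z))]
        have h3 : -(n * c) ≤ ∑ j ∈ Finset.univ.erase (firstIndex Z), -(c * σ j) := by
          calc -(n * c) ≤ ((Finset.univ.erase (firstIndex Z)).card : ℝ) * (-c) := by
                rw [mul_neg, neg_le_neg_iff]
                refine mul_le_mul_of_nonneg_right ?_ hc0.le
                exact_mod_cast (Finset.card_le_univ _).trans (by simp)
            _ = ∑ j ∈ Finset.univ.erase (firstIndex Z), (-c) := by simp
            _ ≤ _ := Finset.sum_le_sum fun j hj => by
                have hj0 : j.val ≠ 0 := fun h => (Finset.mem_erase.mp hj).1 (Fin.ext h)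
                nlinarith [hs j hj0]
        linarith
      calc _ ≤ 1 * (C * Real.exp (-(c * σ (firstIndex Z)))) :=
            mul_le_mul h1 (hC σ ⟨hσ, hs⟩) (norm_nonneg _) zero_le_one
        _ ≤ C * (Real.exp (n * c) * ∏ j, Real.exp (-(c * σ j))) := by rw [one_mul]; gcongr
        _ = _ := by ring
    · push Not at hs
      obtain ⟨k, hk, hk1⟩ := hs
      have hz : (∏ j, weight T j (σ j)) * mixedPartial A (cutRegFun Φ M w Z T) σ = 0 := by
        by_cases hkT : k ∈ T
        · rw [Finset.prod_eq_zero (Finset.mem_univ k), zero_mul]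
          rw [weight, if_pos hkT, if_neg (not_lt.mpr hk1.le)]
        · have h0 : cutRegFun Φ M w Z T =ᶠ[𝓝 σ] 0 := by
            have : ∀ᶠ τ in 𝓝 σ, 1 < τ k :=
              (continuous_apply k).continuousAt.eventually (lt_mem_nhds hk1)
            filter_upwards [this] with τ hτ
            rw [cutRegFun, Finset.prod_eq_zero (Finset.mem_sdiff.mpr
              ⟨mem_tailIndices.mpr hk, hkT⟩), mul_zero, Pi.zero_apply]
            rw [cutoff_of_ge (by linarith), Complex.ofReal_zero]
          rw [(mixedPartial_congr h0 A).self_of_nhds, mixedPartial_zero_fun, Pi.zero_apply,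
            mul_zero]
      rw [hz, norm_zero]
      positivity

/-- Expand `1 = ∏ ((1 - ψ) + ψ)` over the tail variables, where `ψ` is the cutoff; `T` records the
variables in which `1 - ψ` was chosen. Off the domain every summand vanishes. -/
theorem sum_weight_mul_cutRegFun {σ : Fin n → ℝ} (hσ : ∀ k, 0 < σ k) :
    ∑ T ∈ (tailIndices n).powerset, (∏ j, weight T j (σ j)) * cutRegFun Φ M w Z T σ =
      (sigmaDomain n).indicator (regFun Φ M w Z) σ := by
  have hprod : ∀ T : Finset (Fin n), ∏ j, weight T j (σ j) =
      ∏ j ∈ T, (if σ j < 1 then 1 - (cutoff (σ j) : ℂ) else 0) := fun T => by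
    simp only [weight]
    rw [Finset.prod_ite_mem, Finset.univ_inter]
  by_cases hs : σ ∈ sigmaDomain n
  · rw [Set.indicator_of_mem hs]
    have h1 := Finset.prod_add (fun j => 1 - (cutoff (σ j) : ℂ)) (fun j => (cutoff (σ j) : ℂ))
      (tailIndices n)
    simp only [sub_add_cancel, Finset.prod_const_one] at h1
    calc _ = regFun Φ M w Z σ * ∑ T ∈ (tailIndices n).powerset,
          (∏ j ∈ T, (1 - (cutoff (σ j) : ℂ))) * ∏ j ∈ tailIndices n \ T, (cutoff (σ j) : ℂ) := by
          rw [Finset.mul_sum]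
          refine Finset.sum_congr rfl fun T hT => ?_
          have h2 : ∏ j ∈ T, (if σ j < 1 then 1 - (cutoff (σ j) : ℂ) else 0) =
              ∏ j ∈ T, (1 - (cutoff (σ j) : ℂ)) := Finset.prod_congr rfl fun j hj => by
            rw [if_pos (hs.2 j (mem_tailIndices.mp (Finset.mem_powerset.mp hT hj)))]
          rw [hprod, h2, cutRegFun]
          ring
      _ = _ := by rw [← h1, mul_one]
  · rw [Set.indicator_of_notMem hs]
    obtain ⟨k, hk, hk1⟩ : ∃ k : Fin n, k.val ≠ 0 ∧ 1 ≤ σ k := by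
      by_contra h
      push Not at h
      exact hs ⟨hσ, h⟩
    refine Finset.sum_eq_zero fun T _ => ?_
    by_cases hkT : k ∈ T
    · rw [hprod, Finset.prod_eq_zero hkT (if_neg (not_lt.mpr hk1)), zero_mul]
    · rw [cutRegFun, Finset.prod_eq_zero (i := k) (Finset.mem_sdiff.mpr
        ⟨mem_tailIndices.mpr hk, hkT⟩), mul_zero, mul_zero]
      rw [cutoff_of_ge (by linarith), Complex.ofReal_zero]

theorem integral_sigmaDomain_eq (f : (Fin n → ℝ) → ℂ) :
    ∫ σ in sigmaDomain n, f σ =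
      ∫ σ, (sigmaDomain n).indicator f σ ∂Measure.pi fun _ => halfMeasure := by
  have h1 : (Measure.pi fun _ : Fin n => halfMeasure) =
      (volume : Measure (Fin n → ℝ)).restrict (orthant n) := (volume_restrict_orthant n).symm
  rw [integral_indicator (measurableSet_sigmaDomain n), h1,
    Measure.restrict_restrict (measurableSet_sigmaDomain n), Set.inter_eq_left.mpr]
  exact fun σ hσ => hσ.1

theorem ae_pi_half_pos : ∀ᵐ σ ∂(Measure.pi fun _ : Fin n => halfMeasure), ∀ k, 0 < σ k := by
  rw [ae_all_iff]
  exact fun i => (Measure.quasiMeasurePreserving_eval (fun _ : Fin n => halfMeasure) i).ae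
    ae_halfMeasure_pos

/-- The integral over a sector is a product of Gamma functions and an entire function, whose
values at the non-positive integers are derivatives at the origin. -/
theorem exists_entire_sector (hΦ : IsAdmissible Φ) (hM : HypothesisH M) (hL : HasLeading M Z)
    (hw : ∀ j, 0 < (w j).re) {a : ℝ}
    (ha : ∀ s : ℂ, a < s.re → ∀ j, 0 < ((expCoeff Z j : ℂ) * s - expShift M Z j).re) :
    ∃ E : ℂ → ℂ, Differentiable ℂ E ∧
      (∀ s : ℂ, a < s.re → ∫ σ in sigmaDomain n,
        (∏ j, (σ j : ℂ) ^ ((expCoeff Z j : ℂ) * s - expShift M Z j - 1)) * regFun Φ M w Z σ =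
        (∏ j, Complex.Gamma ((expCoeff Z j : ℂ) * s + -(expShift M Z j : ℂ))) * E s) ∧
      ∀ ℓ : ℕ, E (-(ℓ : ℂ)) = (-1) ^ (∑ j, (expCoeff Z j * ℓ + expShift M Z j)) *
        mixedPartial (fun j => expCoeff Z j * ℓ + expShift M Z j) (regFun Φ M w Z) 0 := by
  have hex := fun T : (tailIndices n).powerset =>
    (isRieszData_cutRegFun hΦ hM hL hw T.1).exists_entire
      (expCoeff Z) (expShift M Z) ha
  choose E hE hEf hEv using hex
  refine ⟨fun s => ∑ T, E T s, Differentiable.fun_sum fun T _ => hE T, fun s hs => ?_,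
    fun ℓ => ?_⟩
  · rw [integral_sigmaDomain_eq, Finset.mul_sum]
    simp only [← hEf _ s hs]
    rw [← integral_finsetSum]
    · refine integral_congr_ae ?_
      filter_upwards [ae_pi_half_pos] with σ hσ
      rw [← Finset.mul_sum, Finset.univ_eq_attach, Finset.sum_attach (tailIndices n).powerset
        (fun T => (∏ j, weight T j (σ j)) * cutRegFun Φ M w Z T σ), sum_weight_mul_cutRegFun hσ]
      by_cases hs : σ ∈ sigmaDomain n
      · rw [Set.indicator_of_mem hs, Set.indicator_of_mem hs]
      · rw [Set.indicator_of_notMem hs, Set.indicator_of_notMem hs, mul_zero]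
    · intro T _
      have := (isRieszData_cutRegFun hΦ hM hL hw T.1).integrable 0
        (fun j _ => ha s hs j)
      simpa only [mixedPartial_zero_index] using this
  · have hempty : (∅ : Finset (Fin n)) ∈ (tailIndices n).powerset := by simp
    beta_reduce
    -- At `s = -ℓ` only the piece supported near the origin in all tail variables survives. There
    -- the cutoffs equal `1`, so they do not affect the derivative.
    rw [Finset.sum_eq_single (⟨∅, hempty⟩ : (tailIndices n).powerset)]
    · rw [hEv, if_pos (by simp)]
      congr 1
      refine (mixedPartial_congr ?_ _).self_of_nhds
      have : ∀ᶠ σ : Fin n → ℝ in 𝓝 0, ∀ k, σ k < 1 / 3 := by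
        rw [eventually_all]
        intro k
        refine (continuous_apply k).continuousAt.eventually (gt_mem_nhds ?_)
        norm_num
      filter_upwards [this] with σ hσ
      rw [cutRegFun, Finset.prod_eq_one, mul_one]
      intro j _
      rw [cutoff_of_le (hσ j).le, Complex.ofReal_one]
    · intro T _ hT
      rw [hEv, if_neg]
      intro h
      exact hT (Subtype.ext (by simpa using h))
    · simp

end

section

/-! ### Admissibility of `1` and of `φ` -/

theorem isAdmissible_one : IsAdmissible fun _ => 1 where
  analyticAt := fun z _ => analyticAt_const
  bound := fun m C => ⟨1, fun z _ _ => by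
    rw [iteratedDeriv_const]
    split_ifs
    · simp
    · simp only [norm_zero, one_mul]; positivity⟩
  rational := fun m => by
    rw [iteratedDeriv_const]
    split_ifs
    · exact ⟨1, by simp⟩
    · exact ⟨0, by simp⟩

theorem hasDerivAt_one_sub_exp_neg (z : ℂ) :
    HasDerivAt (fun z => 1 - Complex.exp (-z)) (Complex.exp (-z)) z := by
  simpa using ((hasDerivAt_neg z).cexp).const_sub 1

/-- The divided difference of `1 - e^(-z)` at `0` is entire and equals `1` at `0`, so `φ` is
analytic wherever it does not vanish, the removable point included. -/
theorem phi_eq_inv_dslope (z : ℂ) :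
    phi z = (dslope (fun z => 1 - Complex.exp (-z)) 0 z)⁻¹ := by
  rcases eq_or_ne z 0 with rfl | hz
  · simp [phi, (hasDerivAt_one_sub_exp_neg 0).deriv]
  · rw [phi, if_neg hz, dslope_of_ne _ hz, slope_def_field]
    simp

theorem analyticAt_phi_of_ne {z : ℂ} (hz : z = 0 ∨ Complex.exp (-z) ≠ 1) : AnalyticAt ℂ phi z := by
  have hd : Differentiable ℂ fun z : ℂ => 1 - Complex.exp (-z) := fun z =>
    (hasDerivAt_one_sub_exp_neg z).differentiableAt
  have h1 : Differentiable ℂ (dslope (fun z => 1 - Complex.exp (-z)) (0 : ℂ)) :=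
    differentiableOn_univ.mp
      ((Complex.differentiableOn_dslope univ_mem).mpr hd.differentiableOn)
  have h2 : phi = fun z => (dslope (fun z => 1 - Complex.exp (-z)) 0 z)⁻¹ :=
    funext phi_eq_inv_dslope
  rw [h2]
  refine (h1.analyticAt z).inv ?_
  rcases eq_or_ne z 0 with rfl | h0
  · simp [(hasDerivAt_one_sub_exp_neg 0).deriv]
  · rw [dslope_of_ne _ h0, slope_def_field]
    have := hz.resolve_left h0
    simp [sub_ne_zero, h0, this.symm]

theorem analyticAt_phi {z : ℂ} (hz : z = 0 ∨ z.re ≠ 0) : AnalyticAt ℂ phi z := by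
  refine analyticAt_phi_of_ne (hz.imp_right fun h h1 => h ?_)
  have := congrArg norm h1
  rw [Complex.norm_exp, norm_one, Real.exp_eq_one_iff, Complex.neg_re] at this
  linarith

theorem norm_phi_le {z : ℂ} {δ : ℝ} (hδ : 0 < δ) (hz : δ ≤ z.re) :
    ‖phi z‖ ≤ ‖z‖ / (1 - Real.exp (-δ)) := by
  have h0 : z ≠ 0 := fun h => by simp [h] at hz; linarith
  have h1 : 0 < 1 - Real.exp (-δ) := by
    have : Real.exp (-δ) < 1 := Real.exp_lt_one_iff.mpr (by linarith)
    linarith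
  have h2 : 1 - Real.exp (-δ) ≤ ‖1 - Complex.exp (-z)‖ := by
    have h3 := norm_sub_norm_le (1 : ℂ) (Complex.exp (-z))
    rw [norm_one, Complex.norm_exp, Complex.neg_re] at h3
    have : Real.exp (-z.re) ≤ Real.exp (-δ) := Real.exp_le_exp.mpr (by linarith)
    linarith
  rw [phi, if_neg h0, norm_div]
  gcongr

/-- In the cone, the part with `‖z‖ ≤ 1` is compact and meets the imaginary axis only at `0`.
Elsewhere `Re z` is bounded below, `φ` grows linearly, and Cauchy's estimate on small discs passes
this bound to the derivatives. -/
theorem exists_bound_iteratedDeriv_phi (m : ℕ) (C : ℝ) : ∃ B, ∀ z : ℂ, 0 ≤ z.re →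
    |z.im| ≤ C * z.re → ‖iteratedDeriv m phi z‖ ≤ B * (1 + ‖z‖) := by
  have hK : IsCompact {z : ℂ | ‖z‖ ≤ 1 ∧ 0 ≤ z.re ∧ |z.im| ≤ C * z.re} := by
    refine (isCompact_closedBall (0 : ℂ) 1).of_isClosed_subset ?_ fun z hz => by simpa using hz.1
    refine (isClosed_le continuous_norm continuous_const).inter
      ((isClosed_le continuous_const Complex.continuous_re).inter
        (isClosed_le Complex.continuous_im.abs (continuous_const.mul Complex.continuous_re)))
  have hc : ContinuousOn (iteratedDeriv m phi)
      {z : ℂ | ‖z‖ ≤ 1 ∧ 0 ≤ z.re ∧ |z.im| ≤ C * z.re} := by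
    intro z hz
    have h0 : z = 0 ∨ z.re ≠ 0 := by
      by_cases h : z.re = 0
      · left
        have := hz.2.2
        rw [h, mul_zero] at this
        exact Complex.ext h (abs_eq_zero.mp (le_antisymm this (abs_nonneg _)))
      · exact Or.inr h
    rw [iteratedDeriv_eq_iterate]
    exact ((analyticAt_phi h0).iterated_deriv m).continuousAt.continuousWithinAt
  obtain ⟨B, hB⟩ := hK.exists_bound_of_continuousOn hc
  -- In the cone `‖z‖ ≤ (1 + |C|) Re z`, hence `‖z‖ > 1` forces `Re z ≥ δ`; discs of radius `δ/2`
  -- then stay in `Re ≥ δ/2`.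
  set δ : ℝ := 1 / (1 + |C|) with hδ
  have hC1 : 0 < 1 + |C| := by positivity
  have hδ0 : 0 < δ := by positivity
  have hδ1 : δ ≤ 1 := by
    rw [hδ, div_le_one hC1]
    linarith [abs_nonneg C]
  have hη : 0 < 1 - Real.exp (-(δ / 2)) := by
    have : Real.exp (-(δ / 2)) < 1 := Real.exp_lt_one_iff.mpr (by linarith)
    linarith
  refine ⟨|B| + m.factorial * (1 / (1 - Real.exp (-(δ / 2)))) / (δ / 2) ^ m, fun z hz hzC => ?_⟩
  rw [add_mul]
  by_cases h1 : ‖z‖ ≤ 1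
  · have h2 := (hB z ⟨h1, hz, hzC⟩).trans (le_abs_self B)
    have h3 : |B| * 1 ≤ |B| * (1 + ‖z‖) :=
      mul_le_mul_of_nonneg_left (by linarith [norm_nonneg z]) (abs_nonneg _)
    have h4 : 0 ≤ m.factorial * (1 / (1 - Real.exp (-(δ / 2)))) / (δ / 2) ^ m * (1 + ‖z‖) := by
      positivity
    linarith
  · have hre : δ ≤ z.re := by
      have h2 := Complex.norm_le_abs_re_add_abs_im z
      rw [abs_of_nonneg hz] at h2
      have h3 : C * z.re ≤ |C| * z.re := mul_le_mul_of_nonneg_right (le_abs_self C) hz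
      rw [hδ, div_le_iff₀ hC1]
      push Not at h1
      nlinarith
    have hball : ∀ ζ ∈ Metric.closedBall z (δ / 2), δ / 2 ≤ ζ.re := by
      intro ζ hζ
      rw [Metric.mem_closedBall, dist_eq_norm] at hζ
      have := (abs_le.mp ((Complex.abs_re_le_norm (ζ - z)).trans hζ)).1
      rw [Complex.sub_re] at this
      linarith
    have hd : DifferentiableOn ℂ phi (Metric.closedBall z (δ / 2)) := fun ζ hζ =>
      (analyticAt_phi (Or.inr (by linarith [hball ζ hζ] : 0 < ζ.re).ne')).differentiableAt
        |>.differentiableWithinAt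
    have h2 := Complex.norm_iteratedDeriv_le_of_forall_mem_sphere_norm_le (f := phi) m
      (half_pos hδ0) (c := z) (C := (1 + ‖z‖) / (1 - Real.exp (-(δ / 2))))
      (DifferentiableOn.diffContOnCl (by rwa [closure_ball _ (half_pos hδ0).ne']))
      (fun ζ hζ => by
        refine (norm_phi_le (half_pos hδ0) (hball ζ (Metric.sphere_subset_closedBall hζ))).trans ?_
        gcongr
        rw [mem_sphere_iff_norm] at hζ
        have := norm_le_norm_add_norm_sub' ζ z
        linarith)
    have h3 : 0 ≤ |B| * (1 + ‖z‖) := by positivity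
    refine h2.trans (le_add_of_nonneg_of_le h3 (le_of_eq ?_))
    ring

theorem iteratedDeriv_one_sub_exp_neg (m : ℕ) :
    iteratedDeriv (m + 1) (fun z : ℂ => 1 - Complex.exp (-z)) 0 = -(-1) ^ (m + 1) := by
  have h : deriv (fun z : ℂ => 1 - Complex.exp (-z)) = fun z => Complex.exp (-1 * z) := by
    funext z
    rw [(hasDerivAt_one_sub_exp_neg z).deriv, neg_one_mul]
  rw [iteratedDeriv_succ', h, iteratedDeriv_cexp_const_mul]
  simp [pow_succ]

/-- The Bernoulli recursion: the Leibniz rule for `(1 - e^(-z)) φ(z) = z` expresses each derivative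
at `0` rationally through the earlier ones. -/
theorem exists_rat_iteratedDeriv_phi (m : ℕ) : ∃ q : ℚ, iteratedDeriv m phi 0 = q := by
  induction m using Nat.strong_induction_on with
  | _ m ih =>
    have hf : ContDiffAt ℂ ((m + 1 : ℕ) : WithTop ℕ∞) (fun z : ℂ => 1 - Complex.exp (-z)) 0 :=
      (contDiff_const.sub contDiff_neg.cexp).contDiffAt
    have hφ : ContDiffAt ℂ ((m + 1 : ℕ) : WithTop ℕ∞) phi 0 :=
      (analyticAt_phi (Or.inl rfl)).contDiffAt
    have h1 := iteratedDeriv_mul hf hφ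
    have h2 : (fun z : ℂ => 1 - Complex.exp (-z)) * phi =ᶠ[𝓝 0] fun z => z := by
      have h3 : ∀ᶠ z : ℂ in 𝓝 0, dslope (fun z => 1 - Complex.exp (-z)) 0 z ≠ 0 := by
        have h4 : ContinuousAt (dslope (fun z => 1 - Complex.exp (-z)) (0 : ℂ)) 0 :=
          continuousAt_dslope_same.mpr (hasDerivAt_one_sub_exp_neg 0).differentiableAt
        refine h4.eventually_ne ?_
        simp [(hasDerivAt_one_sub_exp_neg 0).deriv]
      filter_upwards [h3] with z hz
      rcases eq_or_ne z 0 with rfl | h0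
      · simp
      · rw [dslope_of_ne _ h0, slope_def_field] at hz
        have h5 : 1 - Complex.exp (-z) ≠ 0 := fun h => hz (by simp [h])
        rw [Pi.mul_apply, phi, if_neg h0, mul_div_cancel₀ _ h5]
    -- In order `m + 1` the top term drops out since `1 - e^0 = 0`, and the next one is `(m + 1)
    -- φ^(m)(0)`; splitting both off leaves derivatives of order below `m`.
    rw [(h2.iteratedDeriv_eq (m + 1)), iteratedDeriv_fun_id_zero, Finset.sum_range_succ',
      Finset.sum_range_succ'] at h1
    have h6 : ∀ k, ∃ q : ℚ, k ∈ Finset.range m →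
        iteratedDeriv (m + 1 - (k + 1 + 1)) phi 0 = q := by
      intro k
      by_cases hk : k ∈ Finset.range m
      · have := Finset.mem_range.mp hk
        obtain ⟨q, hq⟩ := ih (m + 1 - (k + 1 + 1)) (by omega)
        exact ⟨q, fun _ => hq⟩
      · exact ⟨0, fun h => absurd h hk⟩
    choose q hq using h6
    simp only [iteratedDeriv_one_sub_exp_neg, iteratedDeriv_zero, zero_add, neg_zero,
      Complex.exp_zero, sub_self, mul_zero, zero_mul, add_zero, Nat.choose_one_right,
      Nat.add_sub_cancel, pow_one, neg_neg, mul_one] at h1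
    rw [Finset.sum_congr rfl fun k hk => by rw [hq k hk]] at h1
    refine ⟨((if m + 1 = 1 then 1 else 0) - ∑ k ∈ Finset.range m,
      ((m + 1).choose (k + 1 + 1) : ℚ) * -(-1) ^ (k + 1 + 1) * q k) / ((m + 1 : ℕ) : ℚ), ?_⟩
    have hm : ((m + 1 : ℕ) : ℂ) ≠ 0 := by exact_mod_cast Nat.succ_ne_zero m
    push_cast at h1 hm ⊢
    rw [eq_div_iff hm]
    split_ifs at h1 ⊢ <;> push_cast <;> linear_combination -h1

theorem isAdmissible_phi : IsAdmissible phi where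
  analyticAt := fun _ hz => analyticAt_phi hz
  bound := exists_bound_iteratedDeriv_phi
  rational := exists_rat_iteratedDeriv_phi

end

section

variable {N n : ℕ} {Φ : ℂ → ℂ} {M : Matrix (Fin N) (Fin n) ℂ} {Z : Fin n} {w : Fin n → ℂ}

/-! ### The two measure spaces -/

theorem integrable_one_add_natCast_rpow (p : ℝ) (hp : 1 < p) :
    Integrable (fun k : ℕ => (1 + (k : ℝ)) ^ (-p)) Measure.count := by
  rw [integrable_count_iff]
  refine ((Real.summable_one_div_nat_add_rpow 1 p).mpr hp).congr fun k => ?_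
  have h : (0 : ℝ) ≤ 1 + k := by positivity
  rw [Real.norm_of_nonneg (Real.rpow_nonneg h _), Real.rpow_neg h, add_comm (k : ℝ) 1,
    abs_of_nonneg h, one_div]

theorem integral_count_exp_neg (z : ℂ) (hz : 0 < z.re) :
    ∫ k : ℕ, Complex.exp (-(z * (k : ℝ))) ∂Measure.count = phi z / z := by
  have hr : ‖Complex.exp (-z)‖ < 1 := by
    rw [Complex.norm_exp, Real.exp_lt_one_iff, Complex.neg_re]
    linarith
  have hpow : ∀ k : ℕ, Complex.exp (-(z * (k : ℝ))) = Complex.exp (-z) ^ k := fun k => by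
    rw [← Complex.exp_nat_mul]
    congr 1
    push_cast
    ring
  have hz0 : z ≠ 0 := fun h => by simp [h] at hz
  simp only [hpow]
  rw [integral_countable]
  · simp only [Measure.real, Measure.count_singleton, ENNReal.toReal_one, one_smul]
    rw [tsum_geometric_of_norm_lt_one hr, phi, if_neg hz0, div_div_cancel_left' hz0]
  · rw [integrable_count_iff]
    simpa only [norm_pow] using summable_geometric_of_lt_one (norm_nonneg _) hr

theorem pi_count_eq_count :
    (Measure.pi fun _ : Fin N => (Measure.count : Measure ℕ)) = Measure.count := by
  rw [Measure.ext_iff_singleton]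
  intro k
  rw [Measure.pi_singleton, Measure.count_singleton]
  simp

theorem integrable_one_add_rpow (p : ℝ) (hp : 1 < p) :
    Integrable (fun x : ℝ => (1 + x) ^ (-p)) halfMeasure := by
  have := integrableOn_add_rpow_Ioi_of_lt (a := -p) (c := 0) (m := 1) (by linarith) (by norm_num)
  simp only [add_comm _ (1 : ℝ)] at this
  exact this

theorem integral_half_exp_neg (z : ℂ) (hz : 0 < z.re) :
    ∫ x, Complex.exp (-(z * (x : ℝ))) ∂halfMeasure = 1 / z := by
  have := integral_exp_mul_complex_Ioi (a := -z) (by simpa using hz) 0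
  simp only [neg_mul] at this
  rw [halfMeasure, this]
  simp

/-! ### Exponents -/

theorem card_lt_eq (k : Fin n) : (Finset.univ.filter fun j : Fin n => j < k).card = k.val := by
  have : (Finset.univ.filter fun j : Fin n => j < k) = Finset.Iio k := by ext; simp
  rw [this, Fin.card_Iio]

theorem le_maxZeroCount_of_mem_leadingRows {i : Fin N} {k : Fin n} (hi : i ∈ leadingRows M k) :
    k.val ≤ maxZeroCount M := by
  classical
  refine le_trans ?_ (zeroCount_le_maxZeroCount M i)
  rw [← card_lt_eq k, zeroCount]
  refine Finset.card_le_card fun j hj => ?_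
  simp only [leadingRows, Finset.mem_filter, Finset.mem_univ, true_and] at hi hj ⊢
  exact hi.1 j hj

theorem expShift_le (hL : HasLeading M Z) (j : Fin n) : expShift M Z j ≤ N := by
  rw [expShift]
  split_ifs
  · refine le_trans ?_ (sum_card_leadingRows hL).le
    exact Finset.sum_le_sum_of_subset fun k hk => Finset.mem_Iic.mpr (Finset.mem_Icc.mp hk).2
  · exact Nat.zero_le _

/-- This is where the abscissa comes from. With columns counted from `0`, a nonzero shift at `j`
means that some row vanishes in the first `j` columns, so `j ≤ Z_M` and the coefficient `n - j` is
at least `n - Z_M`; the shift is at most `N`. -/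
theorem re_exponent_pos (hL : HasLeading M Z) (hn : maxZeroCount M < n) {s : ℂ}
    (hs : abscissa M < s.re) (j : Fin n) :
    0 < ((expCoeff Z j : ℂ) * s - expShift M Z j).re := by
  have hs0 : 0 < s.re := (abscissa_nonneg hn).trans_lt hs
  have e : ((expCoeff Z j : ℂ) * s - expShift M Z j).re =
      expCoeff Z j * s.re - expShift M Z j := by simp
  rw [e]
  have hc : (0 : ℝ) < expCoeff Z j := by exact_mod_cast expCoeff_pos Z j
  rcases Nat.eq_zero_or_pos (expShift M Z j) with h0 | hpos
  · rw [h0, Nat.cast_zero, sub_zero]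
    exact mul_pos hc hs0
  · by_cases hj : j ≤ Z
    · rw [expShift, if_pos hj] at hpos
      obtain ⟨k, hk, hkc⟩ := Finset.exists_ne_zero_of_sum_ne_zero hpos.ne'
      obtain ⟨i, hi⟩ := Finset.card_ne_zero.mp hkc
      have h1 : j.val ≤ maxZeroCount M :=
        le_trans (Finset.mem_Icc.mp hk).1 (le_maxZeroCount_of_mem_leadingRows hi)
      have h2 : (0 : ℝ) < (n : ℝ) - maxZeroCount M := by
        have : (maxZeroCount M : ℝ) < n := by exact_mod_cast hn
        linarith
      have h3 : (n : ℝ) - maxZeroCount M ≤ expCoeff Z j := by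
        rw [expCoeff, if_pos hj, Nat.cast_sub j.isLt.le]
        have : (j.val : ℝ) ≤ maxZeroCount M := by exact_mod_cast h1
        linarith
      rw [abscissa, div_lt_iff₀ h2] at hs
      have h4 : (expShift M Z j : ℝ) ≤ N := by exact_mod_cast expShift_le hL j
      have h5 : s.re * ((n : ℝ) - maxZeroCount M) ≤ s.re * expCoeff Z j :=
        mul_le_mul_of_nonneg_left h3 hs0.le
      linarith
    · rw [expShift, if_neg hj] at hpos
      exact absurd hpos (lt_irrefl 0)

theorem zeroCount_permCols (M : Matrix (Fin N) (Fin n) ℂ) (γ : Equiv.Perm (Fin n)) (i : Fin N) :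
    zeroCount (permCols M γ) i = zeroCount M i := by
  classical
  rw [zeroCount, zeroCount]
  refine Finset.card_bij (fun j _ => γ j) (fun j hj => ?_) (fun _ _ _ _ h => γ.injective h)
    fun j hj => ⟨γ.symm j, ?_, by simp⟩
  · exact Finset.mem_filter.mpr ⟨Finset.mem_univ _, (Finset.mem_filter.mp hj).2⟩
  · refine Finset.mem_filter.mpr ⟨Finset.mem_univ _, ?_⟩
    simpa [permCols] using (Finset.mem_filter.mp hj).2

theorem maxZeroCount_permCols (M : Matrix (Fin N) (Fin n) ℂ) (γ : Equiv.Perm (Fin n)) :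
    maxZeroCount (permCols M γ) = maxZeroCount M := by
  rw [maxZeroCount, maxZeroCount, funext (zeroCount_permCols M γ)]

theorem abscissa_permCols (M : Matrix (Fin N) (Fin n) ℂ) (γ : Equiv.Perm (Fin n)) :
    abscissa (permCols M γ) = abscissa M := by
  rw [abscissa, abscissa, maxZeroCount_permCols]

theorem HypothesisH.permCols (hM : HypothesisH M) (γ : Equiv.Perm (Fin n)) :
    HypothesisH (permCols M γ) :=
  ⟨fun i j => hM.1 i (γ j), fun i => (hM.2 i).imp' γ.symm fun j hj => by
    simpa [ShintaniBarnes.permCols] using hj⟩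

theorem hasLeading_permCols (hZ : ∀ i, zeroCount M i ≤ (Z : ℕ)) (γ : Equiv.Perm (Fin n)) :
    HasLeading (permCols M γ) Z :=
  hasLeading_of_zeroCount_le fun i => by rw [zeroCount_permCols]; exact hZ i

/-! ### Continuation and the value at `-ℓ` -/

/-- The multi-index `α`, with `α₁ = nℓ + N`. -/
def fullIndex (M : Matrix (Fin N) (Fin n) ℂ) (Z : Fin n) (ℓ : ℕ) (j : Fin n) : ℕ :=
  expCoeff Z j * ℓ + expShift M Z j

/-- The contribution of one sector to the value at `-ℓ`. -/
def sectorValue (Φ : ℂ → ℂ) (M : Matrix (Fin N) (Fin n) ℂ) (w : Fin n → ℂ) (Z : Fin n)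
    (ℓ : ℕ) : ℂ :=
  (-1) ^ (n * ℓ) * (ℓ.factorial : ℂ) ^ n / (∏ j, (expCoeff Z j : ℂ)) *
    (mixedPartial (fullIndex M Z ℓ) (regFun Φ M w Z) 0 /
      ∏ j, ((fullIndex M Z ℓ j).factorial : ℂ))

/-- The continuation is `Γ(s)^(-n)` times the sum over sectors. Distributing one `1/Γ(s)` to each of
the `n` Gamma factors of a sector gives a product of quotients that are regular at `-ℓ`. -/
theorem continuation_value (hΦ : IsAdmissible Φ) (hM : HypothesisH M)
    (hZ : ∀ i, zeroCount M i ≤ (Z : ℕ)) (hw : ∀ j, 0 < (w j).re) (ℓ : ℕ) {f : ℂ → ℂ}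
    (hint : ∀ s : ℂ, abscissa M < s.re →
      IntegrableOn (fun t : Fin n → ℝ => (∏ j, (t j : ℂ) ^ (s - 1)) *
        Complex.exp (-∑ j, w j * t j) *
        ∏ i, Φ (∑ j, M i j * t j) / (∑ j, M i j * t j)) (orthant n) ∧
      ∫ t in orthant n, (∏ j, (t j : ℂ) ^ (s - 1)) * Complex.exp (-∑ j, w j * t j) *
        ∏ i, Φ (∑ j, M i j * t j) / (∑ j, M i j * t j) = Complex.Gamma s ^ n * f s) :
    IsMeromorphicContinuation f (abscissa M) (continuation f (abscissa M)) ∧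
      AnalyticAt ℂ (continuation f (abscissa M)) (-(ℓ : ℂ)) ∧
      continuation f (abscissa M) (-(ℓ : ℂ)) =
        ∑ γ ∈ injections Z, sectorValue Φ (permCols M γ) (fun j => w (γ j)) Z ℓ := by
  have hn := maxZeroCount_lt hZ
  have hpos : ∀ (γ : Equiv.Perm (Fin n)) (s : ℂ), abscissa M < s.re → ∀ j,
      0 < ((expCoeff Z j : ℂ) * s - expShift (permCols M γ) Z j).re := fun γ s hs j =>
    re_exponent_pos (hasLeading_permCols hZ γ) (by rwa [maxZeroCount_permCols])
      (by rwa [abscissa_permCols]) j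
  choose E hE hEf hEv using fun γ : Equiv.Perm (Fin n) =>
    exists_entire_sector hΦ (hM.permCols γ) (hasLeading_permCols hZ γ) (fun j => hw (γ j))
      (hpos γ)
  choose A hA hAeq hAv using fun (γ : Equiv.Perm (Fin n)) (j : Fin n) =>
    exists_analyticAt_Gamma_ratio (expCoeff Z j) (expShift (permCols M γ) Z j) ℓ (expCoeff_pos Z j)
  have key := isMeromorphicContinuation_continuation (f := f) (c := abscissa M) (s₀ := -(ℓ : ℂ))
    (F := fun s => (Complex.Gamma s)⁻¹ ^ n * ∑ γ ∈ injections Z,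
      (∏ j, Complex.Gamma ((expCoeff Z j : ℂ) * s + -(expShift (permCols M γ) Z j : ℂ))) * E γ s)
    (A := fun s => ∑ γ ∈ injections Z, (∏ j, A γ j s) * E γ s)
    (by
      refine MeromorphicOn.fun_mul (fun s _ => ?_) (MeromorphicOn.fun_sum fun γ =>
        MeromorphicOn.fun_mul (MeromorphicOn.fun_prod fun j _ => meromorphicOn_Gamma_affine _ _)
          fun s _ => ((hE γ).analyticAt s).meromorphicAt)
      exact ((Complex.differentiable_one_div_Gamma.analyticAt s).pow n).meromorphicAt)
    (fun s hs => by
      refine AnalyticAt.fun_mul ((Complex.differentiable_one_div_Gamma.analyticAt s).pow n)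
        (Finset.analyticAt_fun_sum _ fun γ _ => AnalyticAt.fun_mul
          (Finset.analyticAt_fun_prod _ fun j _ => ?_) ((hE γ).analyticAt s))
      have h1 : DifferentiableOn ℂ (fun s => Complex.Gamma ((expCoeff Z j : ℂ) * s +
          -(expShift (permCols M γ) Z j : ℂ))) {s : ℂ | abscissa M < s.re} := by
        intro t ht
        have h2 := hpos γ t ht j
        rw [sub_eq_add_neg] at h2
        refine DifferentiableAt.differentiableWithinAt
          (DifferentiableAt.comp (g := Complex.Gamma) t (Complex.differentiableAt_Gamma _ ?_)
            (by fun_prop))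
        intro m hm
        rw [hm, Complex.neg_re, Complex.natCast_re] at h2
        have : (0 : ℝ) ≤ m := Nat.cast_nonneg m
        linarith
      exact h1.analyticAt
        ((isOpen_lt continuous_const Complex.continuous_re).mem_nhds hs))
    (fun s hs => by
      have hs0 : 0 < s.re := (abscissa_nonneg hn).trans_lt hs
      have hG : Complex.Gamma s ≠ 0 := Complex.Gamma_ne_zero_of_re_pos hs0
      obtain ⟨hi, he⟩ := hint s hs
      rw [integral_orthant_eq_sum_regFun (hasLeading_permCols hZ) Φ w s hi] at he
      simp only [hEf _ s hs] at he
      rw [he, ← mul_assoc, ← mul_pow, inv_mul_cancel₀ hG, one_pow, one_mul])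
    (Finset.analyticAt_fun_sum _ fun γ _ => AnalyticAt.fun_mul
      (Finset.analyticAt_fun_prod _ fun j _ => hA γ j) ((hE γ).analyticAt _))
    (by
      have h1 : ∀ᶠ s in 𝓝[≠] (-(ℓ : ℂ)), ∀ γ j, Complex.Gamma ((expCoeff Z j : ℂ) * s +
          -(expShift (permCols M γ) Z j : ℂ)) / Complex.Gamma s = A γ j s := by
        rw [eventually_all]
        intro γ
        rw [eventually_all]
        exact fun j => hAeq γ j
      filter_upwards [h1] with s hs
      simp only [← hs]
      rw [Finset.mul_sum]
      refine Finset.sum_congr rfl fun γ _ => ?_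
      simp only [div_eq_mul_inv]
      rw [Finset.prod_mul_distrib, Finset.prod_const, Finset.card_univ, Fintype.card_fin]
      ring)
  refine ⟨key.1, key.2.1, key.2.2.trans (Finset.sum_congr rfl fun γ _ => ?_)⟩
  simp only [hAv, hEv]
  rw [sectorValue]
  change _ = _ * (mixedPartial (fun j => expCoeff Z j * ℓ + expShift (permCols M γ) Z j) _ 0 /
    ∏ j, ((expCoeff Z j * ℓ + expShift (permCols M γ) Z j).factorial : ℂ))
  rw [Finset.prod_div_distrib, Finset.prod_mul_distrib, Finset.prod_mul_distrib,
    Finset.prod_mul_distrib, Finset.prod_pow_eq_pow_sum, Finset.prod_const, Finset.prod_const,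
    Finset.card_univ, Fintype.card_fin, ← pow_mul, mul_comm ℓ n]
  -- The sign `(-1)^(cⱼℓ + bⱼ)` arises twice, from the Gamma quotient and from the Riesz integral.
  -- Only `(-1)^ℓ` per variable is left.
  have hsq : ((-1 : ℂ) ^ ∑ j, (expCoeff Z j * ℓ + expShift (permCols M γ) Z j)) *
      (-1) ^ ∑ j, (expCoeff Z j * ℓ + expShift (permCols M γ) Z j) = 1 := by
    rw [← mul_pow]; norm_num
  rw [div_mul_eq_div_div]
  linear_combination ((-1 : ℂ) ^ (n * ℓ) * (ℓ.factorial : ℂ) ^ n / (∏ j, (expCoeff Z j : ℂ)) *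
    (mixedPartial (fun j => expCoeff Z j * ℓ + expShift (permCols M γ) Z j)
      (regFun Φ (permCols M γ) (fun j => w (γ j)) Z) 0 /
      ∏ j, ((expCoeff Z j * ℓ + expShift (permCols M γ) Z j).factorial : ℂ))) * hsq

/-! ### The series and the integral -/

theorem summable_zetaTerm (hM : HypothesisH M) (hn : maxZeroCount M < n)
    (hw : ∀ j, 0 < (w j).re) {s : ℂ} (hs : abscissa M < s.re) : Summable (zetaTerm M w s) := by
  have h := integrable_kernel (pos := fun k : ℕ => (k : ℝ)) hM hn hw hs
    (measurable_of_countable _) (Eventually.of_forall fun k => Nat.cast_nonneg k)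
    integrable_one_add_natCast_rpow
  rw [pi_count_eq_count, integrable_count_iff] at h
  exact Summable.of_norm h

theorem integral_kernel_eq_zetaSeries (hM : HypothesisH M) (hn : maxZeroCount M < n)
    (hw : ∀ j, 0 < (w j).re) {s : ℂ} (hs : abscissa M < s.re) :
    ∫ k : Fin N → ℕ, kernel M w s (fun i => (k i : ℝ)) ∂(Measure.pi fun _ => Measure.count) =
      zetaSeries M w s := by
  have h := integrable_kernel (pos := fun k : ℕ => (k : ℝ)) hM hn hw hs
    (measurable_of_countable _) (Eventually.of_forall fun k => Nat.cast_nonneg k)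
    integrable_one_add_natCast_rpow
  rw [pi_count_eq_count] at h ⊢
  rw [integral_countable h]
  simp only [Measure.real, Measure.count_singleton, ENNReal.toReal_one, one_smul]
  rfl

theorem integrableOn_kernel (hM : HypothesisH M) (hn : maxZeroCount M < n)
    (hw : ∀ j, 0 < (w j).re) {s : ℂ} (hs : abscissa M < s.re) :
    IntegrableOn (kernel M w s) (orthant N) := by
  rw [IntegrableOn, volume_restrict_orthant]
  exact integrable_kernel (pos := fun x : ℝ => x) (μ := halfMeasure) hM hn hw hs measurable_id
    (ae_halfMeasure_pos.mono fun _ h => h.le) integrable_one_add_rpow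

theorem zeta_value (hM : HypothesisH M) (hZ : ∀ i, zeroCount M i ≤ (Z : ℕ))
    (hw : ∀ j, 0 < (w j).re) (ℓ : ℕ) :
    IsMeromorphicContinuation (zetaSeries M w) (abscissa M) (zeta M w) ∧
      AnalyticAt ℂ (zeta M w) (-(ℓ : ℂ)) ∧ zeta M w (-(ℓ : ℂ)) =
        ∑ γ ∈ injections Z, sectorValue phi (permCols M γ) (fun j => w (γ j)) Z ℓ := by
  have hn := maxZeroCount_lt hZ
  refine continuation_value isAdmissible_phi hM hZ hw ℓ fun s hs => ?_
  have h := mellin_kernel (pos := fun k : ℕ => (k : ℝ)) (ρ := fun z => phi z / z) hM hn hw hs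
    (measurable_of_countable _) (Eventually.of_forall fun k => Nat.cast_nonneg k)
    integrable_one_add_natCast_rpow integral_count_exp_neg
  rwa [integral_kernel_eq_zetaSeries hM hn hw hs] at h

theorem zetaInt_value (hM : HypothesisH M) (hZ : ∀ i, zeroCount M i ≤ (Z : ℕ))
    (hw : ∀ j, 0 < (w j).re) (ℓ : ℕ) :
    IsMeromorphicContinuation (zetaIntegral M w) (abscissa M) (zetaInt M w) ∧
      AnalyticAt ℂ (zetaInt M w) (-(ℓ : ℂ)) ∧ zetaInt M w (-(ℓ : ℂ)) =
        ∑ γ ∈ injections Z, sectorValue (fun _ => 1) (permCols M γ) (fun j => w (γ j)) Z ℓ := by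
  have hn := maxZeroCount_lt hZ
  refine continuation_value isAdmissible_one hM hZ hw ℓ fun s hs => ?_
  have h := mellin_kernel (pos := fun x : ℝ => x) (ρ := fun z => 1 / z) (μ := halfMeasure)
    hM hn hw hs measurable_id (ae_halfMeasure_pos.mono fun _ h => h.le) integrable_one_add_rpow
    integral_half_exp_neg
  rw [zetaIntegral, volume_restrict_orthant N]
  exact h

end

section

variable {N n : ℕ} {Φ : ℂ → ℂ} {M : Matrix (Fin N) (Fin n) ℂ} {Z : Fin n} {w : Fin n → ℂ}

/-! ### The Leibniz rule in the first variable -/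

theorem iterate_partialDeriv_line (j : Fin n) (f : (Fin n → ℝ) → ℂ) (σ : Fin n → ℝ) (m : ℕ)
    (t : ℝ) : (partialDeriv j)^[m] f (σ + t • Pi.single j 1) =
      iteratedDeriv m (fun t : ℝ => f (σ + t • Pi.single j 1)) t := by
  induction m generalizing t with
  | zero => simp
  | succ m ih =>
    rw [Function.iterate_succ_apply', iteratedDeriv_succ, ← funext ih, partialDeriv, lineDeriv]
    have h := deriv_comp_const_add
      (fun t : ℝ => (partialDeriv j)^[m] f (σ + t • Pi.single j 1)) t 0
    rw [add_zero] at h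
    rw [← h]
    congr 1
    funext r
    rw [add_assoc, ← add_smul]

theorem partialDeriv_mul_of_ne {i j : Fin n} (hij : i ≠ j) (e : ℝ → ℂ) (h : (Fin n → ℝ) → ℂ) :
    partialDeriv i (fun σ => h σ * e (σ j)) = fun σ => partialDeriv i h σ * e (σ j) := by
  funext σ
  simp only [partialDeriv, lineDeriv, Pi.add_apply, Pi.smul_apply, Pi.single_eq_of_ne hij.symm,
    smul_zero, add_zero]
  exact deriv_mul_const_field _

theorem listPartial_mul_of_notMem {l : List (Fin n)} {j : Fin n} (hj : j ∉ l) (A : Fin n → ℕ)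
    (e : ℝ → ℂ) (h : (Fin n → ℝ) → ℂ) :
    listPartial l A (fun σ => h σ * e (σ j)) = fun σ => listPartial l A h σ * e (σ j) := by
  induction l with
  | nil => rfl
  | cons i l ih =>
    rw [List.mem_cons, not_or] at hj
    rw [listPartial_cons, listPartial_cons, ih hj.2]
    induction A i with
    | zero => rfl
    | succ m ihm =>
      rw [Function.iterate_succ_apply', ihm, partialDeriv_mul_of_ne (Ne.symm hj.1),
        Function.iterate_succ_apply']

theorem listPartial_index_congr {l : List (Fin n)} {A B : Fin n → ℕ} (hAB : ∀ i ∈ l, A i = B i)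
    (h : (Fin n → ℝ) → ℂ) : listPartial l A h = listPartial l B h := by
  induction l with
  | nil => rfl
  | cons i l ih =>
    rw [listPartial_cons, listPartial_cons, ih fun k hk => hAB k (List.mem_cons_of_mem i hk),
      hAB i List.mem_cons_self]

theorem iteratedDeriv_exp_neg_mul_ofReal (v : ℂ) (m : ℕ) :
    iteratedDeriv m (fun t : ℝ => Complex.exp (-(v * t))) =
      fun t : ℝ => (-v) ^ m * Complex.exp (-(v * t)) := by
  induction m with
  | zero => simp
  | succ m ih =>
    rw [iteratedDeriv_succ, ih]
    funext t
    have h : HasDerivAt (fun t : ℝ => Complex.exp (-(v * t)))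
        (Complex.exp (-(v * t)) * -(v * 1)) t :=
      (((hasDerivAt_id t).ofReal_comp.const_mul v).neg).cexp
    rw [(h.const_mul _).deriv]
    ring

/-- The exponential depends only on the first variable, and `List.finRange` with `foldr`
differentiates in that variable last. The other derivatives pass through the exponential, and the
one-variable Leibniz rule applies on the coordinate line. -/
theorem mixedPartial_mul_exp {U : Set (Fin n → ℝ)} (hU : IsOpen U) {H : (Fin n → ℝ) → ℂ}
    (hH : SmoothOn U H) (h0 : 0 ∈ U) {j : Fin n} (hj : j.val = 0) (A : Fin n → ℕ) (v : ℂ) :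
    mixedPartial A (fun σ => H σ * Complex.exp (-(v * σ j))) 0 =
      ∑ q ∈ Finset.range (A j + 1), ((A j).choose q : ℂ) *
        mixedPartial (Function.update A j q) H 0 * (-v) ^ (A j - q) := by
  obtain ⟨m, rfl⟩ : ∃ m, n = m + 1 := ⟨n - 1, by have := j.pos; omega⟩
  obtain rfl : j = 0 := Fin.ext hj
  set l := (List.finRange m).map Fin.succ with hl
  have hnot : (0 : Fin (m + 1)) ∉ l := by simp [hl, Fin.succ_ne_zero]
  have hcons : ∀ (B : Fin (m + 1) → ℕ) (h : (Fin (m + 1) → ℝ) → ℂ),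
      mixedPartial B h 0 = iteratedDeriv (B 0)
        (fun t : ℝ => listPartial l B h ((0 : Fin (m + 1) → ℝ) + t • Pi.single 0 1)) 0 := by
    intro B h
    rw [← iterate_partialDeriv_line, zero_smul, add_zero, mixedPartial_eq_listPartial,
      List.finRange_succ, listPartial_cons]
  have hK : ContDiffAt ℝ ∞ (listPartial l A H) ((0 : Fin (m + 1) → ℝ) + (0 : ℝ) • Pi.single 0 1) := by
    rw [zero_smul, add_zero]
    exact hH.listPartial hU l A 0 h0
  have hline : ContDiffAt ℝ (A 0 : WithTop ℕ∞) (fun t : ℝ =>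
      listPartial l A H ((0 : Fin (m + 1) → ℝ) + t • Pi.single 0 1)) 0 := by
    refine ContDiffAt.comp (g := listPartial l A H) (0 : ℝ) (hK.of_le (by exact_mod_cast le_top))
      (ContDiff.contDiffAt ?_)
    exact contDiff_const.add (contDiff_id.smul contDiff_const)
  have hexp : ContDiffAt ℝ (A 0 : WithTop ℕ∞) (fun t : ℝ => Complex.exp (-(v * t))) 0 :=
    ((contDiff_const.mul Complex.ofRealCLM.contDiff).neg.cexp).contDiffAt
  rw [hcons, listPartial_mul_of_notMem hnot A (fun x : ℝ => Complex.exp (-(v * x))) H]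
  have e1 : (fun t : ℝ => listPartial l A H ((0 : Fin (m + 1) → ℝ) + t • Pi.single 0 1) *
      Complex.exp (-(v * (((0 : Fin (m + 1) → ℝ) + t • Pi.single 0 1 : Fin (m + 1) → ℝ) 0 : ℝ)))) =
      (fun t : ℝ => listPartial l A H ((0 : Fin (m + 1) → ℝ) + t • Pi.single 0 1)) *
        fun t : ℝ => Complex.exp (-(v * t)) := by
    funext t
    simp
  rw [e1, iteratedDeriv_mul hline hexp]
  refine Finset.sum_congr rfl fun q _ => ?_
  rw [iteratedDeriv_exp_neg_mul_ofReal, hcons (Function.update A 0 q), Function.update_self,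
    listPartial_index_congr (A := Function.update A 0 q) (B := A) fun i hi => by
      rw [Function.update_of_ne (fun h : i = 0 => hnot (h ▸ hi))]]
  simp

/-! ### The finite formula -/

theorem expElem_regFun (F : IntermediateField ℚ ℂ) :
    ExpElem F Φ M Z fun w σ => regFun Φ M w Z σ := by
  simpa using expElem_regFun_mul_cutoff (F := F) (Φ := Φ) (M := M) (Z := Z) ∅ (by simp)

/-- The common form of `gFun` and `gTilde`. -/
def gGen (Φ : ℂ → ℂ) (M : Matrix (Fin N) (Fin n) ℂ) (w : Fin n → ℂ) (Z : Fin n)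
    (σ : Fin n → ℝ) : ℂ :=
  gFun M w Z σ * ∏ i, Φ (∑ j, M i j * (tOfSigma Z σ j : ℂ))

theorem exp_neg_sum_eq (w : Fin n → ℂ) (Z : Fin n) (σ : Fin n → ℝ) :
    Complex.exp (-∑ j, w j * (tOfSigma Z σ j : ℂ)) =
      (∏ j ∈ Finset.univ.filter (fun j : Fin n => j.val ≠ 0),
        Complex.exp (-(w j * (tOfSigma Z σ j : ℂ)))) *
        Complex.exp (-(w (firstIndex Z) * σ (firstIndex Z))) := by
  rw [← Finset.sum_neg_distrib, Complex.exp_sum,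
    ← Finset.mul_prod_erase Finset.univ _ (Finset.mem_univ (firstIndex Z)), tOfSigma_firstIndex,
    mul_comm]
  congr 1
  refine Finset.prod_congr ?_ fun _ _ => rfl
  ext j
  simp [firstIndex, Fin.ext_iff]

theorem regFun_eq_gGen_mul_exp (Φ : ℂ → ℂ) (M : Matrix (Fin N) (Fin n) ℂ) (w : Fin n → ℂ)
    (Z : Fin n) : regFun Φ M w Z =
      fun σ => gGen Φ M w Z σ * Complex.exp (-(w (firstIndex Z) * σ (firstIndex Z))) := by
  funext σ
  rw [regFun, gGen, gFun, exp_neg_sum_eq]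
  ring

/-- This function does not involve the first parameter, so it is `regFun` with that parameter set to
`0`; smoothness needs no positivity of the real parts. -/
theorem smoothOn_gGen (hΦ : IsAdmissible Φ) (hL : HasLeading M Z) :
    SmoothOn (regSet M Z) (gGen Φ M w Z) := by
  have h : gGen Φ M w Z = regFun Φ M (Function.update w (firstIndex Z) 0) Z := by
    rw [regFun_eq_gGen_mul_exp]
    funext σ
    rw [Function.update_self, zero_mul, neg_zero, Complex.exp_zero, mul_one, gGen, gGen, gFun,
      gFun]
    congr 2
    refine Finset.prod_congr rfl fun j hj => ?_
    rw [Function.update_of_ne]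
    rintro rfl
    simp [firstIndex] at hj
  rw [h]
  exact (expElem_regFun ⊤).smoothOn hL hΦ _

theorem fullIndex_firstIndex (hL : HasLeading M Z) (ℓ : ℕ) :
    fullIndex M Z ℓ (firstIndex Z) = n * ℓ + N := by
  have h1 : firstIndex Z ≤ Z := Nat.zero_le _
  have h2 : Finset.Icc (firstIndex Z) Z = Finset.Iic Z := by
    ext k
    simp only [Finset.mem_Icc, Finset.mem_Iic, and_iff_right_iff_imp]
    exact fun _ => Nat.zero_le _
  have h3 : expShift M Z (firstIndex Z) = N := by
    rw [expShift, if_pos h1, h2]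
    exact sum_card_leadingRows hL
  rw [fullIndex, h3, expCoeff, if_pos h1]
  rfl

theorem update_fullIndex (M : Matrix (Fin N) (Fin n) ℂ) (Z : Fin n) (ℓ q : ℕ) :
    Function.update (fullIndex M Z ℓ) (firstIndex Z) q = multiIndex M Z ℓ q := by
  funext j
  rcases eq_or_ne j (firstIndex Z) with rfl | hj
  · rw [Function.update_self, multiIndex, if_pos (show (firstIndex Z).val = 0 from rfl)]
  · have h0 : j.val ≠ 0 := fun h => hj (Fin.ext h)
    rw [Function.update_of_ne hj, multiIndex, if_neg h0, fullIndex, expCoeff, expShift]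
    split_ifs
    · rfl
    · simp

theorem prod_expCoeff (Z : Fin n) : ∏ j, (expCoeff Z j : ℂ) =
    ∏ j ∈ Finset.range (Z.val + 1), ((n : ℂ) - (j : ℂ)) := by
  have h1 : ∀ j : Fin n, (expCoeff Z j : ℂ) = if j.val < Z.val + 1 then (n : ℂ) - (j.val : ℂ)
      else 1 := fun j => by
    have : j ≤ Z ↔ j.val < Z.val + 1 := by rw [Fin.le_def]; omega
    simp only [expCoeff, this]
    split_ifs
    · rw [Nat.cast_sub j.isLt.le]
    · simp
  simp only [h1]
  rw [Fin.prod_univ_eq_prod_range (fun j => if j < Z.val + 1 then (n : ℂ) - (j : ℂ) else 1) n,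
    ← Finset.prod_filter]
  refine Finset.prod_congr ?_ fun _ _ => rfl
  ext j
  have := Z.isLt
  simp only [Finset.mem_filter, Finset.mem_range]
  omega

/-- In the first variable the binomial coefficient of the Leibniz rule cancels `(nℓ + N)!` and
leaves the two factorials of the formula. The factorials of the other variables are common to both
sides. -/
theorem sectorValue_eq (hΦ : IsAdmissible Φ) (hM : HypothesisH M) (hL : HasLeading M Z) (ℓ : ℕ) :
    sectorValue Φ M w Z ℓ =
      (-1) ^ N * (ℓ.factorial : ℂ) ^ n / (∏ j ∈ Finset.range (Z.val + 1), ((n : ℂ) - (j : ℂ))) *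
      ∑ q ∈ Finset.range (n * ℓ + N + 1),
        (-1) ^ q * w (firstIndex Z) ^ (n * ℓ + N - q) / ((n * ℓ + N - q).factorial : ℂ) *
          taylorCoeff M Z ℓ q (gGen Φ M w Z) := by
  have h := mixedPartial_mul_exp (isOpen_regSet M Z) (smoothOn_gGen (w := w) hΦ hL)
    (mem_regSet_of_nonneg hM Z fun _ => le_rfl) (j := firstIndex Z) rfl (fullIndex M Z ℓ)
    (w (firstIndex Z))
  simp only [fullIndex_firstIndex hL, update_fullIndex] at h
  rw [sectorValue, prod_expCoeff, regFun_eq_gGen_mul_exp, h, mul_div_assoc, mul_div_assoc,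
    mul_comm ((-1 : ℂ) ^ (n * ℓ)), mul_comm ((-1 : ℂ) ^ N), mul_assoc, mul_assoc]
  congr 1
  rw [Finset.sum_div, Finset.mul_sum, Finset.mul_sum]
  refine Finset.sum_congr rfl fun q hq => ?_
  have hq : q ≤ n * ℓ + N := Nat.lt_succ_iff.mp (Finset.mem_range.mp hq)
  set P := ∏ j ∈ Finset.univ.erase (firstIndex Z), ((fullIndex M Z ℓ j).factorial : ℂ) with hP
  have hP0 : P ≠ 0 := Finset.prod_ne_zero_iff.mpr fun j _ => by
    exact_mod_cast Nat.factorial_ne_zero _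
  have p1 : ∏ j, ((fullIndex M Z ℓ j).factorial : ℂ) = ((n * ℓ + N).factorial : ℂ) * P := by
    rw [← Finset.mul_prod_erase Finset.univ _ (Finset.mem_univ (firstIndex Z)),
      fullIndex_firstIndex hL]
  have p2 : ∏ j, ((multiIndex M Z ℓ q j).factorial : ℂ) = (q.factorial : ℂ) * P := by
    rw [← update_fullIndex,
      ← Finset.mul_prod_erase Finset.univ _ (Finset.mem_univ (firstIndex Z)),
      Function.update_self, hP]
    congr 1
    exact Finset.prod_congr rfl fun j hj => by
      rw [Function.update_of_ne (Finset.ne_of_mem_erase hj)]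
  rw [taylorCoeff, p1, p2]
  obtain ⟨r, hr⟩ := Nat.exists_eq_add_of_le hq
  have hr' : n * ℓ + N - q = r := by omega
  have hch : (((n * ℓ + N).choose q : ℕ) : ℂ) * (q.factorial : ℂ) * (r.factorial : ℂ) =
      ((n * ℓ + N).factorial : ℂ) := by
    rw [← hr']
    exact_mod_cast Nat.choose_mul_factorial_mul_factorial hq
  -- With `r = nℓ + N - q`, the four exponents add up to `2(nℓ + N)`.
  have hsign : (-1 : ℂ) ^ (n * ℓ) * (-1) ^ r = (-1) ^ N * (-1) ^ q := by
    have e1 : (-1 : ℂ) ^ (n * ℓ) * (-1) ^ r * ((-1) ^ N * (-1) ^ q) = 1 := by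
      rw [← pow_add, ← pow_add, ← pow_add]
      refine Even.neg_one_pow ⟨n * ℓ + N, by omega⟩
    have e2 : ((-1 : ℂ) ^ N * (-1) ^ q) * ((-1) ^ N * (-1) ^ q) = 1 := by
      rw [← pow_add, ← mul_pow]; norm_num
    linear_combination ((-1 : ℂ) ^ N * (-1) ^ q) * e1 - ((-1 : ℂ) ^ (n * ℓ) * (-1) ^ r) * e2
  have hf1 : ((n * ℓ + N).factorial : ℂ) ≠ 0 := by exact_mod_cast Nat.factorial_ne_zero _
  have hf2 : (q.factorial : ℂ) ≠ 0 := by exact_mod_cast Nat.factorial_ne_zero _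
  have hf3 : (r.factorial : ℂ) ≠ 0 := by exact_mod_cast Nat.factorial_ne_zero _
  have hdiv : (((n * ℓ + N).choose q : ℕ) : ℂ) / ((n * ℓ + N).factorial : ℂ) =
      (q.factorial : ℂ)⁻¹ * (r.factorial : ℂ)⁻¹ := by
    rw [div_eq_iff hf1, ← hch]
    field_simp
  rw [hr', neg_pow (w (firstIndex Z))]
  linear_combination (mixedPartial (multiIndex M Z ℓ q) (gGen Φ M w Z) 0 *
    w (firstIndex Z) ^ r * P⁻¹ * (-1) ^ (n * ℓ) * (-1) ^ r) * hdiv +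
    (mixedPartial (multiIndex M Z ℓ q) (gGen Φ M w Z) 0 * w (firstIndex Z) ^ r * P⁻¹ *
      (q.factorial : ℂ)⁻¹ * (r.factorial : ℂ)⁻¹) * hsign

theorem sum_sectorValue_eq (hΦ : IsAdmissible Φ) (hM : HypothesisH M)
    (hZ : ∀ i, zeroCount M i ≤ (Z : ℕ)) (w : Fin n → ℂ) (ℓ : ℕ) :
    ∑ γ ∈ injections Z, sectorValue Φ (permCols M γ) (fun j => w (γ j)) Z ℓ =
      finiteTaylorSum M w Z ℓ fun M' w' => gGen Φ M' w' Z := by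
  rw [finiteTaylorSum, Finset.mul_sum]
  exact Finset.sum_congr rfl fun γ _ =>
    sectorValue_eq hΦ (hM.permCols γ) (hasLeading_permCols hZ γ) ℓ

/-! ### Polynomiality -/

theorem exists_polynomial_sectorValue (hΦ : IsAdmissible Φ) (hM : HypothesisH M)
    (hL : HasLeading M Z) (ℓ : ℕ) {F : IntermediateField ℚ ℂ} (hF : ∀ i j, M i j ∈ F) :
    ∃ P : MvPolynomial (Fin n) F, ∀ w, sectorValue Φ M w Z ℓ = MvPolynomial.aeval w P := by
  obtain ⟨P, hP⟩ := ((expElem_regFun (Φ := Φ) (M := M) (Z := Z) F).mixedPartial hF hL hΦ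
    (fullIndex M Z ℓ)).exists_polynomial hM hF hΦ
  refine ⟨MvPolynomial.C ((-1) ^ (n * ℓ) * (ℓ.factorial : F) ^ n / (∏ j, (expCoeff Z j : F)) /
    ∏ j, ((fullIndex M Z ℓ j).factorial : F)) * P, fun w => ?_⟩
  have hP' : mixedPartial (fullIndex M Z ℓ) (regFun Φ M w Z) 0 = MvPolynomial.aeval w P := hP w
  rw [sectorValue, hP', map_mul, MvPolynomial.aeval_C]
  simp only [map_div₀, map_mul, map_pow, map_neg, map_one, map_natCast, map_prod]
  ring

/-- Permuting the columns does not leave the field of entries, and the permuted argument `w ∘ γ` is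
accounted for by renaming the variables of the polynomial of each sector. -/
theorem exists_polynomial_sum_sectorValue (hΦ : IsAdmissible Φ) (hM : HypothesisH M)
    (hZ : ∀ i, zeroCount M i ≤ (Z : ℕ)) (ℓ : ℕ) :
    ∃ P : MvPolynomial (Fin n) (entryField M), ∀ w : Fin n → ℂ,
      ∑ γ ∈ injections Z, sectorValue Φ (permCols M γ) (fun j => w (γ j)) Z ℓ =
        MvPolynomial.aeval w P := by
  have hF : ∀ i j, M i j ∈ entryField M := fun i j =>
    IntermediateField.subset_adjoin ℚ _ ⟨(i, j), rfl⟩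
  choose P hP using fun γ : Equiv.Perm (Fin n) => exists_polynomial_sectorValue hΦ
    (hM.permCols γ) (hasLeading_permCols hZ γ) ℓ (F := entryField M) fun i j => hF i (γ j)
  refine ⟨∑ γ ∈ injections Z, MvPolynomial.rename γ (P γ), fun w => ?_⟩
  rw [map_sum]
  refine Finset.sum_congr rfl fun γ _ => ?_
  rw [hP, MvPolynomial.aeval_rename]
  rfl

theorem gGen_phi : (fun (M' : Matrix (Fin N) (Fin n) ℂ) w' => gGen phi M' w' Z) =
    fun M' w' => gTilde M' w' Z := rfl

theorem gGen_one : (fun (M' : Matrix (Fin N) (Fin n) ℂ) w' => gGen (fun _ => 1) M' w' Z) =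
    fun M' w' => gFun M' w' Z := by
  funext M' w' σ
  simp [gGen]

end

end ShintaniBarnes

end

theorem theorem2 {N n : ℕ} (M : Matrix (Fin N) (Fin n) ℂ) (hM : ShintaniBarnes.HypothesisH M)
    (Z : Fin n) (hZ : ∀ i, ShintaniBarnes.zeroCount M i ≤ (Z : ℕ)) (ℓ : ℕ) :
    -- the Dirichlet series
    (∀ w : Fin n → ℂ, (∀ j, 0 < (w j).re) →
      (∀ s : ℂ, ShintaniBarnes.abscissa M < s.re →
        Summable (ShintaniBarnes.zetaTerm M w s)) ∧
      ShintaniBarnes.IsMeromorphicContinuation (ShintaniBarnes.zetaSeries M w)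
        (ShintaniBarnes.abscissa M) (ShintaniBarnes.zeta M w) ∧
      AnalyticAt ℂ (ShintaniBarnes.zeta M w) (-(ℓ : ℂ)) ∧
      ShintaniBarnes.zeta M w (-(ℓ : ℂ)) =
        ShintaniBarnes.finiteTaylorSum M w Z ℓ
          (fun M' w' => ShintaniBarnes.gTilde M' w' Z)) ∧
    -- the integral
    (∀ w : Fin n → ℂ, (∀ j, 0 < (w j).re) →
      (∀ s : ℂ, ShintaniBarnes.abscissa M < s.re →
        MeasureTheory.IntegrableOn (ShintaniBarnes.kernel M w s)
          (ShintaniBarnes.orthant N)) ∧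
      ShintaniBarnes.IsMeromorphicContinuation (ShintaniBarnes.zetaIntegral M w)
        (ShintaniBarnes.abscissa M) (ShintaniBarnes.zetaInt M w) ∧
      AnalyticAt ℂ (ShintaniBarnes.zetaInt M w) (-(ℓ : ℂ)) ∧
      ShintaniBarnes.zetaInt M w (-(ℓ : ℂ)) =
        ShintaniBarnes.finiteTaylorSum M w Z ℓ
          (fun M' w' => ShintaniBarnes.gFun M' w' Z)) ∧
    -- both values are polynomials in `w` over the field generated by the entries of `M`
    (∃ P : MvPolynomial (Fin n) (ShintaniBarnes.entryField M),
      ∀ w : Fin n → ℂ, (∀ j, 0 < (w j).re) →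
        ShintaniBarnes.zeta M w (-(ℓ : ℂ)) = MvPolynomial.aeval w P) ∧
    (∃ Q : MvPolynomial (Fin n) (ShintaniBarnes.entryField M),
      ∀ w : Fin n → ℂ, (∀ j, 0 < (w j).re) →
        ShintaniBarnes.zetaInt M w (-(ℓ : ℂ)) = MvPolynomial.aeval w Q) := by
  have hn := ShintaniBarnes.maxZeroCount_lt hZ
  refine ⟨fun w hw => ?_, fun w hw => ?_, ?_, ?_⟩
  · obtain ⟨h1, h2, h3⟩ := ShintaniBarnes.zeta_value hM hZ hw ℓ
    refine ⟨fun s hs => ShintaniBarnes.summable_zetaTerm hM hn hw hs, h1, h2, ?_⟩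
    rw [h3, ShintaniBarnes.sum_sectorValue_eq ShintaniBarnes.isAdmissible_phi hM hZ,
      ShintaniBarnes.gGen_phi]
  · obtain ⟨h1, h2, h3⟩ := ShintaniBarnes.zetaInt_value hM hZ hw ℓ
    refine ⟨fun s hs => ShintaniBarnes.integrableOn_kernel hM hn hw hs, h1, h2, ?_⟩
    rw [h3, ShintaniBarnes.sum_sectorValue_eq ShintaniBarnes.isAdmissible_one hM hZ,
      ShintaniBarnes.gGen_one]
  · obtain ⟨P, hP⟩ := ShintaniBarnes.exists_polynomial_sum_sectorValue
      ShintaniBarnes.isAdmissible_phi hM hZ ℓ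
    exact ⟨P, fun w hw => by rw [(ShintaniBarnes.zeta_value hM hZ hw ℓ).2.2, hP]⟩
  · obtain ⟨Q, hQ⟩ := ShintaniBarnes.exists_polynomial_sum_sectorValue
      ShintaniBarnes.isAdmissible_one hM hZ ℓ
    exact ⟨Q, fun w hw => by rw [(ShintaniBarnes.zetaInt_value hM hZ hw ℓ).2.2, hQ]⟩
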